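/- **Theorem 3.6.** Let $k$ be a field. Let $\operatorname{mod}(k)$ be the category of finite-dimensional $k$-vector spaces and $\operatorname{gr}(k[x])$ the category of finitely generated $\mathbb{Z}$-graded $k[x]$-modules ($\deg x=1$) with degree-preserving $k[x]$-linear maps. Let $\mathcal{C}$ (the "$\mathbb{Z}D_\infty$-category") be the pullback $$\operatorname{mod}(k)\oplus\operatorname{mod}(k)\longrightarrow \operatorname{mod}(k)\longleftarrow \operatorname{gr}(k[x]),$$ where the left functor sends $(V_0,V_1)$ to $V_0\oplus V_1$ and the right functor sends $M$ to $(M_x)_0$, the degree-zero part of the localization of $M$ at $x$. That is, an object of $\mathcal{C}$ is a finitely generated graded $k[x]$-module $M$ together with finite-dimensional vector spaces $V_0,V_1$ and an isomorphism $V_0\oplus V_1\cong (M_x)_0$, and a morphism is a triple of maps between the $M$'s, the $V_0$'s and the $V_1$'s compatible with these isomorphisms. This is a $k$-linear abelian category. Then $\mathcal{C}$ satisfies Serre duality. Explicitly: for all $X,Y\in\mathcal{C}$ the space $\bigoplus_{i\ge 0}\operatorname{Ext}^i_{\mathcal{C}}(X,Y)$ is finite-dimensional over $k$; for all $A,B$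 in the bounded derived category $D^b(\mathcal{C})$ the space $\bigoplus_{i\in\mathbb{Z}}\operatorname{Hom}_{D^b(\mathcal{C})}(A,B[i])$ is finite-dimensional over $k$; and there exist a $k$-linear auto-equivalence $F$ of $D^b(\mathcal{C})$ and $k$-linear isomorphisms $$\operatorname{Hom}_{D^b(\mathcal{C})}(A,B)\longrightarrow \operatorname{Hom}_{D^b(\mathcal{C})}(B,FA)^*$$ natural in $A,B\in D^b(\mathcal{C})$, where $(-)^*$ denotes the $k$-dual. -/

import Mathlib

open CategoryTheory CategoryTheory.Limits

universe w w' u v v₁ v₂ v₃ u₁ u₂ u₃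

namespace ZDInf

lemma isIso_map_comparison {P : Type u} [Category.{v} P] [Preadditive P]
    {A : Type u₁} [Category.{v₁} A] [Abelian A] [HasKernels P] [HasCokernels P]
    (F : P ⥤ A) [F.PreservesZeroMorphisms]
    [∀ {X Y : P} (f : X ⟶ Y), PreservesLimit (parallelPair f 0) F]
    [∀ {X Y : P} (f : X ⟶ Y), PreservesColimit (parallelPair f 0) F]
    {X Y : P} (f : X ⟶ Y) : IsIso (F.map (Abelian.coimageImageComparison f)) :=
  IsIso.of_isIso_fac_right (Abelian.PreservesCoimage.hom_coimageImageComparison F f).symm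

/-! ### The categorical pullback of exact functors between abelian categories is abelian

Mathlib's `CategoricalPullback L R` has as objects the triples `(a, b, L a ≅ R b)` and as morphisms
the compatible pairs of morphisms. All structure is componentwise. -/

section Pullback

variable {A : Type u₁} [Category.{v₁} A] {B : Type u₂} [Category.{v₂} B]
  {T : Type u₃} [Category.{v₃} T] {L : A ⥤ T} {R : B ⥤ T}

section Preadditive

variable [Preadditive A] [Preadditive B] [Preadditive T] [L.Additive] [R.Additive]
  {x y : CategoricalPullback L R}

instance : Zero (x ⟶ y) := ⟨⟨0, 0, by simp⟩⟩
instance : Add (x ⟶ y) := ⟨fun f g => ⟨f.fst + g.fst, f.snd + g.snd, by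
  simp [Functor.map_add, Preadditive.add_comp, Preadditive.comp_add]⟩⟩
instance : Neg (x ⟶ y) := ⟨fun f => ⟨-f.fst, -f.snd, by simp [Functor.map_neg]⟩⟩
instance : Sub (x ⟶ y) := ⟨fun f g => ⟨f.fst - g.fst, f.snd - g.snd, by
  simp [Functor.map_sub, Preadditive.sub_comp, Preadditive.comp_sub]⟩⟩
instance : SMul ℕ (x ⟶ y) := ⟨fun n f => ⟨n • f.fst, n • f.snd, by
  simp [Functor.map_nsmul, Preadditive.nsmul_comp, Preadditive.comp_nsmul]⟩⟩
instance : SMul ℤ (x ⟶ y) := ⟨fun n f => ⟨n • f.fst, n • f.snd, by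
  simp [Functor.map_zsmul, Preadditive.zsmul_comp, Preadditive.comp_zsmul]⟩⟩

def pairHom (f : x ⟶ y) : (x.fst ⟶ y.fst) × (x.snd ⟶ y.snd) := (f.fst, f.snd)

lemma pairHom_injective : Function.Injective (pairHom (x := x) (y := y)) := by
  intro f g h
  exact CategoricalPullback.hom_ext (congrArg Prod.fst h) (congrArg Prod.snd h)

instance : AddCommGroup (x ⟶ y) :=
  pairHom_injective.addCommGroup pairHom rfl (fun _ _ => rfl) (fun _ => rfl) (fun _ _ => rfl)
    (fun _ _ => rfl) (fun _ _ => rfl)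

instance : Preadditive (CategoricalPullback L R) where
  add_comp _ _ _ f f' g :=
    CategoricalPullback.hom_ext (Preadditive.add_comp _ _ _ f.fst f'.fst g.fst)
      (Preadditive.add_comp _ _ _ f.snd f'.snd g.snd)
  comp_add _ _ _ f g g' :=
    CategoricalPullback.hom_ext (Preadditive.comp_add _ _ _ f.fst g.fst g'.fst)
      (Preadditive.comp_add _ _ _ f.snd g.snd g'.snd)

instance : (CategoricalPullback.π₁ L R).Additive where
instance : (CategoricalPullback.π₂ L R).Additive where

variable {k : Type u} [Ring k] [Linear k A] [Linear k B] [Linear k T] [L.Linear k] [R.Linear k]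

instance : SMul k (x ⟶ y) := ⟨fun c f => ⟨c • f.fst, c • f.snd, by
  simp [Functor.map_smul, Linear.smul_comp, Linear.comp_smul]⟩⟩

def pairHomAdd : (x ⟶ y) →+ (x.fst ⟶ y.fst) × (x.snd ⟶ y.snd) where
  toFun := pairHom
  map_zero' := rfl
  map_add' _ _ := rfl

instance : Module k (x ⟶ y) :=
  Function.Injective.module k pairHomAdd pairHom_injective (fun _ _ => rfl)

instance : Linear k (CategoricalPullback L R) where
  smul_comp _ _ _ c f g :=
    CategoricalPullback.hom_ext (Linear.smul_comp _ _ _ c f.fst g.fst)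
      (Linear.smul_comp _ _ _ c f.snd g.snd)
  comp_smul _ _ _ f c g :=
    CategoricalPullback.hom_ext (Linear.comp_smul _ _ _ f.fst c g.fst)
      (Linear.comp_smul _ _ _ f.snd c g.snd)

end Preadditive

section Limits

variable {J : Type w} [Category.{w'} J] (K : J ⥤ CategoricalPullback L R)

def diagIso : (K ⋙ CategoricalPullback.π₁ L R) ⋙ L ≅ (K ⋙ CategoricalPullback.π₂ L R) ⋙ R :=
  NatIso.ofComponents (fun j => (K.obj j).iso) (fun f => (K.map f).w)

section

variable {K} {c₁ : Cone (K ⋙ CategoricalPullback.π₁ L R)}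
  {c₂ : Cone (K ⋙ CategoricalPullback.π₂ L R)} (h₁ : IsLimit c₁) (h₂ : IsLimit c₂)
  [PreservesLimit (K ⋙ CategoricalPullback.π₁ L R) L]
  [PreservesLimit (K ⋙ CategoricalPullback.π₂ L R) R]

noncomputable def conePtIso : L.obj c₁.pt ≅ R.obj c₂.pt :=
  IsLimit.conePointsIsoOfNatIso (isLimitOfPreserves L h₁) (isLimitOfPreserves R h₂) (diagIso K)

lemma conePtIso_hom_comp (j : J) :
    (conePtIso h₁ h₂).hom ≫ R.map (c₂.π.app j) = L.map (c₁.π.app j) ≫ (K.obj j).iso.hom :=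
  IsLimit.conePointsIsoOfNatIso_hom_comp (isLimitOfPreserves L h₁) (isLimitOfPreserves R h₂)
    (diagIso K) j

noncomputable def pullbackCone : Cone K where
  pt := ⟨c₁.pt, c₂.pt, conePtIso h₁ h₂⟩
  π :=
    { app j := ⟨c₁.π.app j, c₂.π.app j, (conePtIso_hom_comp h₁ h₂ j).symm⟩
      naturality _ _ f := CategoricalPullback.hom_ext (c₁.π.naturality f) (c₂.π.naturality f) }

noncomputable def isLimitPullbackCone : IsLimit (pullbackCone h₁ h₂) where
  lift s :=
    { fst := h₁.lift ((CategoricalPullback.π₁ L R).mapCone s)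
      snd := h₂.lift ((CategoricalPullback.π₂ L R).mapCone s)
      w := by
        refine (isLimitOfPreserves R h₂).hom_ext (fun j => ?_)
        have e1 : h₁.lift ((CategoricalPullback.π₁ L R).mapCone s) ≫ c₁.π.app j = (s.π.app j).fst :=
          h₁.fac _ j
        have e2 : h₂.lift ((CategoricalPullback.π₂ L R).mapCone s) ≫ c₂.π.app j = (s.π.app j).snd :=
          h₂.fac _ j
        have e3 := (s.π.app j).w
        have e4 := conePtIso_hom_comp h₁ h₂ j
        generalize h₁.lift ((CategoricalPullback.π₁ L R).mapCone s) = l₁ at e1 ⊢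
        generalize h₂.lift ((CategoricalPullback.π₂ L R).mapCone s) = l₂ at e2 ⊢
        change (L.map (X := s.pt.fst) l₁ ≫ (conePtIso h₁ h₂).hom) ≫ R.map (c₂.π.app j) =
          (s.pt.iso.hom ≫ R.map (X := s.pt.snd) l₂) ≫ R.map (c₂.π.app j)
        change L.map (s.π.app j).fst ≫ (K.obj j).iso.hom =
          s.pt.iso.hom ≫ R.map (s.π.app j).snd at e3
        rw [← e1, ← e2] at e3
        erw [Functor.map_comp, Functor.map_comp] at e3
        rw [Category.assoc, Category.assoc, e4]
        exact (Category.assoc _ _ _).symm.trans e3 }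
  fac s j := CategoricalPullback.hom_ext (h₁.fac _ j) (h₂.fac _ j)
  uniq s m hm := CategoricalPullback.hom_ext
    (h₁.uniq ((CategoricalPullback.π₁ L R).mapCone s) _
      (fun j => congrArg CategoricalPullback.Hom.fst (hm j)))
    (h₂.uniq ((CategoricalPullback.π₂ L R).mapCone s) _
      (fun j => congrArg CategoricalPullback.Hom.snd (hm j)))

end

variable [HasLimit (K ⋙ CategoricalPullback.π₁ L R)] [HasLimit (K ⋙ CategoricalPullback.π₂ L R)]
  [PreservesLimit (K ⋙ CategoricalPullback.π₁ L R) L]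
  [PreservesLimit (K ⋙ CategoricalPullback.π₂ L R) R]

lemma hasLimit_pullback : HasLimit K :=
  ⟨⟨_, isLimitPullbackCone (limit.isLimit (K ⋙ CategoricalPullback.π₁ L R))
    (limit.isLimit (K ⋙ CategoricalPullback.π₂ L R))⟩⟩

lemma preservesLimit_π₁ : PreservesLimit K (CategoricalPullback.π₁ L R) :=
  preservesLimit_of_preserves_limit_cone
    (isLimitPullbackCone (limit.isLimit (K ⋙ CategoricalPullback.π₁ L R))
      (limit.isLimit (K ⋙ CategoricalPullback.π₂ L R)))
    (limit.isLimit (K ⋙ CategoricalPullback.π₁ L R))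

lemma preservesLimit_π₂ : PreservesLimit K (CategoricalPullback.π₂ L R) :=
  preservesLimit_of_preserves_limit_cone
    (isLimitPullbackCone (limit.isLimit (K ⋙ CategoricalPullback.π₁ L R))
      (limit.isLimit (K ⋙ CategoricalPullback.π₂ L R)))
    (limit.isLimit (K ⋙ CategoricalPullback.π₂ L R))

end Limits

section Colimits

variable {J : Type w} [Category.{w'} J] (K : J ⥤ CategoricalPullback L R)

section

variable {K} {c₁ : Cocone (K ⋙ CategoricalPullback.π₁ L R)}
  {c₂ : Cocone (K ⋙ CategoricalPullback.π₂ L R)} (h₁ : IsColimit c₁) (h₂ : IsColimit c₂)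
  [PreservesColimit (K ⋙ CategoricalPullback.π₁ L R) L]
  [PreservesColimit (K ⋙ CategoricalPullback.π₂ L R) R]

noncomputable def coconePtIso : L.obj c₁.pt ≅ R.obj c₂.pt :=
  IsColimit.coconePointsIsoOfNatIso (isColimitOfPreserves L h₁) (isColimitOfPreserves R h₂)
    (diagIso K)

lemma comp_coconePtIso_hom (j : J) :
    L.map (c₁.ι.app j) ≫ (coconePtIso h₁ h₂).hom = (K.obj j).iso.hom ≫ R.map (c₂.ι.app j) :=
  IsColimit.comp_coconePointsIsoOfNatIso_hom (isColimitOfPreserves L h₁)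
    (isColimitOfPreserves R h₂) (diagIso K) j

noncomputable def pullbackCocone : Cocone K where
  pt := ⟨c₁.pt, c₂.pt, coconePtIso h₁ h₂⟩
  ι :=
    { app j := ⟨c₁.ι.app j, c₂.ι.app j, comp_coconePtIso_hom h₁ h₂ j⟩
      naturality _ _ f := CategoricalPullback.hom_ext (c₁.ι.naturality f) (c₂.ι.naturality f) }

noncomputable def isColimitPullbackCocone : IsColimit (pullbackCocone h₁ h₂) where
  desc s :=
    { fst := h₁.desc ((CategoricalPullback.π₁ L R).mapCocone s)
      snd := h₂.desc ((CategoricalPullback.π₂ L R).mapCocone s)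
      w := by
        refine (isColimitOfPreserves L h₁).hom_ext (fun j => ?_)
        have e1 : c₁.ι.app j ≫ h₁.desc ((CategoricalPullback.π₁ L R).mapCocone s) =
            (s.ι.app j).fst := h₁.fac _ j
        have e2 : c₂.ι.app j ≫ h₂.desc ((CategoricalPullback.π₂ L R).mapCocone s) =
            (s.ι.app j).snd := h₂.fac _ j
        have e3 := (s.ι.app j).w
        have e4 := comp_coconePtIso_hom h₁ h₂ j
        generalize h₁.desc ((CategoricalPullback.π₁ L R).mapCocone s) = l₁ at e1 ⊢
        generalize h₂.desc ((CategoricalPullback.π₂ L R).mapCocone s) = l₂ at e2 ⊢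
        change L.map (c₁.ι.app j) ≫ L.map (Y := s.pt.fst) l₁ ≫ s.pt.iso.hom =
          L.map (c₁.ι.app j) ≫ (coconePtIso h₁ h₂).hom ≫ R.map (Y := s.pt.snd) l₂
        change L.map (s.ι.app j).fst ≫ s.pt.iso.hom =
          (K.obj j).iso.hom ≫ R.map (s.ι.app j).snd at e3
        rw [← e1, ← e2] at e3
        erw [Functor.map_comp, Functor.map_comp] at e3
        rw [reassoc_of% e4]
        exact ((Category.assoc _ _ _).symm.trans e3).trans (Category.assoc _ _ _).symm }
  fac s j := CategoricalPullback.hom_ext (h₁.fac _ j) (h₂.fac _ j)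
  uniq s m hm := CategoricalPullback.hom_ext
    (h₁.uniq ((CategoricalPullback.π₁ L R).mapCocone s) _
      (fun j => congrArg CategoricalPullback.Hom.fst (hm j)))
    (h₂.uniq ((CategoricalPullback.π₂ L R).mapCocone s) _
      (fun j => congrArg CategoricalPullback.Hom.snd (hm j)))

end

variable [HasColimit (K ⋙ CategoricalPullback.π₁ L R)]
  [HasColimit (K ⋙ CategoricalPullback.π₂ L R)]
  [PreservesColimit (K ⋙ CategoricalPullback.π₁ L R) L]
  [PreservesColimit (K ⋙ CategoricalPullback.π₂ L R) R]

lemma hasColimit_pullback : HasColimit K :=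
  ⟨⟨_, isColimitPullbackCocone (colimit.isColimit (K ⋙ CategoricalPullback.π₁ L R))
    (colimit.isColimit (K ⋙ CategoricalPullback.π₂ L R))⟩⟩

lemma preservesColimit_π₁ : PreservesColimit K (CategoricalPullback.π₁ L R) :=
  preservesColimit_of_preserves_colimit_cocone
    (isColimitPullbackCocone (colimit.isColimit (K ⋙ CategoricalPullback.π₁ L R))
      (colimit.isColimit (K ⋙ CategoricalPullback.π₂ L R)))
    (colimit.isColimit (K ⋙ CategoricalPullback.π₁ L R))

lemma preservesColimit_π₂ : PreservesColimit K (CategoricalPullback.π₂ L R) :=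
  preservesColimit_of_preserves_colimit_cocone
    (isColimitPullbackCocone (colimit.isColimit (K ⋙ CategoricalPullback.π₁ L R))
      (colimit.isColimit (K ⋙ CategoricalPullback.π₂ L R)))
    (colimit.isColimit (K ⋙ CategoricalPullback.π₂ L R))

end Colimits

variable [Abelian A] [Abelian B] [Preadditive T] [L.Additive] [R.Additive]
  [PreservesFiniteLimits L] [PreservesFiniteLimits R]
  [PreservesFiniteColimits L] [PreservesFiniteColimits R]

instance (J : Type) [SmallCategory J] [FinCategory J] :
    HasLimitsOfShape J (CategoricalPullback L R) := ⟨fun K => hasLimit_pullback K⟩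

instance (J : Type) [SmallCategory J] [FinCategory J] :
    HasColimitsOfShape J (CategoricalPullback L R) := ⟨fun K => hasColimit_pullback K⟩

instance : HasFiniteLimits (CategoricalPullback L R) := ⟨fun _ => inferInstance⟩
instance : HasFiniteColimits (CategoricalPullback L R) := ⟨fun _ => inferInstance⟩

instance : PreservesFiniteLimits (CategoricalPullback.π₁ L R) :=
  ⟨fun _ => ⟨fun {K} => preservesLimit_π₁ K⟩⟩
instance : PreservesFiniteLimits (CategoricalPullback.π₂ L R) :=
  ⟨fun _ => ⟨fun {K} => preservesLimit_π₂ K⟩⟩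
instance : PreservesFiniteColimits (CategoricalPullback.π₁ L R) :=
  ⟨fun _ => ⟨fun {K} => preservesColimit_π₁ K⟩⟩
instance : PreservesFiniteColimits (CategoricalPullback.π₂ L R) :=
  ⟨fun _ => ⟨fun {K} => preservesColimit_π₂ K⟩⟩

instance {x y : CategoricalPullback L R} (f : x ⟶ y) :
    IsIso (Abelian.coimageImageComparison f) := by
  rw [CategoricalPullback.isIso_iff]
  exact ⟨isIso_map_comparison (CategoricalPullback.π₁ L R) f,
    isIso_map_comparison (CategoricalPullback.π₂ L R) f⟩

noncomputable instance : Abelian (CategoricalPullback L R) :=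
  Abelian.ofCoimageImageComparisonIsIso

end Pullback

/-! ### The product of two abelian categories is abelian (componentwise) -/

section Product

variable {A : Type u₁} [Category.{v₁} A] {B : Type u₂} [Category.{v₂} B]

instance [Preadditive A] [Preadditive B] : Preadditive (A × B) where
  homGroup x y := inferInstanceAs (AddCommGroup ((x.1 ⟶ y.1) × (x.2 ⟶ y.2)))
  add_comp _ _ _ f f' g :=
    Prod.ext (Preadditive.add_comp _ _ _ f.1 f'.1 g.1) (Preadditive.add_comp _ _ _ f.2 f'.2 g.2)
  comp_add _ _ _ f g g' :=
    Prod.ext (Preadditive.comp_add _ _ _ f.1 g.1 g'.1) (Preadditive.comp_add _ _ _ f.2 g.2 g'.2)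

instance (k : Type u) [Ring k] [Preadditive A] [Preadditive B] [Linear k A] [Linear k B] :
    Linear k (A × B) where
  homModule x y := inferInstanceAs (Module k ((x.1 ⟶ y.1) × (x.2 ⟶ y.2)))
  smul_comp _ _ _ c f g :=
    Prod.ext (Linear.smul_comp _ _ _ c f.1 g.1) (Linear.smul_comp _ _ _ c f.2 g.2)
  comp_smul _ _ _ f c g :=
    Prod.ext (Linear.comp_smul _ _ _ f.1 c g.1) (Linear.comp_smul _ _ _ f.2 c g.2)

instance [Preadditive A] [Preadditive B] : (CategoryTheory.Prod.fst A B).Additive where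
instance [Preadditive A] [Preadditive B] : (CategoryTheory.Prod.snd A B).Additive where

section Limits

variable {J : Type w} [Category.{w'} J] {K : J ⥤ A × B}

def prodCone (c₁ : Cone (K ⋙ CategoryTheory.Prod.fst A B))
    (c₂ : Cone (K ⋙ CategoryTheory.Prod.snd A B)) : Cone K where
  pt := (c₁.pt, c₂.pt)
  π :=
    { app j := (c₁.π.app j, c₂.π.app j)
      naturality _ _ f := Prod.ext (c₁.π.naturality f) (c₂.π.naturality f) }

def isLimitProdCone {c₁ : Cone (K ⋙ CategoryTheory.Prod.fst A B)}
    {c₂ : Cone (K ⋙ CategoryTheory.Prod.snd A B)} (h₁ : IsLimit c₁) (h₂ : IsLimit c₂) :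
    IsLimit (prodCone c₁ c₂) where
  lift s := (h₁.lift ((CategoryTheory.Prod.fst A B).mapCone s),
    h₂.lift ((CategoryTheory.Prod.snd A B).mapCone s))
  fac s j := Prod.ext (h₁.fac _ j) (h₂.fac _ j)
  uniq s m hm := Prod.ext
    (h₁.uniq ((CategoryTheory.Prod.fst A B).mapCone s) _ (fun j => congrArg Prod.fst (hm j)))
    (h₂.uniq ((CategoryTheory.Prod.snd A B).mapCone s) _ (fun j => congrArg Prod.snd (hm j)))

def prodCocone (c₁ : Cocone (K ⋙ CategoryTheory.Prod.fst A B))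
    (c₂ : Cocone (K ⋙ CategoryTheory.Prod.snd A B)) : Cocone K where
  pt := (c₁.pt, c₂.pt)
  ι :=
    { app j := (c₁.ι.app j, c₂.ι.app j)
      naturality _ _ f := Prod.ext (c₁.ι.naturality f) (c₂.ι.naturality f) }

def isColimitProdCocone {c₁ : Cocone (K ⋙ CategoryTheory.Prod.fst A B)}
    {c₂ : Cocone (K ⋙ CategoryTheory.Prod.snd A B)} (h₁ : IsColimit c₁) (h₂ : IsColimit c₂) :
    IsColimit (prodCocone c₁ c₂) where
  desc s := (h₁.desc ((CategoryTheory.Prod.fst A B).mapCocone s),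
    h₂.desc ((CategoryTheory.Prod.snd A B).mapCocone s))
  fac s j := Prod.ext (h₁.fac _ j) (h₂.fac _ j)
  uniq s m hm := Prod.ext
    (h₁.uniq ((CategoryTheory.Prod.fst A B).mapCocone s) _ (fun j => congrArg Prod.fst (hm j)))
    (h₂.uniq ((CategoryTheory.Prod.snd A B).mapCocone s) _ (fun j => congrArg Prod.snd (hm j)))

end Limits

variable [Abelian A] [Abelian B]

instance (J : Type) [SmallCategory J] [FinCategory J] : HasLimitsOfShape J (A × B) :=
  ⟨fun K => ⟨⟨_, isLimitProdCone (limit.isLimit (K ⋙ CategoryTheory.Prod.fst A B))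
    (limit.isLimit (K ⋙ CategoryTheory.Prod.snd A B))⟩⟩⟩

instance (J : Type) [SmallCategory J] [FinCategory J] : HasColimitsOfShape J (A × B) :=
  ⟨fun K => ⟨⟨_, isColimitProdCocone (colimit.isColimit (K ⋙ CategoryTheory.Prod.fst A B))
    (colimit.isColimit (K ⋙ CategoryTheory.Prod.snd A B))⟩⟩⟩

instance : HasFiniteLimits (A × B) := ⟨fun _ => inferInstance⟩
instance : HasFiniteColimits (A × B) := ⟨fun _ => inferInstance⟩

instance : PreservesFiniteLimits (CategoryTheory.Prod.fst A B) :=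
  ⟨fun _ => ⟨fun {K} => preservesLimit_of_preserves_limit_cone
    (isLimitProdCone (limit.isLimit (K ⋙ CategoryTheory.Prod.fst A B))
      (limit.isLimit (K ⋙ CategoryTheory.Prod.snd A B)))
    (limit.isLimit (K ⋙ CategoryTheory.Prod.fst A B))⟩⟩

instance : PreservesFiniteLimits (CategoryTheory.Prod.snd A B) :=
  ⟨fun _ => ⟨fun {K} => preservesLimit_of_preserves_limit_cone
    (isLimitProdCone (limit.isLimit (K ⋙ CategoryTheory.Prod.fst A B))
      (limit.isLimit (K ⋙ CategoryTheory.Prod.snd A B)))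
    (limit.isLimit (K ⋙ CategoryTheory.Prod.snd A B))⟩⟩

instance : PreservesFiniteColimits (CategoryTheory.Prod.fst A B) :=
  ⟨fun _ => ⟨fun {K} => preservesColimit_of_preserves_colimit_cocone
    (isColimitProdCocone (colimit.isColimit (K ⋙ CategoryTheory.Prod.fst A B))
      (colimit.isColimit (K ⋙ CategoryTheory.Prod.snd A B)))
    (colimit.isColimit (K ⋙ CategoryTheory.Prod.fst A B))⟩⟩

instance : PreservesFiniteColimits (CategoryTheory.Prod.snd A B) :=
  ⟨fun _ => ⟨fun {K} => preservesColimit_of_preserves_colimit_cocone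
    (isColimitProdCocone (colimit.isColimit (K ⋙ CategoryTheory.Prod.fst A B))
      (colimit.isColimit (K ⋙ CategoryTheory.Prod.snd A B)))
    (colimit.isColimit (K ⋙ CategoryTheory.Prod.snd A B))⟩⟩

instance {x y : A × B} (f : x ⟶ y) : IsIso (Abelian.coimageImageComparison f) := by
  rw [isIso_prod_iff]
  exact ⟨isIso_map_comparison (CategoryTheory.Prod.fst A B) f,
    isIso_map_comparison (CategoryTheory.Prod.snd A B) f⟩

noncomputable instance : Abelian (A × B) := Abelian.ofCoimageImageComparisonIsIso

end Product

/-! ### The three corners of the pullback diagram -/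

section Concrete

open Polynomial DirectSum

variable (k : Type u) [Field k]

/-- `mod(k)`: finite dimensional `k`-vector spaces. -/
abbrev Vec := FGModuleCat.{u} k

/-- The functor `mod(k) ⊕ mod(k) ⥤ mod(k)` sending `(V₁, V₂)` to `V₁ ⊕ V₂`. -/
noncomputable def sumFunctor : Vec k × Vec k ⥤ Vec k where
  obj V := FGModuleCat.of k (V.1 × V.2)
  map f := FGModuleCat.ofHom (f.1.hom.hom.prodMap f.2.hom.hom)

noncomputable def diagAdjSum : Functor.diag (Vec k) ⊣ sumFunctor k :=
  Adjunction.mkOfHomEquiv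
    { homEquiv X V :=
        { toFun f := FGModuleCat.ofHom (f.1.hom.hom.prod f.2.hom.hom)
          invFun g := (FGModuleCat.ofHom (LinearMap.fst k V.1 V.2 ∘ₗ g.hom.hom),
            FGModuleCat.ofHom (LinearMap.snd k V.1 V.2 ∘ₗ g.hom.hom))
          left_inv _ := rfl
          right_inv _ := rfl }
      homEquiv_naturality_left_symm _ _ := rfl
      homEquiv_naturality_right _ _ := rfl }

noncomputable def sumAdjDiag : sumFunctor k ⊣ Functor.diag (Vec k) :=
  Adjunction.mkOfHomEquiv
    { homEquiv V X :=
        { toFun g := (FGModuleCat.ofHom (g.hom.hom ∘ₗ LinearMap.inl k V.1 V.2),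
            FGModuleCat.ofHom (g.hom.hom ∘ₗ LinearMap.inr k V.1 V.2))
          invFun f := FGModuleCat.ofHom (f.1.hom.hom.coprod f.2.hom.hom)
          left_inv g := by
            apply (ModuleCat.isFG k).ι.map_injective
            exact ModuleCat.hom_ext (LinearMap.coprod_comp_inl_inr g.hom.hom)
          right_inv f := by
            refine Prod.ext ?_ ?_
            · apply (ModuleCat.isFG k).ι.map_injective
              exact ModuleCat.hom_ext (LinearMap.coprod_inl f.1.hom.hom f.2.hom.hom)
            · apply (ModuleCat.isFG k).ι.map_injective
              exact ModuleCat.hom_ext (LinearMap.coprod_inr f.1.hom.hom f.2.hom.hom) }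
      homEquiv_naturality_left_symm f g := by
        ext x
        rfl
      homEquiv_naturality_right f g := rfl }

instance : PreservesFiniteLimits (sumFunctor k) :=
  haveI := (diagAdjSum k).rightAdjoint_preservesLimits
  inferInstance
instance : PreservesFiniteColimits (sumFunctor k) :=
  haveI := (sumAdjDiag k).leftAdjoint_preservesColimits
  inferInstance
instance : (sumFunctor k).Additive where
  map_add := rfl
instance : (sumFunctor k).Linear k where
  map_smul _ _ := rfl

/-- `Gr(k[x])`: a `ℤ`-graded `k[x]`-module, with `x` in degree one, is a family of `k`-vector
spaces `M n` (`n : ℤ`) with `k`-linear maps `x : M n ⟶ M (n + 1)`, that is, a functor from the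
poset `ℤ` to `k`-vector spaces: `M n ⟶ M (n + j)` is multiplication by `x ^ j`. Morphisms are the
natural transformations, i.e. the `k[x]`-linear maps preserving degrees. -/
abbrev GrMod := ℤ ⥤ ModuleCat.{u} k

variable {k}

/-- Multiplication by `x` on the direct sum of all the graded pieces. -/
noncomputable def mulX (M : GrMod k) : Module.End k (⨁ n : ℤ, M.obj n) :=
  DirectSum.toModule k ℤ _ fun n =>
    DirectSum.lof k ℤ (fun n => M.obj n) (n + 1) ∘ₗ (M.map (homOfLE (by lia : n ≤ n + 1))).hom

/-- The `k[x]`-module underlying a graded `k[x]`-module: `⨁ n, M n` with `X` acting by `mulX`. -/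
abbrev Total (M : GrMod k) : Type u := Module.AEval' (mulX M)

lemma mulX_lof (M : GrMod k) (n : ℤ) (m : M.obj n) :
    mulX M (DirectSum.lof k ℤ (fun n => M.obj n) n m) =
      DirectSum.lof k ℤ (fun n => M.obj n) (n + 1)
        ((M.map (homOfLE (by lia : n ≤ n + 1))).hom m) := by
  simp [mulX]

noncomputable def sumMap {M N : GrMod k} (f : M ⟶ N) :
    (⨁ n : ℤ, M.obj n) →ₗ[k] (⨁ n : ℤ, N.obj n) :=
  DirectSum.lmap fun n => (f.app n).hom

lemma sumMap_mulX {M N : GrMod k} (f : M ⟶ N) (m : ⨁ n : ℤ, M.obj n) :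
    sumMap f (mulX M m) = mulX N (sumMap f m) := by
  suffices h : sumMap f ∘ₗ mulX M = mulX N ∘ₗ sumMap f from LinearMap.congr_fun h m
  ext n x : 2
  have := ConcreteCategory.congr_hom (f.naturality (homOfLE (by lia : n ≤ n + 1))) x
  simp only [LinearMap.comp_apply, mulX_lof, sumMap, DirectSum.lmap_lof]
  congr 1

noncomputable def totalMap {M N : GrMod k} (f : M ⟶ N) : Total M →ₗ[k[X]] Total N :=
  LinearMap.ofAEval _ ((Module.AEval'.of (mulX N)).toLinearMap ∘ₗ sumMap f) (fun m => by
    rw [LinearMap.comp_apply, LinearMap.comp_apply, Module.End.smul_def, sumMap_mulX]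
    exact (Module.AEval'.X_smul_of _ _).symm)

lemma totalMap_injective {M N : GrMod k} (f : M ⟶ N)
    (h : ∀ n, Function.Injective (f.app n).hom) : Function.Injective (totalMap f) :=
  (Module.AEval'.of (mulX N)).injective.comp
    (((DirectSum.lmap_injective _).2 h).comp (Module.AEval'.of (mulX M)).symm.injective)

lemma totalMap_surjective {M N : GrMod k} (f : M ⟶ N)
    (h : ∀ n, Function.Surjective (f.app n).hom) : Function.Surjective (totalMap f) :=
  (Module.AEval'.of (mulX N)).surjective.comp
    (((DirectSum.lmap_surjective _).2 h).comp (Module.AEval'.of (mulX M)).symm.surjective)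

variable (k) in
/-- A graded module is finitely generated if its underlying `k[x]`-module is. -/
def isFG : ObjectProperty (GrMod k) := fun M => Module.Finite k[X] (Total M)

instance : (isFG k).IsClosedUnderSubobjects where
  prop_of_mono {M N} f _ hN := by
    have : Module.Finite k[X] (Total N) := hN
    exact Module.Finite.of_injective (totalMap f) (totalMap_injective f fun n =>
      (ModuleCat.mono_iff_injective (f.app n)).1 inferInstance)

instance : (isFG k).IsClosedUnderQuotients where
  prop_of_epi {M N} f _ hM := by
    have : Module.Finite k[X] (Total M) := hM
    exact Module.Finite.of_surjective (totalMap f) (totalMap_surjective f fun n =>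
      (ModuleCat.epi_iff_surjective (f.app n)).1 inferInstance)

instance : (isFG k).IsClosedUnderFiniteProducts where
  isClosedUnderLimitsOfShape J _ := ⟨by
    rintro M ⟨p⟩
    have (j : J) : Module.Finite k[X] (Total (p.diag.obj ⟨j⟩)) := p.prop_diag_obj ⟨j⟩
    refine Module.Finite.of_injective (LinearMap.pi fun j : J => totalMap (p.π.app ⟨j⟩)) ?_
    rw [injective_iff_map_eq_zero]
    intro m hm
    obtain ⟨m, rfl⟩ := (Module.AEval'.of (mulX M)).surjective m
    have hm' (j : J) : sumMap (p.π.app ⟨j⟩) m = 0 :=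
      (Module.AEval'.of (mulX _)).injective (by
        rw [map_zero]; exact congrFun hm j)
    suffices h : m = 0 by rw [h, map_zero]
    refine DFinsupp.ext fun n => ?_
    refine Concrete.isLimit_ext _
      (isLimitOfPreserves ((evaluation ℤ (ModuleCat.{u} k)).obj n) p.isLimit) _ _ fun ⟨j⟩ => ?_
    have := congrArg (fun z => z n) (hm' j)
    exact this.trans (map_zero ((p.π.app ⟨j⟩).app n).hom).symm⟩

instance : (isFG k).ContainsZero where
  exists_zero := by
    obtain ⟨Z, hZ⟩ := HasZeroObject.zero (C := GrMod k)
    refine ⟨Z, hZ, ?_⟩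
    have : Subsingleton (⨁ n : ℤ, Z.obj n) := by
      refine ⟨fun a b => DFinsupp.ext fun n => ?_⟩
      have := ModuleCat.subsingleton_of_isZero
        (((evaluation ℤ (ModuleCat.{u} k)).obj n).map_isZero hZ)
      exact this.elim _ _
    have : Subsingleton (Total Z) := (Module.AEval'.of (mulX Z)).symm.injective.subsingleton
    exact inferInstanceAs (Module.Finite k[X] (Total Z))

variable (k) in
/-- `gr(k[x])`: finitely generated graded `k[x]`-modules. -/
abbrev FGGrMod := (isFG k).FullSubcategory

instance : PreservesFiniteLimits (isFG k).ι :=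
  haveI := (isFG k).preservesKernels_ι
  Functor.preservesFiniteLimits_of_preservesKernels _
instance : PreservesFiniteColimits (isFG k).ι :=
  haveI := (isFG k).preservesCokernels_ι
  Functor.preservesFiniteColimits_of_preservesCokernels _

instance : PreservesFiniteLimits (colim (J := ℤ) (C := ModuleCat.{u} k)) :=
  haveI : AB5OfSize.{0, 0} (ModuleCat.{u} k) := AB5OfSize_of_univLE.{0, 0, u, u} _
  inferInstance

instance : (colim (J := ℤ) (C := ModuleCat.{u} k)).Linear k where
  map_smul f r := by
    refine colimit.hom_ext fun n => ?_
    simp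

noncomputable def totalToColim (M : GrMod k) : (⨁ n : ℤ, M.obj n) →ₗ[k] (colimit M : ModuleCat.{u} k) :=
  DirectSum.toModule k ℤ _ fun n => (colimit.ι M n).hom

lemma totalToColim_mulX (M : GrMod k) (m : ⨁ n : ℤ, M.obj n) :
    totalToColim M (mulX M m) = totalToColim M m := by
  suffices h : totalToColim M ∘ₗ mulX M = totalToColim M from LinearMap.congr_fun h m
  ext n x : 2
  have := ConcreteCategory.congr_hom (colimit.w M (homOfLE (by lia : n ≤ n + 1))) x
  simp only [LinearMap.comp_apply, mulX_lof, totalToColim, DirectSum.toModule_lof]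
  exact this

lemma totalToColim_surjective (M : GrMod k) : Function.Surjective (totalToColim M) := by
  rw [← LinearMap.range_eq_top, ← Submodule.ker_mkQ (LinearMap.range (totalToColim M)),
    LinearMap.ker_eq_top]
  have h : ModuleCat.ofHom (LinearMap.range (totalToColim M)).mkQ = 0 := by
    refine colimit.hom_ext fun n => ?_
    ext m
    refine (Submodule.Quotient.mk_eq_zero _).2
      ⟨DirectSum.lof k ℤ (fun n => M.obj n) n m, ?_⟩
    simp [totalToColim]
    rfl
  exact congrArg ModuleCat.Hom.hom h

lemma totalToColim_smul (M : GrMod k) (p : k[X]) (m : Total M) :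
    totalToColim M ((Module.AEval'.of (mulX M)).symm (p • m)) =
      p.eval 1 • totalToColim M ((Module.AEval'.of (mulX M)).symm m) := by
  induction p using Polynomial.induction_on' with
  | add p q hp hq => rw [add_smul, map_add, map_add, hp, hq, eval_add, add_smul]
  | monomial n a =>
    rw [← C_mul_X_pow_eq_monomial, mul_smul, Module.AEval.C_smul, map_smul, map_smul]
    simp only [eval_mul, eval_C, eval_pow, eval_X, one_pow, mul_one]
    congr 1
    induction n with
    | zero => simp
    | succ n ih => 
      rw [pow_succ', mul_smul, Module.AEval'.of_symm_X_smul, totalToColim_mulX, ih]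

/-- `(M_x)₀` is finite dimensional when `M` is finitely generated. -/
lemma finite_colimit (M : GrMod k) (hM : isFG k M) :
    Module.Finite k (colimit M : ModuleCat.{u} k) := by
  classical
  obtain ⟨s, hs⟩ := hM
  let g : Total M → (colimit M : ModuleCat.{u} k) := fun m =>
    totalToColim M ((Module.AEval'.of (mulX M)).symm m)
  refine ⟨s.image g, eq_top_iff.2 fun y _ => ?_⟩
  obtain ⟨m, rfl⟩ := totalToColim_surjective M y
  have key (t : Total M) (ht : t ∈ Submodule.span k[X] (s : Set (Total M))) :
      g t ∈ Submodule.span k (↑(s.image g) : Set (colimit M : ModuleCat.{u} k)) := by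
    induction ht using Submodule.span_induction with
    | mem x hx => exact Submodule.subset_span (by simpa using ⟨x, hx, rfl⟩)
    | zero => simp [g]
    | add x y _ _ hx hy => simpa [g] using add_mem hx hy
    | smul p x _ hx =>
      change totalToColim M _ ∈ _
      rw [totalToColim_smul]
      exact Submodule.smul_mem _ _ hx
  simpa [g] using key (Module.AEval'.of (mulX M) m) (hs ▸ Submodule.mem_top)

variable (k) in
/-- The functor `gr(k[x]) ⥤ mod(k)`, `M ↦ (M_x)₀`: localize at `x` and take the degree zero part.
An element of `(M_x)₀` is a fraction `m / x ^ n` with `m` homogeneous of degree `n`, and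
`m / x ^ n = x m / x ^ (n + 1)`. So `(M_x)₀` is the colimit of the maps `x : M n ⟶ M (n + 1)`,
in which the class of `m : M n` stands for `m / x ^ n`. -/
noncomputable def locDegreeZero : FGGrMod k ⥤ Vec k :=
  (ModuleCat.isFG k).lift ((isFG k).ι ⋙ colim) fun M => finite_colimit M.obj M.property

instance : (locDegreeZero k).Additive where
  map_add {M N f g} := by
    apply (ModuleCat.isFG k).ι.map_injective
    exact ((isFG k).ι ⋙ colim (J := ℤ) (C := ModuleCat.{u} k)).map_add (f := f) (g := g)

instance : (locDegreeZero k).Linear k where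
  map_smul f r := by
    apply (ModuleCat.isFG k).ι.map_injective
    exact (colim (J := ℤ) (C := ModuleCat.{u} k)).map_smul r f.hom

instance : PreservesFiniteLimits (locDegreeZero k) where
  preservesFiniteLimits J _ _ := ⟨fun {K} =>
    haveI : PreservesLimit K (locDegreeZero k ⋙ (ModuleCat.isFG k).ι) :=
      inferInstanceAs (PreservesLimit K ((isFG k).ι ⋙ colim (J := ℤ) (C := ModuleCat.{u} k)))
    preservesLimit_of_reflects_of_preserves (locDegreeZero k) (ModuleCat.isFG k).ι⟩

instance : PreservesFiniteColimits (locDegreeZero k) where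
  preservesFiniteColimits J _ _ := ⟨fun {K} =>
    haveI : PreservesColimit K (locDegreeZero k ⋙ (ModuleCat.isFG k).ι) :=
      inferInstanceAs (PreservesColimit K ((isFG k).ι ⋙ colim (J := ℤ) (C := ModuleCat.{u} k)))
    preservesColimit_of_reflects_of_preserves (locDegreeZero k) (ModuleCat.isFG k).ι⟩

end Concrete

/-! ### The category and Serre duality -/

/-- The category `C`, i.e. the pullback of
`mod(k) ⊕ mod(k) ⥤ mod(k)`, `(V₁, V₂) ↦ V₁ ⊕ V₂`, and `gr(k[x]) ⥤ mod(k)`, `M ↦ (M_x)₀`. -/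
abbrev ZDCategory (k : Type u) [Field k] := CategoricalPullback (sumFunctor k) (locDegreeZero k)

section SerreDuality

open DirectSum

variable (k : Type u) [Field k]

/-- A Serre functor on a `k`-linear category `D`: a `k`-linear auto-equivalence `F` with
isomorphisms `Hom(A, B) ≃ Hom(B, F A)^*` natural in `A` and `B`. -/
structure SerreFunctor (D : Type u₁) [Category.{v₁} D] [Preadditive D] [Linear k D] where
  equiv : D ≌ D
  additive : equiv.functor.Additive
  linear : equiv.functor.Linear k
  iso (A B : D) : (A ⟶ B) ≃ₗ[k] Module.Dual k (B ⟶ equiv.functor.obj A)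
  naturality_left {A A' B : D} (f : A' ⟶ A) (g : A ⟶ B) (h : B ⟶ equiv.functor.obj A') :
    iso A' B (f ≫ g) h = iso A B g (h ≫ equiv.functor.map f)
  naturality_right {A B B' : D} (g : A ⟶ B) (f : B ⟶ B') (h : B' ⟶ equiv.functor.obj A) :
    iso A B' (g ≫ f) h = iso A B g (f ≫ h)

/-- A `k`-linear triangulated category is Ext-finite if `⨁ i, Hom(A, B[i])` is finite dimensional
for all `A` and `B`. -/
def TriangulatedExtFinite (D : Type u₁) [Category.{v₁} D] [Preadditive D] [Linear k D]
    [HasShift D ℤ] : Prop :=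
  ∀ A B : D, Module.Finite k (⨁ i : ℤ, (A ⟶ B⟦i⟧))

/-- A `k`-linear abelian category is Ext-finite if `⨁ i, Extⁱ(A, B)` is finite dimensional
for all `A` and `B`. -/
def AbelianExtFinite (C : Type u₁) [Category.{v₁} C] [Abelian C] [Linear k C]
    [HasExt.{w'} C] : Prop :=
  ∀ A B : C, Module.Finite k (⨁ i : ℕ, Abelian.Ext A B i)

/-- A `k`-linear triangulated category satisfies Serre duality if it is Ext-finite and has a
Serre functor. -/
def TriangulatedSerreDuality (D : Type u₁) [Category.{v₁} D] [Preadditive D] [Linear k D]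
    [HasShift D ℤ] : Prop :=
  TriangulatedExtFinite k D ∧ Nonempty (SerreFunctor k D)

/-- The bounded derived category of `C`. -/
abbrev BoundedDerivedCategory (C : Type u₁) [Category.{v₁} C] [Abelian C]
    [HasDerivedCategory.{w} C] :=
  (DerivedCategory.TStructure.t (C := C)).bounded.FullSubcategory

/-- A `k`-linear abelian category satisfies Serre duality if it is Ext-finite and its bounded
derived category satisfies Serre duality. -/
def SatisfiesSerreDuality (C : Type u₁) [Category.{v₁} C] [Abelian C] [Linear k C]
    [HasDerivedCategory.{w} C] [HasExt.{w'} C] : Prop :=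
  AbelianExtFinite.{w'} k C ∧ TriangulatedSerreDuality k (BoundedDerivedCategory C)

end SerreDuality

end ZDInf

/-! Write `F(n,j)` for `free k n j`, the module `k[x](-n)` whose localization lies entirely in
`V_j`, and `T[a,b)` for `torsion k a b`. Everything rests on these objects. `Hom(F(n,i), F(m,j))` is
a line if `i = j` and `m ≤ n`, and zero otherwise. `Ext¹(F(n,i), F(m,j))` is a line if `i ≠ j` and
`n < m`, and zero otherwise. Higher `Ext` vanishes. Hence `Hom(F(n,i), F(m,j))` and `Ext¹(F(m,j),
F(n+1,!i))` are nonzero under the same condition, and so are `Ext¹(F(n,i), F(m,j))` and `Hom(F(m,j),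
F(n+1,!i))`. Composition into the line `Ext¹(F(n,i), F(n+1,!i))` is nonzero on nonzero elements, so
`F(n+1,!i)[1]` is the Serre dual of `F(n,i)` (`mk₀_comp_ne_zero`, `comp_mk₀_ne_zero`,
`bijective_serrePairing_freeObj`).

The `Ext` groups are found without projective or injective resolutions. A class of positive degree
is killed by some monomorphism out of its target (`exists_mono_comp_mk₀_eq_zero`), and a
monomorphism out of `F(m,j)` can be continued to an inclusion into `F(a,j)` with `a` small
(`exists_comp_eq_freeIncl`). By `0 → F(m,j) → F(a,j) → T[a,m) → 0`, the class then comes from an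
`Ext` into `T[a,m)` of one degree less. In positive degree that group vanishes for `a` small
(`ext_torsion_eq_zero`); in degree zero one computes with homomorphisms.

The passage to all objects is formal. The `F(n,j)` generate the bounded derived category under
shifts and cones (`IsExactClosed.prop_of_free`, `IsConeClosed.prop_of_single`). Finiteness and
perfectness of the pairing spread along triangles by long exact sequences and the five lemma, and a
cone has the cone of the duals as a Serre dual (`IsSerreDual.cone`). A choice of duals is a fully
faithful functor. It is essentially surjective because the objects that are duals are also closed
under cones and contain the generators (`Generates.triangulatedSerreDuality`). -/

namespace ZDInf

/-! ### Monomorphisms that kill `Ext` classes of positive degree. -/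

section Effacement

open CategoryTheory.Abelian DerivedCategory HomologicalComplex

variable {C : Type u} [Category.{v} C] [Abelian C]

/-- As `L` starts in degree `i`, its cohomology there is a subobject of `L.X i`. The
quasi-isomorphism identifies `Y` with that cohomology, which gives `α`. Since `L` vanishes in degree
`i - 1`, projecting to the term of degree `i` is a chain map. -/
lemma exists_single_hom_comp_eq_map {L : CochainComplex C ℤ} {i : ℤ} [L.IsStrictlyGE i] {Y : C}
    (s : (single C (ComplexShape.up ℤ) i).obj Y ⟶ L) (hs : QuasiIso s) :
    ∃ (α : Y ⟶ L.X i) (_ : Mono α) (π : L ⟶ (single C (ComplexShape.up ℤ) i).obj (L.X i)),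
      s ≫ π = (single C (ComplexShape.up ℤ) i).map α := by
  let e := L.pOpcyclesIso (i - 1) i (by simp)
    ((L.isZero_of_isStrictlyGE i (i - 1) (by simp)).eq_of_src _ _)
  let α := (singleObjHomologySelfIso _ _ _).inv ≫ homologyMap s i ≫ L.homologyι i ≫ e.inv
  have hα : s.f i = (singleObjXSelf (ComplexShape.up ℤ) i Y).hom ≫ α := by
    rw [← cancel_mono e.hom]
    dsimp only [α]
    rw [Category.assoc, Category.assoc, Category.assoc, Category.assoc, Iso.inv_hom_id,
      Category.comp_id, show e.hom = L.pOpcycles i from rfl, homologyι_naturality,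
      singleObjHomologySelfIso_inv_homologyι_assoc,
      ← pOpcycles_singleObjOpcyclesSelfIso_inv_assoc, Iso.inv_hom_id_assoc, p_opcyclesMap]
  let π : L ⟶ (single C (ComplexShape.up ℤ) i).obj (L.X i) := mkHomToSingle (𝟙 _) (by
    rintro j rfl
    apply (L.isZero_of_isStrictlyGE (j + 1) j (by simp)).eq_of_src)
  have : Mono α := by dsimp [α]; infer_instance
  refine ⟨α, this, π, ?_⟩
  apply HomologicalComplex.to_single_hom_ext
  rw [comp_f, mkHomToSingle_f, hα, single_map_f_self]
  simp

/-- Represent `φ` by a fraction `K ⟶ L ⟵ Y` with `L` starting in degree `i`. After the projection of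
`L` to degree `i` the numerator vanishes, because `K` has no term in degree `i`. -/
lemma exists_mono_comp_eq_zero_of_singleFunctor [HasDerivedCategory.{w} C] {Y : C}
    {K : CochainComplex C ℤ} {i : ℤ}
    (φ : Q.obj K ⟶ Q.obj ((CochainComplex.singleFunctor C i).obj Y))
    (n : ℤ) (hn : i < n) [K.IsStrictlyGE n] :
    ∃ (Y' : C) (f : Y ⟶ Y') (_ : Mono f),
      φ ≫ Q.map ((CochainComplex.singleFunctor C i).map f) = 0 := by
  obtain ⟨L, _, g, s, h, rfl⟩ := left_fac_of_isStrictlyGE φ i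
  have : QuasiIso s := by rwa [isIso_Q_map_iff_quasiIso] at h
  obtain ⟨α, hα, π, h₁⟩ := exists_single_hom_comp_eq_map (Y := Y) s this
  have h₂ : g ≫ π = 0 := by
    apply HomologicalComplex.to_single_hom_ext
    apply (K.isZero_of_isStrictlyGE n i hn).eq_of_src
  have h₃ : inv (Q.map s) ≫ Q.map ((single C (ComplexShape.up ℤ) i).map α) = Q.map π := by
    rw [IsIso.inv_comp_eq]
    exact (congrArg Q.map h₁).symm.trans (Q.map_comp s π)
  refine ⟨L.X i, α, hα, ?_⟩
  refine (Category.assoc _ _ _).trans ((congrArg (Q.map g ≫ ·) h₃).trans ?_)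
  exact (Q.map_comp g π).symm.trans ((congrArg Q.map h₂).trans (Q.map_zero _ _))

/-- This takes the place of injective resolutions in the computation of `Ext`. -/
lemma exists_mono_comp_mk₀_eq_zero [HasExt.{w} C] {X Y : C} {n : ℕ} (e : Ext X Y (n + 1)) :
    ∃ (Y' : C) (f : Y ⟶ Y') (_ : Mono f), e.comp (Ext.mk₀ f) (add_zero _) = 0 := by
  let K := (CochainComplex.singleFunctor C 0).obj X
  have := K.isStrictlyGE_of_ge (-n) 0 (by lia)
  let := HasDerivedCategory.standard C
  -- The class is read as a map from `X` in degree `0`, hence in degrees at least `-n`, to `Y`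
  -- placed in degree `-(n + 1)`.
  obtain ⟨Y', f, hf, hf'⟩ := exists_mono_comp_eq_zero_of_singleFunctor (K := K) (Y := Y)
    (i := -(n + 1))
    (e.hom ≫ ((singleFunctors C).shiftIso (n + 1) (-(n + 1)) 0 (by lia)).hom.app _) (-n) (by lia)
  refine ⟨Y', f, hf, Ext.homEquiv.injective ?_⟩
  let σ := (singleFunctors C).shiftIso (n + 1) (-(n + 1)) 0 (by lia)
  have h₁ : (e.comp (Ext.mk₀ f) (add_zero _)).hom =
      e.hom ≫ ((singleFunctor C 0).map f)⟦((n + 1 : ℕ) : ℤ)⟧' :=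
    (Ext.hom_comp_singleFunctor_map_shift e f).symm
  have h₂ : (e.hom ≫ ((singleFunctor C 0).map f)⟦((n + 1 : ℕ) : ℤ)⟧') ≫ σ.hom.app Y' = 0 :=
    ((Category.assoc _ _ _).trans ((congrArg (e.hom ≫ ·) (σ.hom.naturality f)).trans
      (Category.assoc _ _ _).symm)).trans hf'
  refine (h₁.trans ?_).trans (Ext.zero_hom _ _ _).symm
  exact (cancel_mono (σ.hom.app Y')).1 (h₂.trans zero_comp.symm)

end Effacement

/-! ### Serre duals of single objects. -/

section SerreDual

open Pretriangulated

variable {k : Type u} [Field k] {D : Type u₁} [Category.{v₁} D] [Preadditive D] [Linear k D]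

/-- The map `Hom(A, B) ⟶ Hom(B, S)^*` given by composition and a functional on `Hom(A, S)`. -/
def serrePairing {A S : D} (η : (A ⟶ S) →ₗ[k] k) (B : D) :
    (A ⟶ B) →ₗ[k] Module.Dual k (B ⟶ S) :=
  (LinearMap.llcomp k (B ⟶ S) (A ⟶ S) k η) ∘ₗ Linear.comp A B S

@[simp]
lemma serrePairing_apply {A S : D} (η : (A ⟶ S) →ₗ[k] k) {B : D} (f : A ⟶ B) (g : B ⟶ S) :
    serrePairing η B f g = η (f ≫ g) := rfl

/-- `S`, together with `η`, represents the functor `Hom(A, -)^*`. -/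
def IsSerreDual (A S : D) (η : (A ⟶ S) →ₗ[k] k) : Prop :=
  ∀ B : D, Function.Bijective (serrePairing η B)

/-- For finite-dimensional spaces the flipped pairing is the transpose of the original one, up to
biduality. In this form morphisms into `S` are functionals on morphisms out of `A`, which gives
uniqueness and functoriality of duals. -/
lemma IsSerreDual.bijective_flip [∀ X Y : D, Module.Finite k (X ⟶ Y)] {A S : D}
    {η : (A ⟶ S) →ₗ[k] k} (h : IsSerreDual A S η) (B : D) :
    Function.Bijective (serrePairing η B).flip := by
  have : (serrePairing η B).flip =
      (LinearEquiv.ofBijective _ (h B)).toLinearMap.dualMap ∘ₗ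
        (Module.evalEquiv k (B ⟶ S)).toLinearMap := by
    ext g f
    rfl
  rw [this]
  exact ((LinearEquiv.ofBijective _ (h B)).dualMap.bijective).comp
    (Module.evalEquiv k (B ⟶ S)).bijective

lemma IsSerreDual.exists_comp_eq [∀ X Y : D, Module.Finite k (X ⟶ Y)] {A S : D}
    {η : (A ⟶ S) →ₗ[k] k} (h : IsSerreDual A S η) {B : D} (φ : (A ⟶ B) →ₗ[k] k) :
    ∃ g : B ⟶ S, ∀ f : A ⟶ B, η (f ≫ g) = φ f := by
  obtain ⟨g, hg⟩ := (h.bijective_flip B).2 φ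
  exact ⟨g, fun f => LinearMap.congr_fun hg f⟩

lemma IsSerreDual.hom_ext [∀ X Y : D, Module.Finite k (X ⟶ Y)] {A S : D}
    {η : (A ⟶ S) →ₗ[k] k} (h : IsSerreDual A S η) {B : D} {g g' : B ⟶ S}
    (hg : ∀ f : A ⟶ B, η (f ≫ g) = η (f ≫ g')) : g = g' :=
  (h.bijective_flip B).1 (LinearMap.ext hg)

lemma IsSerreDual.of_iso {A S A' S' : D} {η : (A ⟶ S) →ₗ[k] k} (h : IsSerreDual A S η)
    (a : A ≅ A') (s : S ≅ S') :
    IsSerreDual A' S' (η ∘ₗ Linear.rightComp k A s.inv ∘ₗ Linear.leftComp k S' a.hom) := by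
  intro B
  constructor
  · rw [injective_iff_map_eq_zero]
    intro f hf
    have : a.hom ≫ f = 0 := by
      rw [← map_eq_zero_iff _ (h B).1]
      ext g
      have := LinearMap.congr_fun hf (g ≫ s.hom)
      simpa using this
    simpa using this
  · intro φ
    obtain ⟨f, hf⟩ := (h B).2 (φ ∘ₗ Linear.rightComp k B s.hom)
    refine ⟨a.inv ≫ f, ?_⟩
    ext g
    have := LinearMap.congr_fun hf (g ≫ s.inv)
    simpa using this

/-- Used for the shift functors. The formula for `η'` is kept because the dual of a cone compares
pairings before and after a shift. -/
lemma IsSerreDual.map (F : D ⥤ D) [F.IsEquivalence] [F.Additive] [F.Linear k]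
    {A S : D} {η : (A ⟶ S) →ₗ[k] k} (h : IsSerreDual A S η) :
    ∃ η' : (F.obj A ⟶ F.obj S) →ₗ[k] k,
      IsSerreDual (F.obj A) (F.obj S) η' ∧ ∀ f : A ⟶ S, η' (F.map f) = η f := by
  let e := (LinearEquiv.ofBijective (F.mapLinearMap k (X := A) (Y := S))
        ⟨F.map_injective, F.map_surjective⟩)
  have he (f : A ⟶ S) : (η ∘ₗ e.symm.toLinearMap) (F.map f) = η f :=
    congrArg η (e.symm_apply_apply f)
  refine ⟨η ∘ₗ e.symm.toLinearMap, ?_, he⟩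
  intro B
  obtain ⟨B', ⟨i⟩⟩ : ∃ B', Nonempty (F.obj B' ≅ B) := ⟨_, ⟨F.objObjPreimageIso B⟩⟩
  constructor
  · rw [injective_iff_map_eq_zero]
    intro f hf
    obtain ⟨f', hf'⟩ := F.map_surjective (f ≫ i.inv)
    have : f' = 0 := by
      rw [← map_eq_zero_iff _ (h B').1]
      ext g
      have := LinearMap.congr_fun hf (i.inv ≫ F.map g)
      rw [serrePairing_apply, ← Category.assoc, ← hf', ← F.map_comp, he] at this
      exact this
    rw [← cancel_mono i.inv, ← hf', this]
    simp
  · intro φ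
    obtain ⟨f, hf⟩ := (h B').2 (φ ∘ₗ Linear.leftComp k _ i.inv ∘ₗ F.mapLinearMap k)
    refine ⟨F.map f ≫ i.hom, ?_⟩
    ext g
    obtain ⟨g', hg'⟩ := F.map_surjective (i.hom ≫ g)
    have := LinearMap.congr_fun hf g'
    rw [serrePairing_apply, Category.assoc, ← hg', ← F.map_comp, he]
    simpa [hg'] using this

end SerreDual

/-! ### Duals of exact sequences and gluing of functionals. -/

section LinearAlgebra

variable {k X Y V : Type*} [Field k] [AddCommGroup X] [Module k X] [AddCommGroup Y] [Module k Y]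
  [AddCommGroup V] [Module k V]

lemma exact_dualMap {α : X →ₗ[k] V} {β : V →ₗ[k] Y} (h : Function.Exact α β) :
    Function.Exact β.dualMap α.dualMap := by
  rw [LinearMap.exact_iff, LinearMap.range_dualMap_eq_dualAnnihilator_ker,
    LinearMap.ker_dualMap_eq_dualAnnihilator_range, LinearMap.exact_iff.1 h]

/-- The functional `(a, -b)` vanishes on the kernel of `(α, -β)`, so over a field it factors through
that map. -/
lemma exists_functional (α : X →ₗ[k] V) (β : Y →ₗ[k] V) (a : X →ₗ[k] k) (b : Y →ₗ[k] k)
    (h : ∀ x y, α x = β y → a x = b y) :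
    ∃ η : V →ₗ[k] k, (∀ x, η (α x) = a x) ∧ ∀ y, η (β y) = b y := by
  have : a.coprod (-b) ∈ LinearMap.range (α.coprod (-β)).dualMap := by
    rw [LinearMap.range_dualMap_eq_dualAnnihilator_ker, Submodule.mem_dualAnnihilator]
    rintro ⟨x, y⟩ hxy
    have := h x y (by simpa [sub_eq_zero, ← sub_eq_add_neg] using hxy)
    simp [this]
  obtain ⟨η, hη⟩ := this
  refine ⟨η, fun x => ?_, fun y => ?_⟩
  · simpa using LinearMap.congr_fun hη (x, 0)
  · simpa using LinearMap.congr_fun hη (0, y)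

end LinearAlgebra

/-! ### Long exact `Hom` sequences of a distinguished triangle. -/

section Triangles

open Pretriangulated

variable (k : Type u) [Field k] {D : Type u₁} [Category.{v₁} D] [Preadditive D] [Linear k D]
  [HasZeroObject D] [HasShift D ℤ] [∀ n : ℤ, (shiftFunctor D n).Additive] [Pretriangulated D]

lemma yoneda_exact_shift {T : Triangle D} (hT : T ∈ distTriang D) {X : D}
    (f : T.obj₁⟦(1 : ℤ)⟧ ⟶ X) (hf : T.mor₃ ≫ f = 0) : ∃ g, f = T.mor₁⟦(1 : ℤ)⟧' ≫ g := by
  obtain ⟨g, hg⟩ : ∃ g : T.obj₂⟦(1 : ℤ)⟧ ⟶ X, f = (-(T.mor₁⟦(1 : ℤ)⟧')) ≫ g :=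
    Triangle.yoneda_exact₂ _ (rot_of_distTriang _ (rot_of_distTriang _ hT)) f hf
  exact ⟨-g, by rw [hg, Preadditive.neg_comp, Preadditive.comp_neg]⟩

variable {T : Triangle D} (hT : T ∈ distTriang D) (X : D)

include hT

lemma exact_yoneda_obj₂ :
    Function.Exact (Linear.leftComp k X T.mor₂) (Linear.leftComp k X T.mor₁) := by
  refine fun f => ⟨fun hf => ?_, ?_⟩
  · obtain ⟨g, rfl⟩ := Triangle.yoneda_exact₂ _ hT f hf
    exact ⟨g, rfl⟩
  · rintro ⟨g, rfl⟩
    simp [comp_distTriang_mor_zero₁₂_assoc _ hT]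

lemma exact_yoneda_obj₃ :
    Function.Exact (Linear.leftComp k X T.mor₃) (Linear.leftComp k X T.mor₂) := by
  refine fun f => ⟨fun hf => ?_, ?_⟩
  · obtain ⟨g, rfl⟩ := Triangle.yoneda_exact₃ _ hT f hf
    exact ⟨g, rfl⟩
  · rintro ⟨g, rfl⟩
    simp [comp_distTriang_mor_zero₂₃_assoc _ hT]

lemma exact_yoneda_shift :
    Function.Exact (Linear.leftComp k X (T.mor₁⟦(1 : ℤ)⟧')) (Linear.leftComp k X T.mor₃) := by
  refine fun f => ⟨fun hf => ?_, ?_⟩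
  · obtain ⟨g, rfl⟩ := yoneda_exact_shift hT f hf
    exact ⟨g, rfl⟩
  · rintro ⟨g, rfl⟩
    simp [comp_distTriang_mor_zero₃₁_assoc _ hT]

lemma exact_coyoneda_obj₂ :
    Function.Exact (Linear.rightComp k X T.mor₁) (Linear.rightComp k X T.mor₂) := by
  refine fun f => ⟨fun hf => ?_, ?_⟩
  · obtain ⟨g, rfl⟩ := Triangle.coyoneda_exact₂ _ hT f hf
    exact ⟨g, rfl⟩
  · rintro ⟨g, rfl⟩
    simp [comp_distTriang_mor_zero₁₂ _ hT]

lemma exact_coyoneda_obj₃ :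
    Function.Exact (Linear.rightComp k X T.mor₂) (Linear.rightComp k X T.mor₃) := by
  refine fun f => ⟨fun hf => ?_, ?_⟩
  · obtain ⟨g, rfl⟩ := Triangle.coyoneda_exact₃ _ hT f hf
    exact ⟨g, rfl⟩
  · rintro ⟨g, rfl⟩
    simp [comp_distTriang_mor_zero₂₃ _ hT]

lemma exact_coyoneda_shift :
    Function.Exact (Linear.rightComp k X T.mor₃) (Linear.rightComp k X (T.mor₁⟦(1 : ℤ)⟧')) := by
  refine fun f => ⟨fun hf => ?_, ?_⟩
  · obtain ⟨g, rfl⟩ := Triangle.coyoneda_exact₁ _ hT f hf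
    exact ⟨g, rfl⟩
  · rintro ⟨g, rfl⟩
    simp [comp_distTriang_mor_zero₃₁ _ hT]

end Triangles

/-! ### Serre pairings and cones. -/

section SerreDual

open Pretriangulated

variable {k : Type u} [Field k] {D : Type u₁} [Category.{v₁} D] [Preadditive D] [Linear k D]
  [HasZeroObject D] [HasShift D ℤ] [∀ n : ℤ, (shiftFunctor D n).Additive] [Pretriangulated D]

/-- For fixed `η` the pairing is natural in its test object, so the five lemma applies to the
sequence of `Hom(A, -)` and the dual of that of `Hom(-, S)`. -/
lemma bijective_serrePairing_obj₃ {T : Triangle D} (hT : T ∈ distTriang D) {A S : D}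
    (η : (A ⟶ S) →ₗ[k] k)
    (h₁ : Function.Bijective (serrePairing η T.obj₁))
    (h₂ : Function.Bijective (serrePairing η T.obj₂))
    (h₁' : Function.Bijective (serrePairing η (T.obj₁⟦(1 : ℤ)⟧)))
    (h₂' : Function.Bijective (serrePairing η (T.obj₂⟦(1 : ℤ)⟧))) :
    Function.Bijective (serrePairing η T.obj₃) := by
  refine LinearMap.bijective_of_surjective_of_bijective_of_bijective_of_injective
    (Linear.rightComp k A T.mor₁) (Linear.rightComp k A T.mor₂) (Linear.rightComp k A T.mor₃)
    (Linear.rightComp k A (T.mor₁⟦(1 : ℤ)⟧'))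
    (Linear.leftComp k S T.mor₁).dualMap (Linear.leftComp k S T.mor₂).dualMap
    (Linear.leftComp k S T.mor₃).dualMap (Linear.leftComp k S (T.mor₁⟦(1 : ℤ)⟧')).dualMap
    _ _ _ _ _ ?_ ?_ ?_ ?_ (exact_coyoneda_obj₂ k hT A) (exact_coyoneda_obj₃ k hT A)
    (exact_coyoneda_shift k hT A) (exact_dualMap (exact_yoneda_obj₂ k hT S))
    (exact_dualMap (exact_yoneda_obj₃ k hT S)) (exact_dualMap (exact_yoneda_shift k hT S))
    h₁.2 h₂ h₁' h₂'.1
  all_goals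
    ext f g
    simp

lemma exact_neg_right {X Y Z : Type*} [AddCommGroup X] [AddCommGroup Y] [AddCommGroup Z]
    [Module k X] [Module k Y] [Module k Z] {f : X →ₗ[k] Y} {g : Y →ₗ[k] Z}
    (h : Function.Exact f g) : Function.Exact f (-g) := fun y => by
  simpa using h y

lemma exact_neg_left {X Y Z : Type*} [AddCommGroup X] [AddCommGroup Y] [AddCommGroup Z]
    [Module k X] [Module k Y] [Module k Z] {f : X →ₗ[k] Y} {g : Y →ₗ[k] Z}
    (h : Function.Exact f g) : Function.Exact (-f) g := by
  rw [LinearMap.exact_iff] at h ⊢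
  rw [h, LinearMap.range_neg]

variable [∀ n : ℤ, (shiftFunctor D n).Linear k]

/-- The cone of a morphism of objects having Serre duals has a Serre dual, namely the cone of the
corresponding morphism of the duals. -/
lemma IsSerreDual.cone {T T' : Triangle D} (hT : T ∈ distTriang D) (hT' : T' ∈ distTriang D)
    {η₁ : (T.obj₁ ⟶ T'.obj₁) →ₗ[k] k} {η₂ : (T.obj₂ ⟶ T'.obj₂) →ₗ[k] k}
    (h₁ : IsSerreDual T.obj₁ T'.obj₁ η₁) (h₂ : IsSerreDual T.obj₂ T'.obj₂ η₂)
    (comm : ∀ g : T.obj₂ ⟶ T'.obj₁, η₂ (g ≫ T'.mor₁) = η₁ (T.mor₁ ≫ g)) :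
    ∃ η₃ : (T.obj₃ ⟶ T'.obj₃) →ₗ[k] k, IsSerreDual T.obj₃ T'.obj₃ η₃ := by
  obtain ⟨η₁', h₁', e₁⟩ := h₁.map (shiftFunctor D (1 : ℤ))
  obtain ⟨η₂', h₂', e₂⟩ := h₂.map (shiftFunctor D (1 : ℤ))
  have comm' (g : T.obj₂⟦(1 : ℤ)⟧ ⟶ T'.obj₁⟦(1 : ℤ)⟧) :
      η₂' (g ≫ T'.mor₁⟦(1 : ℤ)⟧') = η₁' (T.mor₁⟦(1 : ℤ)⟧' ≫ g) := by
    obtain ⟨g, rfl⟩ := (shiftFunctor D (1 : ℤ)).map_surjective g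
    rw [← Functor.map_comp, ← Functor.map_comp, e₁, e₂, comm]
  -- The functional on `Hom(T.obj₃, T'.obj₃)` has to match `η₂` on maps factoring through `T'.mor₂`
  -- and `η₁'` on maps factoring through `T.mor₃`. The minus sign cancels the one produced by
  -- rotating triangles.
  obtain ⟨η₃, h, h'⟩ := exists_functional
    (Linear.rightComp k T.obj₃ T'.mor₂) (Linear.leftComp k T'.obj₃ T.mor₃)
    (η₂ ∘ₗ Linear.leftComp k _ T.mor₂) (-(η₁' ∘ₗ Linear.rightComp k _ T'.mor₃)) (by
      intro x y hxy
      -- A map lying in both families gives a commutative square between rotated triangles. Its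
      -- completion `w` turns both prescribed values into `η₁ (T.mor₁ ≫ w)`.
      obtain ⟨w, hw, hw'⟩ : ∃ w : T.obj₂⟦(1 : ℤ)⟧ ⟶ T'.obj₁⟦(1 : ℤ)⟧,
          (-(T.mor₁⟦(1 : ℤ)⟧')) ≫ w = y ≫ T'.mor₃ ∧
            (-(T.mor₂⟦(1 : ℤ)⟧')) ≫ x⟦(1 : ℤ)⟧' = w ≫ (-(T'.mor₁⟦(1 : ℤ)⟧')) :=
        complete_distinguished_triangle_morphism _ _
          (rot_of_distTriang _ (rot_of_distTriang _ hT)) (rot_of_distTriang _ hT') x y hxy.symm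
      obtain ⟨w, rfl⟩ := (shiftFunctor D (1 : ℤ)).map_surjective w
      have e : T.mor₂ ≫ x = w ≫ T'.mor₁ := by
        apply (shiftFunctor D (1 : ℤ)).map_injective
        simpa using hw'
      have e' : y ≫ T'.mor₃ = -(T.mor₁ ≫ w)⟦(1 : ℤ)⟧' := by
        simpa using hw.symm
      simp only [LinearMap.comp_apply, Linear.leftComp_apply, LinearMap.neg_apply,
        Linear.rightComp_apply, e, e', comm, map_neg, e₁, neg_neg])
  simp only [Linear.rightComp_apply, Linear.leftComp_apply, LinearMap.comp_apply,
    LinearMap.neg_apply] at h h'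
  refine ⟨η₃, fun B => ?_⟩
  -- Five lemma in the test object `B`. The sign in the choice of `η₃` appears as one negated map in
  -- the dual row, which leaves exactness unchanged.
  refine LinearMap.bijective_of_surjective_of_bijective_of_bijective_of_injective
    (Linear.leftComp k B (T.mor₁⟦(1 : ℤ)⟧')) (Linear.leftComp k B T.mor₃)
    (Linear.leftComp k B T.mor₂) (Linear.leftComp k B T.mor₁)
    (Linear.rightComp k B (T'.mor₁⟦(1 : ℤ)⟧')).dualMap (-(Linear.rightComp k B T'.mor₃).dualMap)
    (Linear.rightComp k B T'.mor₂).dualMap (Linear.rightComp k B T'.mor₁).dualMap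
    (serrePairing η₂' B) (serrePairing η₁' B) _ (serrePairing η₂ B) (serrePairing η₁ B)
    ?_ ?_ ?_ ?_ (exact_yoneda_shift k hT B) (exact_yoneda_obj₃ k hT B) (exact_yoneda_obj₂ k hT B)
    (exact_neg_right (exact_dualMap (exact_coyoneda_shift k hT' B)))
    (exact_neg_left (exact_dualMap (exact_coyoneda_obj₃ k hT' B)))
    (exact_dualMap (exact_coyoneda_obj₂ k hT' B))
    (h₂' B).2 (h₁' B) (h₂ B) (h₁ B).1
  · ext f g
    simpa using comm' (f ≫ g)
  · ext f g
    simp [h']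
  · ext f g
    simpa using h (f ≫ g)
  · ext f g
    simpa using comm (f ≫ g)

end SerreDual

/-! ### Finiteness along exact sequences and direct sums. -/

section LinearAlgebra

variable {k : Type*} [Field k]

lemma finite_of_exact {X Y Z : Type*} [AddCommGroup X] [AddCommGroup Y] [AddCommGroup Z]
    [Module k X] [Module k Y] [Module k Z] (f : X →ₗ[k] Y) (g : Y →ₗ[k] Z)
    (h : Function.Exact f g) [Module.Finite k X] [Module.Finite k Z] : Module.Finite k Y := by
  have : Module.Finite k (LinearMap.ker g) := by
    rw [h.linearMap_ker_eq]
    infer_instance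
  have := Module.Finite.equiv g.quotKerEquivRange.symm
  exact Module.Finite.of_submodule_quotient (LinearMap.ker g)

lemma nontrivial_of_exact {X Y Z : Type*} [AddCommGroup X] [AddCommGroup Y] [AddCommGroup Z]
    [Module k X] [Module k Y] [Module k Z] (f : X →ₗ[k] Y) (g : Y →ₗ[k] Z)
    (h : Function.Exact f g) [Nontrivial Y] : Nontrivial X ∨ Nontrivial Z := by
  by_contra! H
  obtain ⟨_, _⟩ := H
  obtain ⟨y, hy⟩ := exists_ne (0 : Y)
  obtain ⟨x, rfl⟩ := (h y).1 (Subsingleton.elim _ _)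
  exact hy (by rw [Subsingleton.elim x 0, map_zero])

lemma finite_directSum {ι : Type*} {M : ι → Type*} [∀ i, AddCommGroup (M i)]
    [∀ i, Module k (M i)] [∀ i, Module.Finite k (M i)] (h : {i | Nontrivial (M i)}.Finite) :
    Module.Finite k (DirectSum ι M) := by
  classical
  let _ := h.fintype
  let f : (∀ i : {i | Nontrivial (M i)}, M i) →ₗ[k] DirectSum ι M :=
    ∑ i : {i | Nontrivial (M i)}, DirectSum.lof k ι M i ∘ₗ
      LinearMap.proj (φ := fun i : {i | Nontrivial (M i)} => M i) i
  refine Module.Finite.of_surjective f fun x => ⟨fun i => x i, ?_⟩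
  refine DFinsupp.ext fun i => ?_
  by_cases hi : Nontrivial (M i)
  · have : f (fun i => x i) i = ∑ j : {i | Nontrivial (M i)}, (DirectSum.lof k ι M j (x j)) i := by
      simp only [f, LinearMap.sum_apply, LinearMap.comp_apply, LinearMap.proj_apply]
      exact DFinsupp.finsetSum_apply _ _ _
    rw [this, Finset.sum_eq_single ⟨i, hi⟩]
    · exact DirectSum.lof_apply ..
    · intro j _ hj
      exact DirectSum.of_eq_of_ne _ _ _ fun e => hj (Subtype.ext e.symm)
    · simp
  · have := not_nontrivial_iff_subsingleton.1 hi
    exact Subsingleton.elim _ _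

end LinearAlgebra

/-! ### From duals of generators to a Serre functor. -/

section SerreFunctor

open Pretriangulated

variable {k : Type u} [Field k] {D : Type u₁} [Category.{v₁} D] [Preadditive D] [Linear k D]

section

variable [∀ X Y : D, Module.Finite k (X ⟶ Y)] {S : D → D}
  {η : ∀ A : D, (A ⟶ S A) →ₗ[k] k} (h : ∀ A, IsSerreDual A (S A) (η A))

/-- The morphism between Serre duals which is induced by a morphism. -/
noncomputable def serreMap {A A' : D} (f : A ⟶ A') : S A ⟶ S A' :=
  ((h A').exists_comp_eq (η A ∘ₗ Linear.leftComp k _ f)).choose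

lemma comp_serreMap {A A' : D} (f : A ⟶ A') (g : A' ⟶ S A) :
    η A' (g ≫ serreMap h f) = η A (f ≫ g) :=
  ((h A').exists_comp_eq (η A ∘ₗ Linear.leftComp k _ f)).choose_spec g

lemma serreMap_add {A B : D} (f g : A ⟶ B) :
    serreMap h (f + g) = serreMap h f + serreMap h g :=
  (h B).hom_ext fun t => by
    simp only [comp_serreMap, Preadditive.comp_add, Preadditive.add_comp, map_add]

lemma serreMap_smul {A B : D} (r : k) (f : A ⟶ B) :
    serreMap h (r • f) = r • serreMap h f :=
  (h B).hom_ext fun t => by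
    simp only [comp_serreMap, Linear.comp_smul, Linear.smul_comp, map_smul]

/-- The Serre functor obtained from a choice of Serre duals. -/
noncomputable def serreFunctorOfDuals : D ⥤ D where
  obj := S
  map f := serreMap h f
  map_id A := (h A).hom_ext fun f => by simp [comp_serreMap]
  map_comp {A B C} f g := (h C).hom_ext fun t => by
    rw [comp_serreMap, ← Category.assoc t, comp_serreMap, ← Category.assoc g t, comp_serreMap]
    simp

instance : (serreFunctorOfDuals h).Additive where
  map_add := serreMap_add h _ _

instance : (serreFunctorOfDuals h).Linear k where
  map_smul f r := serreMap_smul h r f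

/-- Following `serreMap` by the flipped pairing of `B` gives the pairing of `A`. Two of these three
maps are bijective, hence so is the third. -/
lemma serreMap_bijective (A B : D) :
    Function.Bijective (fun f : A ⟶ B => serreMap h f) := by
  have e : ((serrePairing (η B) (S A)).flip ∘ fun f : A ⟶ B => serreMap h f) =
      serrePairing (η A) B := by
    ext f g
    exact comp_serreMap h f g
  rw [← Function.Bijective.of_comp_iff' ((h B).bijective_flip (S A)), e]
  exact h A B

include h in
lemma nonempty_serreFunctor (hS : ∀ B : D, ∃ A : D, Nonempty (S A ≅ B)) :
    Nonempty (SerreFunctor k D) := by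
  let F := serreFunctorOfDuals h
  have : F.Full := ⟨fun f => (serreMap_bijective h _ _).2 f⟩
  have : F.Faithful := ⟨fun e => (serreMap_bijective h _ _).1 e⟩
  have : F.EssSurj := ⟨fun B => hS B⟩
  have : F.IsEquivalence := { }
  exact ⟨{
    equiv := F.asEquivalence
    additive := inferInstanceAs F.Additive
    linear := inferInstanceAs (F.Linear k)
    iso A B := LinearEquiv.ofBijective _ (h A B)
    naturality_left {A A' B} f g := fun (t : B ⟶ S A') => by
      change η A' ((f ≫ g) ≫ t) = η A (g ≫ t ≫ serreMap h f)
      rw [← Category.assoc g t, comp_serreMap, Category.assoc]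
    naturality_right {A B B'} g f := fun (t : B' ⟶ S A) => by
      change η _ ((g ≫ f) ≫ t) = η _ (g ≫ f ≫ t)
      rw [Category.assoc] }⟩

end

variable [HasZeroObject D] [HasShift D ℤ] [∀ n : ℤ, (shiftFunctor D n).Additive]
  [Pretriangulated D]

/-- A class of objects closed under isomorphisms, shifts and cones. -/
structure IsConeClosed (P : D → Prop) : Prop where
  iso {X Y : D} (e : X ≅ Y) (h : P X) : P Y
  shift {X : D} (n : ℤ) (h : P X) : P (X⟦n⟧)
  cone {T : Triangle D} (hT : T ∈ distTriang D) (h₁ : P T.obj₁) (h₂ : P T.obj₂) : P T.obj₃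

/-- The objects `G i` generate a triangulated category under shifts and cones. -/
def Generates {ι : Type*} (G : ι → D) : Prop :=
  ∀ P : D → Prop, IsConeClosed P → (∀ i, P (G i)) → ∀ X, P X

variable [∀ n : ℤ, (shiftFunctor D n).Linear k]

variable (k) in
/-- The graded space `⨁ i, Hom(A, B[i])` is finite dimensional. -/
def ExtFinitePair (A B : D) : Prop :=
  (∀ n : ℤ, Module.Finite k (A ⟶ B⟦n⟧)) ∧ {n : ℤ | Nontrivial (A ⟶ B⟦n⟧)}.Finite

/-- Postcomposition with an isomorphism. -/
def homCongrRight (k : Type u) [Field k] [Linear k D] (A : D) {B B' : D} (e : B ≅ B') :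
    (A ⟶ B) ≃ₗ[k] (A ⟶ B') :=
  LinearEquiv.ofLinearMap (Linear.rightComp k A e.hom) (Linear.rightComp k A e.inv)
    (by ext; simp) (by ext; simp)

/-- Precomposition with an isomorphism. -/
def homCongrLeft (k : Type u) [Field k] [Linear k D] {A A' : D} (B : D) (e : A ≅ A') :
    (A' ⟶ B) ≃ₗ[k] (A ⟶ B) :=
  LinearEquiv.ofLinearMap (Linear.leftComp k B e.hom) (Linear.leftComp k B e.inv)
    (by ext; simp) (by ext; simp)

lemma ExtFinitePair.of_equiv {A B A' B' : D} (h : ExtFinitePair k A B) (m : ℤ)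
    (e : ∀ n : ℤ, (A' ⟶ B'⟦n⟧) ≃ₗ[k] (A ⟶ B⟦n + m⟧)) : ExtFinitePair k A' B' := by
  refine ⟨fun n => ?_, ?_⟩
  · have := h.1 (n + m)
    exact Module.Finite.equiv (e n).symm
  · refine (h.2.preimage (f := fun n => n + m) (add_left_injective m).injOn).subset fun n hn => ?_
    have : Nontrivial (A' ⟶ B'⟦n⟧) := hn
    exact (e n).symm.toEquiv.nontrivial

/-- The shift functor on spaces of morphisms. -/
noncomputable def shiftHomEquiv (k : Type u) [Field k] [Linear k D]
    [∀ n : ℤ, (shiftFunctor D n).Linear k] (A B : D) (m : ℤ) : (A ⟶ B) ≃ₗ[k] (A⟦m⟧ ⟶ B⟦m⟧) :=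
  LinearEquiv.ofBijective ((shiftFunctor D m).mapLinearMap k)
    ⟨(shiftFunctor D m).map_injective, (shiftFunctor D m).map_surjective⟩

lemma isConeClosed_extFinitePair_right (A : D) :
    IsConeClosed fun B : D => ExtFinitePair k A B where
  iso {X Y} e h := h.of_equiv 0 fun n =>
    homCongrRight k A ((shiftFunctor D n).mapIso e.symm ≪≫ eqToIso (by rw [add_zero]))
  shift {X} m h := h.of_equiv m fun n =>
    homCongrRight k A ((shiftFunctorAdd' D m n (n + m) (add_comm _ _)).symm.app X)
  cone {T} hT h₁ h₂ := by
    have ex (n : ℤ) : ∃ (f : (A ⟶ T.obj₂⟦n⟧) →ₗ[k] (A ⟶ T.obj₃⟦n⟧))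
        (g : (A ⟶ T.obj₃⟦n⟧) →ₗ[k] (A ⟶ T.obj₁⟦n⟧⟦(1 : ℤ)⟧)), Function.Exact f g :=
      ⟨_, _, exact_coyoneda_obj₃ k (Triangle.shift_distinguished _ hT n) A⟩
    have e (n : ℤ) : (A ⟶ T.obj₁⟦n⟧⟦(1 : ℤ)⟧) ≃ₗ[k] (A ⟶ T.obj₁⟦n + 1⟧) :=
      homCongrRight k A ((shiftFunctorAdd D n 1).symm.app _)
    refine ⟨fun n => ?_, ?_⟩
    · have := h₂.1 n
      have := h₁.1 (n + 1)
      have := Module.Finite.equiv (e n).symm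
      obtain ⟨f, g, ex⟩ := ex n
      exact finite_of_exact f g ex
    · refine (h₂.2.union (h₁.2.preimage (f := fun n => n + 1)
        (add_left_injective 1).injOn)).subset fun n hn => ?_
      have : Nontrivial (A ⟶ T.obj₃⟦n⟧) := hn
      obtain ⟨f, g, ex⟩ := ex n
      exact (nontrivial_of_exact f g ex).imp id fun h => by
        have : Nontrivial (A ⟶ T.obj₁⟦n⟧⟦(1 : ℤ)⟧) := h
        exact (e n).symm.toEquiv.nontrivial

lemma isConeClosed_extFinitePair_left (B : D) :
    IsConeClosed fun A : D => ExtFinitePair k A B where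
  iso {X Y} e h := h.of_equiv 0 fun n =>
    Linear.homCongr k e.symm (eqToIso (by rw [add_zero]))
  shift {X} m h := h.of_equiv (-m) fun n =>
    homCongrRight k _ ((shiftFunctorAdd' D (n + -m) m n (by lia)).app B) ≪≫ₗ
      (shiftHomEquiv k X (B⟦n + -m⟧) m).symm
  cone {T} hT h₁ h₂ := by
    have ex (n : ℤ) := exact_yoneda_obj₃ k hT (B⟦n⟧)
    have e (n : ℤ) : (T.obj₁⟦(1 : ℤ)⟧ ⟶ B⟦n⟧) ≃ₗ[k] (T.obj₁ ⟶ B⟦n + -1⟧) :=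
      homCongrRight k _ ((shiftFunctorAdd' D (n + -1) 1 n (by lia)).app B) ≪≫ₗ
        (shiftHomEquiv k _ (B⟦n + -1⟧) 1).symm
    refine ⟨fun n => ?_, ?_⟩
    · have := h₂.1 n
      have := h₁.1 (n + -1)
      have := Module.Finite.equiv (e n).symm
      exact finite_of_exact _ _ (ex n)
    · refine ((h₁.2.preimage (f := fun n => n + -1)
        (add_left_injective (-1)).injOn).union h₂.2).subset fun n hn => ?_
      have : Nontrivial (T.obj₃ ⟶ B⟦n⟧) := hn
      exact (nontrivial_of_exact _ _ (ex n)).imp (fun h => by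
        have : Nontrivial (T.obj₁⟦(1 : ℤ)⟧ ⟶ B⟦n⟧) := h
        exact (e n).symm.toEquiv.nontrivial) id

/-- Dévissage in the target for a fixed generator as source, then in the source for an arbitrary
target. -/
lemma Generates.extFinitePair {ι : Type*} {G : ι → D} (hG : Generates G)
    (h : ∀ i j, ExtFinitePair k (G i) (G j)) (A B : D) : ExtFinitePair k A B :=
  hG _ (isConeClosed_extFinitePair_left B)
    (fun i => hG _ (isConeClosed_extFinitePair_right (G i)) (h i) B) A

lemma bijective_serrePairing_of_iso {A S B B' : D} (η : (A ⟶ S) →ₗ[k] k) (e : B ≅ B')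
    (h : Function.Bijective (serrePairing η B)) : Function.Bijective (serrePairing η B') := by
  have : (Linear.leftComp k S e.hom).dualMap ∘ₗ serrePairing η B ∘ₗ Linear.rightComp k A e.inv =
      serrePairing η B' := by
    ext f g
    simp
  rw [← this]
  exact (homCongrLeft k S e).dualMap.bijective.comp
    (h.comp (homCongrRight k A e.symm).bijective)

/-- All shifts are included in the property because the five lemma for a cone also needs the first
two objects shifted by one. -/
lemma isConeClosed_bijective_serrePairing {A S : D} (η : (A ⟶ S) →ₗ[k] k) :
    IsConeClosed fun B : D => ∀ n : ℤ, Function.Bijective (serrePairing η (B⟦n⟧)) where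
  iso e h n := bijective_serrePairing_of_iso η ((shiftFunctor D n).mapIso e) (h n)
  shift m h n := bijective_serrePairing_of_iso η ((shiftFunctorAdd D m n).app _) (h _)
  cone {T} hT h₁ h₂ n := bijective_serrePairing_obj₃ (Triangle.shift_distinguished _ hT n) η
    (h₁ n) (h₂ n) (bijective_serrePairing_of_iso η ((shiftFunctorAdd D n 1).app _) (h₁ _))
    (bijective_serrePairing_of_iso η ((shiftFunctorAdd D n 1).app _) (h₂ _))

lemma IsSerreDual.nonempty_iso [∀ X Y : D, Module.Finite k (X ⟶ Y)] {A S S' : D}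
    {η : (A ⟶ S) →ₗ[k] k} {η' : (A ⟶ S') →ₗ[k] k} (h : IsSerreDual A S η)
    (h' : IsSerreDual A S' η') : Nonempty (S ≅ S') := by
  obtain ⟨a, ha⟩ := h.exists_comp_eq η'
  obtain ⟨b, hb⟩ := h'.exists_comp_eq η
  exact ⟨b, a, h.hom_ext fun f => by simp [← Category.assoc, ha, hb],
    h'.hom_ext fun f => by simp [← Category.assoc, ha, hb]⟩

variable [∀ X Y : D, Module.Finite k (X ⟶ Y)]

variable (k) in
-- A morphism of objects with duals induces a morphism `v` of the duals, and the cone of `v` is a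
-- dual of the cone.
lemma isConeClosed_exists_serreDual :
    IsConeClosed fun A : D => ∃ (S : D) (η : (A ⟶ S) →ₗ[k] k), IsSerreDual A S η where
  iso e := fun ⟨S, _, h⟩ => ⟨S, _, h.of_iso e (Iso.refl S)⟩
  shift n := fun ⟨_, _, h⟩ => by
    obtain ⟨η, h, -⟩ := h.map (shiftFunctor D n)
    exact ⟨_, η, h⟩
  cone {T} hT := by
    rintro ⟨S₁, η₁, h₁⟩ ⟨S₂, η₂, h₂⟩
    obtain ⟨v, hv⟩ := h₂.exists_comp_eq (η₁ ∘ₗ Linear.leftComp k _ T.mor₁)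
    obtain ⟨_, _, _, hT'⟩ := distinguished_cocone_triangle v
    obtain ⟨η₃, h₃⟩ := h₁.cone hT hT' h₂ hv
    exact ⟨_, η₃, h₃⟩

variable (k) in
-- This is the mirror image of `isConeClosed_exists_serreDual`, with a morphism of duals lifted to
-- the objects they are dual to. It yields essential surjectivity of the Serre functor.
lemma isConeClosed_exists_isSerreDual :
    IsConeClosed fun S : D => ∃ (A : D) (η : (A ⟶ S) →ₗ[k] k), IsSerreDual A S η where
  iso e := fun ⟨A, _, h⟩ => ⟨A, _, h.of_iso (Iso.refl A) e⟩
  shift n := fun ⟨_, _, h⟩ => by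
    obtain ⟨η, h, -⟩ := h.map (shiftFunctor D n)
    exact ⟨_, η, h⟩
  cone {T} hT := by
    rintro ⟨A₁, η₁, h₁⟩ ⟨A₂, η₂, h₂⟩
    obtain ⟨u, hu⟩ := (h₁ A₂).2 (η₂ ∘ₗ Linear.rightComp k _ T.mor₁)
    obtain ⟨_, _, _, hT'⟩ := distinguished_cocone_triangle u
    obtain ⟨η₃, h₃⟩ := h₁.cone hT' hT h₂ fun g => (LinearMap.congr_fun hu g).symm
    exact ⟨_, η₃, h₃⟩

omit [∀ X Y : D, Module.Finite k (X ⟶ Y)] in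
-- The formal criterion: everything is checked on generators. The hypothesis `hS` places each
-- generator among the shifts of the chosen duals, which is what makes the functor essentially
-- surjective.
lemma Generates.triangulatedSerreDuality {ι : Type*} {G : ι → D} (hG : Generates G)
    (h : ∀ i j, ExtFinitePair k (G i) (G j)) (S : ι → D)
    (hS : ∀ j, ∃ (i : ι) (n : ℤ), Nonempty ((S i)⟦n⟧ ≅ G j))
    (η : ∀ i, (G i ⟶ S i) →ₗ[k] k)
    (hη : ∀ i j (n : ℤ), Function.Bijective (serrePairing (η i) ((G j)⟦n⟧))) :
    TriangulatedSerreDuality k D := by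
  have hfin := hG.extFinitePair h
  have hfin' (A B : D) : Module.Finite k (A ⟶ B) :=
    have := (hfin A B).1 0
    Module.Finite.equiv (homCongrRight k A ((shiftFunctorZero D ℤ).app B))
  refine ⟨fun A B => ?_, ?_⟩
  · have := (hfin A B).1
    exact finite_directSum (hfin A B).2
  have hdual (i : ι) : IsSerreDual (G i) (S i) (η i) := fun B =>
    bijective_serrePairing_of_iso _ ((shiftFunctorZero D ℤ).app B)
      (hG _ (isConeClosed_bijective_serrePairing (η i)) (hη i) B 0)
  choose F ξ hF using hG _ (isConeClosed_exists_serreDual k) fun i => ⟨_, _, hdual i⟩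
  refine nonempty_serreFunctor hF fun B => ?_
  obtain ⟨A, η, h⟩ := hG _ (isConeClosed_exists_isSerreDual k) (fun j => by
    obtain ⟨i, n, ⟨e⟩⟩ := hS j
    exact (isConeClosed_exists_isSerreDual k).iso e
      ((isConeClosed_exists_isSerreDual k).shift n ⟨_, _, hdual i⟩)) B
  exact ⟨A, (hF A).nonempty_iso h⟩

end SerreFunctor

/-! ### The components `M_n` and `V_i` of an object. -/

section Components

variable {k : Type u} [Field k]

variable (k) in
/-- The functor sending an object to the degree `n` part of the graded module. -/
noncomputable def deg (n : ℤ) : ZDCategory k ⥤ ModuleCat.{u} k :=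
  CategoricalPullback.π₂ _ _ ⋙ (isFG k).ι ⋙ (evaluation ℤ (ModuleCat.{u} k)).obj n

noncomputable instance (n : ℤ) : PreservesFiniteLimits (deg k n) := by
  unfold deg; infer_instance
noncomputable instance (n : ℤ) : PreservesFiniteColimits (deg k n) := by
  unfold deg; infer_instance
instance (n : ℤ) : (deg k n).Additive where
  map_add := rfl

variable (k) in
/-- The functor sending an object to one of the two summands of `(M_x)₀`. -/
noncomputable def vec (i : Bool) : ZDCategory k ⥤ ModuleCat.{u} k :=
  CategoricalPullback.π₁ _ _ ⋙
    (bif i then CategoryTheory.Prod.snd (Vec k) (Vec k)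
      else CategoryTheory.Prod.fst (Vec k) (Vec k)) ⋙
      (ModuleCat.isFG k).ι

instance (i : Bool) : PreservesFiniteLimits (vec k i) := by
  have : PreservesFiniteLimits (ModuleCat.isFG k).ι :=
    inferInstanceAs (PreservesFiniteLimits (forget₂ (FGModuleCat.{u} k) (ModuleCat.{u} k)))
  cases i <;> dsimp [vec] <;> infer_instance

/-- The localization of the graded module is the sum of the two vector spaces. -/
noncomputable def locIso (X : ZDCategory k) :
    (colimit X.snd.obj : ModuleCat.{u} k) ≅ ModuleCat.of k (X.fst.1 × X.fst.2) :=
  (ModuleCat.isFG k).ι.mapIso X.iso.symm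

variable (k) in
/-- Multiplication by `x ^ (m - n)`. -/
noncomputable def mul {n m : ℤ} (h : n ≤ m) : deg k n ⟶ deg k m where
  app X := X.snd.obj.map (homOfLE h)
  naturality _ _ f := (f.snd.hom.naturality (homOfLE h)).symm

/-- The components `M n ⟶ (M_x)₀ ⟶ V i`. -/
noncomputable def pr (X : ZDCategory k) (n : ℤ) : ∀ i : Bool, (deg k n).obj X ⟶ (vec k i).obj X
  | false => ModuleCat.ofHom (LinearMap.fst k _ _ ∘ₗ (colimit.ι X.snd.obj n ≫ (locIso X).hom).hom)
  | true => ModuleCat.ofHom (LinearMap.snd k _ _ ∘ₗ (colimit.ι X.snd.obj n ≫ (locIso X).hom).hom)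

lemma mul_pr (X : ZDCategory k) {n m : ℤ} (h : n ≤ m) (i : Bool) :
    (mul k h).app X ≫ pr X m i = pr X n i := by
  have := colimit.w X.snd.obj (homOfLE h)
  cases i
  all_goals
    dsimp only [pr, mul]
    rw [← this]
    rfl

lemma locIso_naturality {X Y : ZDCategory k} (f : X ⟶ Y) :
    colimMap f.snd.hom ≫ (locIso Y).hom = (locIso X).hom ≫
      ModuleCat.ofHom (f.fst.1.hom.hom.prodMap f.fst.2.hom.hom) := by
  have h : X.iso.inv ≫ (sumFunctor k).map f.fst = (locDegreeZero k).map f.snd ≫ Y.iso.inv := by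
    rw [Iso.inv_comp_eq, ← Category.assoc, Iso.eq_comp_inv]
    exact f.w
  exact (congrArg (ModuleCat.isFG k).ι.map h).symm

lemma pr_naturality {X Y : ZDCategory k} (f : X ⟶ Y) (n : ℤ) (i : Bool) :
    (deg k n).map f ≫ pr Y n i = pr X n i ≫ (vec k i).map f := by
  have h : f.snd.hom.app n ≫ colimit.ι Y.snd.obj n ≫ (locIso Y).hom =
      (colimit.ι X.snd.obj n ≫ (locIso X).hom) ≫
        ModuleCat.ofHom (f.fst.1.hom.hom.prodMap f.fst.2.hom.hom) := by
    rw [Category.assoc, ← locIso_naturality, ι_colimMap_assoc]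
  cases i
  · ext x
    exact congrArg Prod.fst (ConcreteCategory.congr_hom h x)
  · ext x
    exact congrArg Prod.snd (ConcreteCategory.congr_hom h x)

lemma pullback_condition {X Y : ZDCategory k} (f : X.snd ⟶ Y.snd) (g : X.fst ⟶ Y.fst)
    (h : colimMap f.hom ≫ (locIso Y).hom = (locIso X).hom ≫
      ModuleCat.ofHom (g.1.hom.hom.prodMap g.2.hom.hom)) :
    (sumFunctor k).map g ≫ Y.iso.hom = X.iso.hom ≫ (locDegreeZero k).map f := by
  have h' : X.iso.inv ≫ (sumFunctor k).map g = (locDegreeZero k).map f ≫ Y.iso.inv :=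
    (ModuleCat.isFG k).ι.map_injective h.symm
  rw [Iso.inv_comp_eq, ← Category.assoc, Iso.eq_comp_inv] at h'
  exact h'

/-- Constructor for morphisms. -/
noncomputable def mkHom {X Y : ZDCategory k} (f : X.snd.obj ⟶ Y.snd.obj)
    (g : ∀ i : Bool, (vec k i).obj X ⟶ (vec k i).obj Y)
    (h : ∀ n i, (f.app n : (deg k n).obj X ⟶ (deg k n).obj Y) ≫ pr Y n i = pr X n i ≫ g i) :
    X ⟶ Y where
  fst := (ObjectProperty.homMk (g false), ObjectProperty.homMk (g true))
  snd := ObjectProperty.homMk f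
  w := by
    apply pullback_condition
    refine colimit.hom_ext fun n => ?_
    refine (ι_colimMap_assoc _ _ _).trans ?_
    refine ModuleCat.hom_ext (LinearMap.ext fun x => ?_)
    exact Prod.ext (ConcreteCategory.congr_hom (h n false) x)
      (ConcreteCategory.congr_hom (h n true) x)

instance (F : ℤ ⥤ ModuleCat.{u} k) : PreservesColimit F (forget (ModuleCat.{u} k)) :=
  haveI : PreservesFilteredColimitsOfSize.{0, 0} (forget (ModuleCat.{u} k)) :=
    preservesFilteredColimitsOfSize_shrink.{0, u, 0, u} _
  inferInstance

lemma exists_pr_eq (X : ZDCategory k) (a : (vec k false).obj X) (b : (vec k true).obj X) (m : ℤ) :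
    ∃ (n : ℤ) (_ : m ≤ n) (z : (deg k n).obj X), pr X n false z = a ∧ pr X n true z = b := by
  obtain ⟨n, z, hz⟩ := Concrete.colimit_exists_rep X.snd.obj
    ((locIso X).inv (show X.fst.1 × X.fst.2 from (a, b)))
  have key : (locIso X).hom (colimit.ι X.snd.obj (max m n)
      (X.snd.obj.map (homOfLE (le_max_right m n)) z)) = (show X.fst.1 × X.fst.2 from (a, b)) := by
    have h := ConcreteCategory.congr_hom (colimit.w X.snd.obj (homOfLE (le_max_right m n))) z
    refine (congrArg (locIso X).hom (h.trans hz)).trans ?_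
    exact ConcreteCategory.congr_hom (locIso X).inv_hom_id _
  exact ⟨max m n, le_max_left _ _, X.snd.obj.map (homOfLE (le_max_right m n)) z,
    congrArg Prod.fst key, congrArg Prod.snd key⟩

lemma exists_mul_eq_zero (X : ZDCategory k) {n : ℤ} (z : (deg k n).obj X)
    (h : ∀ i, pr X n i z = 0) : ∃ (m : ℤ) (h : n ≤ m), (mul k h).app X z = 0 := by
  have key : (locIso X).hom (colimit.ι X.snd.obj n z) = 0 :=
    Prod.ext (h false) (h true)
  have key' : colimit.ι X.snd.obj n z = 0 := by
    have := congrArg (locIso X).inv key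
    rw [map_zero] at this
    rw [← this]
    exact (ConcreteCategory.congr_hom (locIso X).hom_inv_id _).symm
  obtain ⟨m, f, hm⟩ := Concrete.colimit_rep_eq_zero k X.snd.obj n z key'
  exact ⟨m, leOfHom f, hm⟩

lemma vec_ext {X : ZDCategory k} {i : Bool} {M : ModuleCat.{u} k} {f g : (vec k i).obj X ⟶ M}
    (h : ∀ n, pr X n i ≫ f = pr X n i ≫ g) : f = g := by
  ext a
  obtain ⟨n, z, rfl⟩ : ∃ n z, pr X n i z = a := by
    cases i
    · obtain ⟨n, -, z, h, -⟩ := exists_pr_eq X a 0 0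
      exact ⟨n, z, h⟩
    · obtain ⟨n, -, z, -, h⟩ := exists_pr_eq X 0 a 0
      exact ⟨n, z, h⟩
  exact ConcreteCategory.congr_hom (h n) z

/-- Every element of `V_i` is the image of a homogeneous element of `M`, so the graded part of a
morphism determines the rest. Hence vanishing, monomorphisms, epimorphisms and short exactness may
be tested in each degree. -/
lemma hom_ext_deg {X Y : ZDCategory k} {f g : X ⟶ Y}
    (h : ∀ n, (deg k n).map f = (deg k n).map g) : f = g := by
  have h' (i : Bool) : (vec k i).map f = (vec k i).map g := vec_ext fun n => by
    rw [← pr_naturality, ← pr_naturality, h]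
  refine CategoricalPullback.hom_ext (Prod.ext ?_ ?_) ?_
  · exact (ModuleCat.isFG k).ι.map_injective (h' false)
  · exact (ModuleCat.isFG k).ι.map_injective (h' true)
  · apply (isFG k).ι.map_injective
    exact NatTrans.ext (funext h)

lemma isZero_of_deg {X : ZDCategory k} (h : ∀ n, IsZero ((deg k n).obj X)) : IsZero X := by
  rw [IsZero.iff_id_eq_zero]
  exact hom_ext_deg fun n => (h n).eq_of_src _ _

lemma mono_of_deg {X Y : ZDCategory k} (f : X ⟶ Y) (h : ∀ n, Mono ((deg k n).map f)) : Mono f where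
  right_cancellation u v e := hom_ext_deg fun n => by
    have := h n
    rw [← cancel_mono ((deg k n).map f), ← Functor.map_comp, ← Functor.map_comp, e]

lemma epi_of_deg {X Y : ZDCategory k} (f : X ⟶ Y) (h : ∀ n, Epi ((deg k n).map f)) : Epi f where
  left_cancellation u v e := hom_ext_deg fun n => by
    have := h n
    rw [← cancel_epi ((deg k n).map f), ← Functor.map_comp, ← Functor.map_comp, e]

lemma shortExact_of_deg (S : ShortComplex (ZDCategory k))
    (h : ∀ n, (S.map (deg k n)).ShortExact) : S.ShortExact where
  exact := by
    rw [ShortComplex.exact_iff_isZero_homology]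
    refine isZero_of_deg fun n => ?_
    exact IsZero.of_iso ((ShortComplex.exact_iff_isZero_homology _).1 (h n).exact)
      (S.mapHomologyIso (deg k n)).symm
  mono_f := mono_of_deg _ fun n => (h n).mono_f
  epi_g := epi_of_deg _ fun n => (h n).epi_g

end Components

/-! ### Graded modules supported on an interval of degrees. -/

section Interval

open Polynomial DirectSum

variable {k : Type u} [Field k]

lemma isFG_of_generator (M : GrMod k) {n : ℤ} (z : M.obj n)
    (h : ∀ (l : ℤ) (w : M.obj l), w ≠ 0 → ∃ (h : n ≤ l) (c : k), w = c • M.map (homOfLE h) z) :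
    isFG k M := by
  classical
  let g : Total M := Module.AEval'.of (mulX M) (DirectSum.lof k ℤ (fun n => M.obj n) n z)
  have hpow (j : ℕ) : (X ^ j : k[X]) • g = Module.AEval'.of (mulX M)
      (DirectSum.lof k ℤ (fun n => M.obj n) (n + j)
        (M.map (homOfLE (by lia : n ≤ n + j)) z)) := by
    induction j with
    | zero =>
      rw [pow_zero, one_smul]
      -- The degrees `n` and `n + 0` index different types, so the identity is proved for a variable
      -- degree `m` and then specialized.
      have (m : ℤ) (hm : n = m) : g = Module.AEval'.of (mulX M)
          (DirectSum.lof k ℤ (fun n => M.obj n) m (M.map (homOfLE hm.le) z)) := by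
        subst hm
        have : homOfLE (le_refl n) = 𝟙 n := rfl
        rw [this, M.map_id]
        rfl
      exact this _ (by simp)
    | succ j ih =>
      rw [pow_succ', mul_smul, ih, Module.AEval'.X_smul_of, mulX_lof]
      have (m : ℤ) (hm : n + j + 1 = m) : Module.AEval'.of (mulX M)
          (DirectSum.lof k ℤ (fun n => M.obj n) (n + j + 1)
            ((M.map (homOfLE (by lia : n + j ≤ n + j + 1))).hom
              (M.map (homOfLE (by lia : n ≤ n + j)) z))) = Module.AEval'.of (mulX M)
          (DirectSum.lof k ℤ (fun n => M.obj n) m (M.map (homOfLE (by lia)) z)) := by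
        subst hm
        congr 2
        exact (ConcreteCategory.congr_hom (M.map_comp (homOfLE (by lia : n ≤ n + j))
          (homOfLE (by lia : n + j ≤ n + j + 1))) z).symm
      exact this _ (by push_cast; ring)
  refine ⟨{g}, eq_top_iff.2 fun y _ => ?_⟩
  obtain ⟨y, rfl⟩ := (Module.AEval'.of (mulX M)).surjective y
  induction y using DirectSum.induction_on with
  | zero => rw [map_zero]; exact zero_mem _
  | add a b ha hb => rw [map_add]; exact add_mem (ha trivial) (hb trivial)
  | of l w =>
    by_cases hw : w = 0
    · rw [hw, map_zero, map_zero]; exact zero_mem _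
    · obtain ⟨hl, c, rfl⟩ := h l w hw
      obtain ⟨j, rfl⟩ := Int.le.dest hl
      have := hpow j
      have h2 : Module.AEval'.of (mulX M) (DirectSum.of (fun n => M.obj n) (n + j)
          (c • M.map (homOfLE hl) z)) = (C c * X ^ j : k[X]) • g := by
        rw [mul_smul, hpow, Module.AEval.C_smul, ← (Module.AEval'.of (mulX M)).map_smul,
          ← (DirectSum.lof k ℤ _ _).map_smul]
        rfl
      rw [h2]
      exact Submodule.smul_mem _ _ (Submodule.mem_span_of_mem (by simp))

/-- The vector space that is `k` if `p` holds and `0` otherwise. -/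
def cell (k : Type u) [Field k] (p : Prop) : Submodule k k where
  carrier := {c : k | ¬p → c = 0}
  add_mem' ha hb h := by rw [ha h, hb h, add_zero]
  zero_mem' _ := rfl
  smul_mem' c a ha h := by rw [ha h, smul_zero]

open scoped Classical in
/-- The graded module with a copy of `k` in each degree in `s`. -/
noncomputable def intervalModule (k : Type u) [Field k] (s : Set ℤ) [hs : s.OrdConnected] :
    GrMod k where
  obj l := ModuleCat.of k (cell k (l ∈ s))
  map {l l'} _ := ModuleCat.ofHom
    { toFun c := ⟨if l' ∈ s then c.1 else 0, fun h => if_neg h⟩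
      map_add' a b := Subtype.ext (by dsimp; split_ifs <;> simp)
      map_smul' a b := Subtype.ext (by dsimp; split_ifs <;> simp) }
  map_id l := by
    ext c
    by_cases h : l ∈ s
    · exact if_pos h
    · exact (if_neg h).trans (c.2 h).symm
  map_comp {l l' l''} f g := by
    ext c
    change (if l'' ∈ s then c.1 else 0) = if l'' ∈ s then (if l' ∈ s then c.1 else 0) else 0
    split_ifs with h h'
    · rfl
    -- Convexity of `s`: the middle degree can lie outside `s` only if the source degree does, and
    -- then `c` is zero.
    · exact c.2 fun h1 => h' (hs.out h1 h ⟨leOfHom f, leOfHom g⟩)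
    · rfl

variable {s : Set ℤ} [hs : s.OrdConnected]

/-- Homogeneous elements of an interval module are scalars. -/
noncomputable def val {l : ℤ} : (intervalModule k s).obj l →ₗ[k] k := Submodule.subtype _

lemma val_injective {l : ℤ} : Function.Injective (val (k := k) (s := s) (l := l)) :=
  Subtype.val_injective

lemma val_eq_zero {l : ℤ} (h : l ∉ s) (z : (intervalModule k s).obj l) : val z = 0 :=
  z.2 h

lemma exists_val_eq {l : ℤ} (h : l ∈ s) (c : k) :
    ∃ z : (intervalModule k s).obj l, val z = c := ⟨⟨c, fun h' => absurd h h'⟩, rfl⟩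

lemma val_map {l l' : ℤ} (f : l ⟶ l') (h : l' ∈ s) (z : (intervalModule k s).obj l) :
    val ((intervalModule k s).map f z) = val z := if_pos h

/-- A morphism to an interval module from a family of linear forms. -/
noncomputable def toInterval (M : GrMod k) (φ : ∀ l, M.obj l →ₗ[k] k) (h₀ : ∀ l ∉ s, φ l = 0)
    (h₁ : ∀ l l' (f : l ⟶ l') (z : M.obj l), l' ∈ s → φ l' (M.map f z) = φ l z) :
    M ⟶ intervalModule k s where
  app l := ModuleCat.ofHom ((φ l).codRestrict _ fun z h => by rw [h₀ l h]; rfl)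
  naturality l l' f := by
    ext z
    refine val_injective ?_
    change φ l' (M.map f z) = val ((intervalModule k s).map f _)
    by_cases h : l' ∈ s
    · rw [val_map f h, h₁ _ _ _ _ h]; rfl
    · rw [val_eq_zero h, h₀ _ h]; rfl

lemma isFG_intervalModule {n : ℤ} (hn : n ∈ s) (h : ∀ l ∈ s, n ≤ l) :
    isFG k (intervalModule k s) := by
  obtain ⟨z, hz⟩ := exists_val_eq (k := k) hn 1
  refine isFG_of_generator _ z fun l w hw => ?_
  have hl : l ∈ s := by
    by_contra hl
    exact hw (val_injective ((val_eq_zero hl w).trans (map_zero _).symm))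
  refine ⟨h l hl, val w, val_injective ?_⟩
  rw [map_smul, val_map _ hl, hz, smul_eq_mul, mul_one]

lemma isFG_intervalModule_empty (h : s = ∅) : isFG k (intervalModule k s) := by
  refine isFG_of_generator _ (n := 0) 0 fun l w hw => ?_
  have hl : l ∉ s := by simp [h]
  exact absurd (val_injective ((val_eq_zero hl w).trans (map_zero _).symm)) hw

lemma isFG_Ici (n : ℤ) : isFG k (intervalModule k (Set.Ici n)) :=
  isFG_intervalModule (Set.mem_Ici.2 le_rfl) fun _ => id

lemma isFG_Ico (a b : ℤ) : isFG k (intervalModule k (Set.Ico a b)) := by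
  by_cases h : a < b
  · exact isFG_intervalModule (Set.left_mem_Ico.2 h) fun _ => And.left
  · exact isFG_intervalModule_empty (Set.Ico_eq_empty h)

end Interval

/-! ### Objects built from a graded module and projections to two vector spaces. -/

section Construction

variable {k : Type u} [Field k]

/-- A cocone on a graded module with finite dimensional point whose legs are eventually
bijective is a colimit cocone. -/
lemma isIso_desc_of_bijective (M : GrMod k) (c : Cocone M)
    (h : ∃ n₀ : ℤ, ∀ n, n₀ ≤ n → Function.Bijective (c.ι.app n)) : IsIso (colimit.desc M c) := by
  obtain ⟨n₀, h⟩ := h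
  rw [ConcreteCategory.isIso_iff_bijective]
  have hι (n : ℤ) (z : M.obj n) : colimit.desc M c (colimit.ι M n z) = c.ι.app n z :=
    ConcreteCategory.congr_hom (colimit.ι_desc c n) z
  constructor
  · rw [← AddMonoidHom.coe_coe, injective_iff_map_eq_zero]
    intro a ha
    obtain ⟨n, z, rfl⟩ := Concrete.colimit_exists_rep M a
    have hw := ConcreteCategory.congr_hom (colimit.w M (homOfLE (le_max_left n n₀))) z
    have h1 : c.ι.app _ (M.map (homOfLE (le_max_left n n₀)) z) = 0 := by
      rw [← hι]
      exact (congrArg _ hw).trans ha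
    have h2 : M.map (homOfLE (le_max_left n n₀)) z = 0 :=
      (h _ (le_max_right n n₀)).1 (h1.trans (map_zero _).symm)
    rw [← hw]
    exact (congrArg (colimit.ι M _) h2).trans (map_zero (colimit.ι M _).hom)
  · intro y
    obtain ⟨z, rfl⟩ := (h n₀ le_rfl).2 y
    exact ⟨_, hι _ z⟩

variable (M : GrMod k) (hM : isFG k M) (V : Bool → Vec k) (p : ∀ n i, M.obj n →ₗ[k] V i)
  (hp : ∀ n m (f : n ⟶ m) i z, p m i (M.map f z) = p n i z)
  (hiso : ∃ n₀ : ℤ, ∀ n, n₀ ≤ n → Function.Bijective ((p n false).prod (p n true)))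

/-- The cocone used in `mkObj`. -/
noncomputable def mkCocone : Cocone M where
  pt := ModuleCat.of k (V false × V true)
  ι := { app n := ModuleCat.ofHom ((p n false).prod (p n true))
         naturality n m f := by
          refine ModuleCat.hom_ext (LinearMap.ext fun z => ?_)
          exact Prod.ext (hp n m f false z) (hp n m f true z) }

/-- The colimit of `M`. -/
noncomputable def mkLocIso : (colimit M : ModuleCat.{u} k) ≅ (mkCocone M V p hp).pt :=
  haveI := isIso_desc_of_bijective M (mkCocone M V p hp) hiso
  asIso (colimit.desc M (mkCocone M V p hp))

/-- Constructor for objects. -/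
noncomputable def mkObj : ZDCategory k :=
  { fst := (V false, V true)
    snd := ⟨M, hM⟩
    iso := ((ModuleCat.isFG k).fullyFaithfulι.preimageIso
      (X := (locDegreeZero k).obj ⟨M, hM⟩) (Y := (sumFunctor k).obj (V false, V true))
      (mkLocIso M V p hp hiso)).symm }

/-- The components of `mkObj`. -/
noncomputable def mkObjVecIso : ∀ i, (vec k i).obj (mkObj M hM V p hp hiso) ≅ (V i).obj
  | false => Iso.refl _
  | true => Iso.refl _

lemma mkObjVecIso_pr (n : ℤ) (i : Bool) (z : M.obj n) :
    (mkObjVecIso M hM V p hp hiso i).hom (pr (mkObj M hM V p hp hiso) n i z) = p n i z := by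
  have h := ConcreteCategory.congr_hom (colimit.ι_desc (mkCocone M V p hp) n) z
  cases i
  · exact congrArg Prod.fst h
  · exact congrArg Prod.snd h

end Construction

/-! ### The basic free and torsion objects and the morphisms into them. -/

section Objects

variable {k : Type u} [Field k]

/-- The projections of `free k n j`. -/
noncomputable def freeProj (n : ℤ) (j : Bool) (l : ℤ) (i : Bool) :
    (intervalModule k (Set.Ici n)).obj l →ₗ[k] cell k (i = j) :=
  LinearMap.codRestrict _ (if i = j then val else 0) fun z h => by rw [if_neg h]; rfl

lemma coe_freeProj (n : ℤ) (j : Bool) (l : ℤ) (i : Bool)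
    (z : (intervalModule k (Set.Ici n)).obj l) :
    (freeProj n j l i z).1 = if i = j then val z else 0 := by
  simp only [freeProj]
  split_ifs <;> rfl

lemma freeProj_map (n : ℤ) (j : Bool) (l l' : ℤ) (f : l ⟶ l') (i : Bool)
    (z : (intervalModule k (Set.Ici n)).obj l) :
    freeProj n j l' i ((intervalModule k (Set.Ici n)).map f z) = freeProj n j l i z := by
  refine Subtype.ext ?_
  rw [coe_freeProj, coe_freeProj]
  by_cases hb : l' ∈ Set.Ici n
  · rw [val_map f hb z]
  · rw [val_eq_zero hb, val_eq_zero fun ha : l ∈ Set.Ici n => hb (le_trans ha (leOfHom f))]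

lemma bijective_freeProj (n : ℤ) (j : Bool) (l : ℤ) (hl : n ≤ l) :
    Function.Bijective ((freeProj (k := k) n j l false).prod (freeProj n j l true)) := by
  constructor
  · intro z z' h
    refine val_injective ?_
    have h1 : (freeProj n j l false z).1 = (freeProj n j l false z').1 :=
      congrArg Subtype.val (congrArg Prod.fst h)
    have h2 : (freeProj n j l true z).1 = (freeProj n j l true z').1 :=
      congrArg Subtype.val (congrArg Prod.snd h)
    rw [coe_freeProj, coe_freeProj] at h1 h2
    cases j
    · simpa using h1
    · simpa using h2
  · rintro ⟨a, b⟩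
    obtain ⟨z, hz⟩ := exists_val_eq (k := k) (s := Set.Ici n) hl (if false = j then a.1 else b.1)
    refine ⟨z, Prod.ext (Subtype.ext ?_) (Subtype.ext ?_)⟩
    · refine (coe_freeProj _ _ _ _ _).trans ?_
      split_ifs with h
      · rw [hz, if_pos h]
      · exact (a.2 h).symm
    · refine (coe_freeProj _ _ _ _ _).trans ?_
      split_ifs with h
      · rw [hz, if_neg (by rw [← h]; simp)]
      · exact (b.2 h).symm

variable (k) in
/-- The object with graded module `k[x](-n)` and with `V j = k`, where `j` is the given index, and
with the other vector space zero. -/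
noncomputable def free (n : ℤ) (j : Bool) : ZDCategory k :=
  mkObj (intervalModule k (Set.Ici n)) (isFG_Ici n)
    (fun i => FGModuleCat.of k (cell k (i = j))) (freeProj n j)
    (freeProj_map n j) ⟨n, bijective_freeProj n j⟩

variable (k) in
/-- The torsion object with a copy of `k` in each degree in `[a, b)`. -/
noncomputable def torsion (a b : ℤ) : ZDCategory k :=
  mkObj (intervalModule k (Set.Ico a b)) (isFG_Ico a b) (fun _ => FGModuleCat.of k (cell k False))
    (fun _ _ => 0) (fun _ _ _ _ _ => rfl)
    ⟨b, fun m hm => by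
      have hm' : m ∉ Set.Ico a b := fun h => absurd h.2 (not_lt.2 hm)
      constructor
      · intro z z' h
        refine val_injective ?_
        rw [val_eq_zero hm', val_eq_zero hm']
      · rintro ⟨x, y⟩
        exact ⟨0, Prod.ext (Subtype.ext (x.2 id).symm) (Subtype.ext (y.2 id).symm)⟩⟩

/-- Homogeneous elements of `free k n j` are scalars. -/
noncomputable def freeVal (n : ℤ) (j : Bool) (l : ℤ) : (deg k l).obj (free k n j) →ₗ[k] k :=
  val (s := Set.Ici n)

/-- Homogeneous elements of `torsion k a b` are scalars. -/
noncomputable def torsionVal (a b l : ℤ) : (deg k l).obj (torsion k a b) →ₗ[k] k :=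
  val (s := Set.Ico a b)

/-- The components of `free k n j`. -/
noncomputable def freeVecIso (n : ℤ) (j i : Bool) :
    (vec k i).obj (free k n j) ≅ ModuleCat.of k (cell k (i = j)) :=
  mkObjVecIso (intervalModule k (Set.Ici n)) (isFG_Ici n)
    (fun i => FGModuleCat.of k (cell k (i = j))) (freeProj n j)
    (freeProj_map n j) ⟨n, bijective_freeProj n j⟩ i

lemma coe_freeVecIso_pr (n : ℤ) (j : Bool) (l : ℤ) (i : Bool) (z : (deg k l).obj (free k n j)) :
    ((freeVecIso n j i).hom (pr _ l i z)).1 = if i = j then freeVal n j l z else 0 :=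
  (congrArg Subtype.val (mkObjVecIso_pr (intervalModule k (Set.Ici n)) (isFG_Ici n)
    (fun i => FGModuleCat.of k (cell k (i = j))) (freeProj n j)
    (freeProj_map n j) ⟨n, bijective_freeProj n j⟩ l i z)).trans (coe_freeProj _ _ _ _ _)

/-- The elements of the nonzero component of `free k n j` are scalars. -/
noncomputable def freeVec (n : ℤ) (j : Bool) : (vec k j).obj (free k n j) →ₗ[k] k :=
  (cell k (j = j)).subtype ∘ₗ (freeVecIso n j j).hom.hom

lemma freeVec_pr (n : ℤ) (j : Bool) (l : ℤ) (z : (deg k l).obj (free k n j)) :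
    freeVec n j (pr _ l j z) = freeVal n j l z :=
  (coe_freeVecIso_pr n j l j z).trans (if_pos rfl)

lemma freeVec_injective (n : ℤ) (j : Bool) : Function.Injective (freeVec (k := k) n j) :=
  Subtype.val_injective.comp (ConcreteCategory.bijective_of_isIso (freeVecIso n j j).hom).1

lemma isZero_vec_free (n : ℤ) {i j : Bool} (h : i ≠ j) : IsZero ((vec k i).obj (free k n j)) := by
  refine IsZero.of_iso ?_ (freeVecIso n j i)
  have : Subsingleton (cell k (i = j)) :=
    ⟨fun a b => Subtype.ext ((a.2 h).trans (b.2 h).symm)⟩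
  exact ModuleCat.isZero_of_subsingleton (ModuleCat.of k (cell k (i = j)))

lemma isZero_vec_torsion (a b : ℤ) (i : Bool) : IsZero ((vec k i).obj (torsion k a b)) := by
  refine IsZero.of_iso ?_ (mkObjVecIso _ _ _ _ _ _ i)
  have : Subsingleton (cell k False) :=
    ⟨fun a b => Subtype.ext ((a.2 id).trans (b.2 id).symm)⟩
  exact ModuleCat.isZero_of_subsingleton (ModuleCat.of k (cell k False))

lemma freeVal_injective (n : ℤ) (j : Bool) (l : ℤ) :
    Function.Injective (freeVal (k := k) n j l) := val_injective

lemma torsionVal_injective (a b l : ℤ) :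
    Function.Injective (torsionVal (k := k) a b l) := val_injective

lemma freeVal_eq_zero {n l : ℤ} (h : l < n) (j : Bool) (z : (deg k l).obj (free k n j)) :
    freeVal n j l z = 0 := val_eq_zero (s := Set.Ici n) (not_le.2 h) z

lemma torsionVal_eq_zero {a b l : ℤ} (h : ¬(a ≤ l ∧ l < b)) (z : (deg k l).obj (torsion k a b)) :
    torsionVal a b l z = 0 := val_eq_zero (s := Set.Ico a b) h z

lemma freeVal_surjective {n l : ℤ} (h : n ≤ l) (j : Bool) :
    Function.Surjective (freeVal (k := k) n j l) := exists_val_eq (s := Set.Ici n) h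

lemma torsionVal_surjective {a b l : ℤ} (h : a ≤ l ∧ l < b) :
    Function.Surjective (torsionVal (k := k) a b l) := exists_val_eq (s := Set.Ico a b) h

lemma freeVal_mul (n : ℤ) (j : Bool) {l l' : ℤ} (h : l ≤ l') (z : (deg k l).obj (free k n j)) :
    freeVal n j l' ((mul k h).app _ z) = freeVal n j l z := by
  rw [← freeVec_pr, ← freeVec_pr, ← mul_pr _ h]
  rfl

lemma torsionVal_mul {a b l l' : ℤ} (h : l ≤ l') (h' : a ≤ l' ∧ l' < b)
    (z : (deg k l).obj (torsion k a b)) :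
    torsionVal a b l' ((mul k h).app _ z) = torsionVal a b l z :=
  val_map (s := Set.Ico a b) (homOfLE h) h' z

section Hom

variable {Y : ZDCategory k}

/-- A linear form on `V j` defines a morphism to the components of `free k a j`. -/
noncomputable def toFreeVec (a : ℤ) (j : Bool) (φ : (vec k j).obj Y →ₗ[k] k) (i : Bool) :
    (vec k i).obj Y ⟶ (vec k i).obj (free k a j) :=
  if h : i = j then
    eqToHom (by rw [h]) ≫ ModuleCat.ofHom (φ.codRestrict (cell k (j = j)) fun _ h => absurd rfl h) ≫
      (freeVecIso a j j).inv ≫ eqToHom (by rw [h])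
  else 0

lemma freeVec_toFreeVec (a : ℤ) (j : Bool) (φ : (vec k j).obj Y →ₗ[k] k) (y : (vec k j).obj Y) :
    freeVec a j (toFreeVec a j φ j y) = φ y := by
  rw [toFreeVec, dif_pos rfl, eqToHom_refl, eqToHom_refl, Category.id_comp, Category.comp_id]
  exact congrArg Subtype.val (ConcreteCategory.congr_hom (freeVecIso a j j).inv_hom_id _)

/-- The morphism to `free k a j` given by a linear form on `V j`. -/
noncomputable def toFree (a : ℤ) (j : Bool) (φ : (vec k j).obj Y →ₗ[k] k)
    (h : ∀ l < a, ∀ z, φ (pr Y l j z) = 0) : Y ⟶ free k a j :=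
  mkHom (toInterval Y.snd.obj (fun l => φ ∘ₗ (pr Y l j).hom)
      (fun l hl => LinearMap.ext fun z => h l (not_le.1 hl) z)
      (fun l l' f z _ => congrArg φ (ConcreteCategory.congr_hom (mul_pr Y (leOfHom f) j) z)))
    (toFreeVec a j φ)
    (fun n i => by
      rcases eq_or_ne i j with rfl | h
      · refine ModuleCat.hom_ext (LinearMap.ext fun z => freeVec_injective _ _ ?_)
        exact (freeVec_pr _ _ _ _).trans (freeVec_toFreeVec _ _ _ _).symm
      · exact (isZero_vec_free a h).eq_of_tgt _ _)

lemma freeVal_toFree (a : ℤ) (j : Bool) (φ : (vec k j).obj Y →ₗ[k] k)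
    (h : ∀ l < a, ∀ z, φ (pr Y l j z) = 0) (l : ℤ) (z : (deg k l).obj Y) :
    freeVal a j l ((deg k l).map (toFree a j φ h) z) = φ (pr Y l j z) := rfl

/-- The morphism to `torsion k a b` given by linear forms in each degree. -/
noncomputable def toTorsion (a b : ℤ) (φ : ∀ l, (deg k l).obj Y →ₗ[k] k)
    (h₀ : ∀ l, ¬(a ≤ l ∧ l < b) → φ l = 0)
    (h₁ : ∀ l l' (f : l ≤ l') (z : (deg k l).obj Y), a ≤ l' → l' < b →
      φ l' ((mul k f).app Y z) = φ l z) :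
    Y ⟶ torsion k a b :=
  mkHom (toInterval Y.snd.obj φ h₀ (fun l l' f z h => h₁ l l' (leOfHom f) z h.1 h.2))
    (fun _ => 0) (fun _ i => (isZero_vec_torsion a b i).eq_of_tgt _ _)

lemma torsionVal_toTorsion (a b : ℤ) (φ : ∀ l, (deg k l).obj Y →ₗ[k] k)
    (h₀ : ∀ l, ¬(a ≤ l ∧ l < b) → φ l = 0)
    (h₁ : ∀ l l' (f : l ≤ l') (z : (deg k l).obj Y), a ≤ l' → l' < b →
      φ l' ((mul k f).app Y z) = φ l z) (l : ℤ) (z : (deg k l).obj Y) :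
    torsionVal a b l ((deg k l).map (toTorsion a b φ h₀ h₁) z) = φ l z := rfl

end Hom
end Objects

/-! ### Morphisms and short exact sequences among the basic objects. -/

section Maps

variable {k : Type u} [Field k]

lemma deg_map_mul {X Y : ZDCategory k} (f : X ⟶ Y) {l l' : ℤ} (h : l ≤ l') (z : (deg k l).obj X) :
    (deg k l').map f ((mul k h).app X z) = (mul k h).app Y ((deg k l).map f z) :=
  (ConcreteCategory.congr_hom ((mul k h).naturality f) z).symm

lemma hom_ext_elem {X Y : ZDCategory k} {f g : X ⟶ Y}
    (h : ∀ l (z : (deg k l).obj X), (deg k l).map f z = (deg k l).map g z) : f = g :=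
  hom_ext_deg fun l => ModuleCat.hom_ext (LinearMap.ext (h l))

lemma deg_map_smul {X Y : ZDCategory k} (c : k) (f : X ⟶ Y) (l : ℤ) (z : (deg k l).obj X) :
    (deg k l).map (c • f) z = c • (deg k l).map f z := rfl

lemma deg_map_zero {X Y : ZDCategory k} (l : ℤ) (z : (deg k l).obj X) :
    (deg k l).map (0 : X ⟶ Y) z = 0 := rfl

lemma deg_map_comp {X Y Z : ZDCategory k} (f : X ⟶ Y) (g : Y ⟶ Z) (l : ℤ)
    (z : (deg k l).obj X) : (deg k l).map (f ≫ g) z = (deg k l).map g ((deg k l).map f z) := rfl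

/-- The inclusions between the objects `free k n j`. -/
noncomputable def freeIncl (j : Bool) {a m : ℤ} (h : a ≤ m) : free k m j ⟶ free k a j :=
  toFree a j (freeVec m j) fun l hl z => by
    rw [freeVec_pr, freeVal_eq_zero (hl.trans_le h)]

lemma freeVal_freeIncl (j : Bool) {a m : ℤ} (h : a ≤ m) (l : ℤ) (z : (deg k l).obj (free k m j)) :
    freeVal a j l ((deg k l).map (freeIncl j h) z) = freeVal m j l z :=
  (freeVal_toFree _ _ _ _ _ _).trans (freeVec_pr _ _ _ _)

/-- The projection of `free k n j` to a torsion object. -/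
noncomputable def freeToTorsion (j : Bool) {a n : ℤ} (b : ℤ) (h : a ≤ n) :
    free k n j ⟶ torsion k a b :=
  toTorsion a b (fun l => if l < b then freeVal n j l else 0)
    (fun l hl => by
      split_ifs with h'
      · exact LinearMap.ext fun z => freeVal_eq_zero
          (lt_of_not_ge fun h'' => hl ⟨h.trans h'', h'⟩) j z
      · rfl)
    (fun l l' f z h₁ h₂ => by
      rw [if_pos h₂, if_pos (f.trans_lt h₂), freeVal_mul])

lemma torsionVal_freeToTorsion (j : Bool) {a n : ℤ} (b : ℤ) (h : a ≤ n) (l : ℤ)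
    (z : (deg k l).obj (free k n j)) :
    torsionVal a b l ((deg k l).map (freeToTorsion j b h) z) =
      if l < b then freeVal n j l z else 0 :=
  (torsionVal_toTorsion _ _ _ _ _ _ _).trans (by split_ifs <;> rfl)

/-- The canonical maps between torsion objects. -/
noncomputable def torsionMap {a a' b c : ℤ} (h : a' ≤ a) (h' : b ≤ c) :
    torsion k a c ⟶ torsion k a' b :=
  toTorsion a' b (fun l => if l < b then torsionVal a c l else 0)
    (fun l hl => by
      split_ifs with h''
      · exact LinearMap.ext fun z => torsionVal_eq_zero (fun h₁ => hl ⟨h.trans h₁.1, h''⟩) z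
      · rfl)
    (fun l l' f z h₁ h₂ => by
      rw [if_pos h₂, if_pos (f.trans_lt h₂)]
      by_cases h₃ : a ≤ l'
      · rw [torsionVal_mul f ⟨h₃, h₂.trans_le h'⟩]
      · rw [torsionVal_eq_zero fun h₄ => h₃ h₄.1, torsionVal_eq_zero fun h₄ => h₃ (h₄.1.trans f)])

lemma torsionVal_torsionMap {a a' b c : ℤ} (h : a' ≤ a) (h' : b ≤ c) (l : ℤ)
    (z : (deg k l).obj (torsion k a c)) :
    torsionVal a' b l ((deg k l).map (torsionMap h h') z) =
      if l < b then torsionVal a c l z else 0 :=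
  (torsionVal_toTorsion _ _ _ _ _ _ _).trans (by split_ifs <;> rfl)

/-- The forms are coordinates on spaces of dimension at most one, and `p₁`, `p₃` mark where the
outer terms are nonzero. Exactness becomes a case distinction, which suits the basic objects in a
single degree. -/
lemma shortExact_of_forms (S : ShortComplex (ModuleCat.{u} k)) (v₁ : S.X₁ →ₗ[k] k)
    (v₂ : S.X₂ →ₗ[k] k) (v₃ : S.X₃ →ₗ[k] k) (p₁ p₃ : Prop) [Decidable p₃]
    (i₁ : Function.Injective v₁) (i₂ : Function.Injective v₂) (i₃ : Function.Injective v₃)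
    (h₁ : p₁ → Function.Surjective v₁) (h₂ : p₃ → Function.Surjective v₂)
    (h₂' : ¬ p₁ → ¬ p₃ → v₂ = 0) (h₃ : ¬ p₃ → v₃ = 0)
    (hf : ∀ z, v₂ (S.f z) = v₁ z) (hg : ∀ z, v₃ (S.g z) = if p₃ then v₂ z else 0) :
    S.ShortExact where
  exact := by
    rw [ShortComplex.moduleCat_exact_iff]
    intro z hz
    by_cases hp : p₃
    · have := hg z
      rw [hz, map_zero, if_pos hp] at this
      exact ⟨0, i₂ (by rw [hf, map_zero, this])⟩
    · by_cases hp' : p₁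
      · obtain ⟨y, hy⟩ := h₁ hp' (v₂ z)
        exact ⟨y, i₂ (by rw [hf, hy])⟩
      · exact ⟨0, i₂ (by rw [h₂' hp' hp]; rfl)⟩
  mono_f := by
    rw [ModuleCat.mono_iff_injective]
    intro y z h
    exact i₁ (by rw [← hf, ← hf, h])
  epi_g := by
    rw [ModuleCat.epi_iff_surjective]
    intro y
    by_cases hp : p₃
    · obtain ⟨z, hz⟩ := h₂ hp (v₃ y)
      exact ⟨z, i₃ (by rw [hg, if_pos hp, hz])⟩
    · exact ⟨0, i₃ (by rw [h₃ hp]; rfl)⟩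

variable (k) in
/-- The short exact sequence `0 ⟶ free k m j ⟶ free k a j ⟶ torsion k a m ⟶ 0`. -/
noncomputable abbrev freeSequence (j : Bool) {a m : ℤ} (h : a ≤ m) :
    ShortComplex (ZDCategory k) where
  f := freeIncl j h
  g := freeToTorsion j m le_rfl
  zero := hom_ext_elem fun l z => torsionVal_injective _ _ _ <| by
    rw [deg_map_comp, torsionVal_freeToTorsion, freeVal_freeIncl, deg_map_zero, map_zero]
    split_ifs with h
    · exact freeVal_eq_zero h _ _
    · rfl

lemma freeSequence_shortExact (j : Bool) {a m : ℤ} (h : a ≤ m) :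
    (freeSequence k j h).ShortExact := by
  refine shortExact_of_deg _ fun l => ?_
  refine shortExact_of_forms _ (freeVal m j l) (freeVal a j l) (torsionVal a m l) (m ≤ l)
    (a ≤ l ∧ l < m) (freeVal_injective _ _ _) (freeVal_injective _ _ _)
    (torsionVal_injective _ _ _) (fun h => freeVal_surjective h j)
    (fun h => freeVal_surjective h.1 j) ?_ (fun h => LinearMap.ext (torsionVal_eq_zero h))
    (freeVal_freeIncl j h l) ?_
  · intro h₁ h₂
    exact LinearMap.ext (freeVal_eq_zero (by lia) j)
  · intro z
    refine (torsionVal_freeToTorsion j m le_rfl l z).trans ?_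
    split_ifs with h₁ h₂ h₂
    · rfl
    · exact freeVal_eq_zero (by lia) j z
    · exact absurd h₂.2 h₁
    · rfl

variable (k) in
/-- The short exact sequence `0 ⟶ torsion k b c ⟶ torsion k a c ⟶ torsion k a b ⟶ 0`. -/
noncomputable abbrev torsionSequence {a b c : ℤ} (h : a ≤ b) (h' : b ≤ c) :
    ShortComplex (ZDCategory k) where
  f := torsionMap h (le_refl c)
  g := torsionMap (le_refl a) h'
  zero := hom_ext_elem fun l z => torsionVal_injective _ _ _ <| by
    rw [deg_map_comp, torsionVal_torsionMap, torsionVal_torsionMap, deg_map_zero, map_zero]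
    split_ifs with h h
    · exact torsionVal_eq_zero (by lia) _
    · rfl
    · rfl

lemma torsionSequence_shortExact {a b c : ℤ} (h : a ≤ b) (h' : b ≤ c) :
    (torsionSequence k h h').ShortExact := by
  refine shortExact_of_deg _ fun l => ?_
  refine shortExact_of_forms _ (torsionVal b c l) (torsionVal a c l) (torsionVal a b l)
    (b ≤ l ∧ l < c) (a ≤ l ∧ l < b) (torsionVal_injective _ _ _) (torsionVal_injective _ _ _)
    (torsionVal_injective _ _ _) (fun h => torsionVal_surjective h)
    (fun h => torsionVal_surjective (by lia)) ?_ (fun h => LinearMap.ext (torsionVal_eq_zero h))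
    ?_ ?_
  · intro h₁ h₂
    exact LinearMap.ext (torsionVal_eq_zero (by lia))
  · intro z
    refine (torsionVal_torsionMap h le_rfl l z).trans ?_
    split_ifs with h₁
    · rfl
    · exact (torsionVal_eq_zero (by lia) z).symm
  · intro z
    refine (torsionVal_torsionMap le_rfl h' l z).trans ?_
    split_ifs with h₁ h₂ h₂
    · rfl
    · exact torsionVal_eq_zero (by lia) z
    · exact absurd h₂.2 h₁
    · rfl

lemma freeIncl_comp (j : Bool) {a b c : ℤ} (h : a ≤ b) (h' : b ≤ c) :
    freeIncl (k := k) j h' ≫ freeIncl j h = freeIncl j (h.trans h') :=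
  hom_ext_elem fun l z => freeVal_injective _ _ _ <| by
    rw [deg_map_comp, freeVal_freeIncl, freeVal_freeIncl, freeVal_freeIncl]

lemma freeIncl_freeToTorsion (j : Bool) {a b n : ℤ} (m : ℤ) (h : a ≤ b) (h' : b ≤ n) :
    freeIncl j h' ≫ freeToTorsion j m h = freeToTorsion (k := k) j m (h.trans h') :=
  hom_ext_elem fun l z => torsionVal_injective _ _ _ <| by
    rw [deg_map_comp, torsionVal_freeToTorsion, torsionVal_freeToTorsion, freeVal_freeIncl]

variable (k) in
/-- The generator of `free k n j`. -/
noncomputable def gen (n : ℤ) (j : Bool) : (deg k n).obj (free k n j) :=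
  (freeVal_surjective le_rfl j 1).choose

lemma freeVal_gen (n : ℤ) (j : Bool) : freeVal n j n (gen k n j) = 1 :=
  (freeVal_surjective le_rfl j 1).choose_spec

lemma eq_smul_gen {n : ℤ} {j : Bool} {l : ℤ} (h : n ≤ l) (z : (deg k l).obj (free k n j)) :
    z = freeVal n j l z • (mul k h).app _ (gen k n j) :=
  freeVal_injective _ _ _ (by rw [map_smul, freeVal_mul, freeVal_gen, smul_eq_mul, mul_one])

/-- The graded part is generated by `gen k n j`. Only uniqueness holds: an element of `Y` with a
nonzero component in the other vector space is not the image of the generator. -/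
lemma free_hom_ext {n : ℤ} {j : Bool} {Y : ZDCategory k} {f g : free k n j ⟶ Y}
    (h : (deg k n).map f (gen k n j) = (deg k n).map g (gen k n j)) : f = g := by
  refine hom_ext_elem fun l z => ?_
  by_cases hl : n ≤ l
  · rw [eq_smul_gen hl z, map_smul, map_smul, deg_map_mul, deg_map_mul, h]
  · rw [show z = 0 from freeVal_injective _ _ _
      ((freeVal_eq_zero (not_le.1 hl) _ _).trans (map_zero _).symm), map_zero, map_zero]

lemma free_torsion_eq_zero {n a b : ℤ} {j : Bool} (h : ¬(a ≤ n ∧ n < b))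
    (f : free k n j ⟶ torsion k a b) : f = 0 :=
  free_hom_ext (torsionVal_injective _ _ _ (by
    rw [torsionVal_eq_zero h, torsionVal_eq_zero h]))

lemma free_torsion_eq_smul {n a b : ℤ} {j : Bool} (h : a ≤ n) (h' : n < b)
    (f : free k n j ⟶ torsion k a b) : ∃ c : k, f = c • freeToTorsion j b h :=
  ⟨torsionVal a b n ((deg k n).map f (gen k n j)), free_hom_ext (torsionVal_injective _ _ _ (by
    rw [deg_map_smul, map_smul, torsionVal_freeToTorsion, if_pos h', freeVal_gen, smul_eq_mul,
      mul_one]))⟩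

/-- If `n < m`, the target vanishes in the degree of the generator. If `i ≠ j`, the map on `V_j`
starts from zero, while elements of the target are detected in `V_j`. -/
lemma free_free_eq_zero {n m : ℤ} {i j : Bool} (h : ¬(i = j ∧ m ≤ n))
    (f : free k n i ⟶ free k m j) : f = 0 := by
  refine free_hom_ext (freeVal_injective _ _ _ ?_)
  by_cases hm : m ≤ n
  · have hij : j ≠ i := fun h' => h ⟨h'.symm, hm⟩
    have := ConcreteCategory.congr_hom (pr_naturality f n j) (gen k n i)
    rw [(isZero_vec_free n hij).eq_of_src ((vec k j).map f) 0, comp_zero] at this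
    rw [← freeVec_pr, deg_map_zero, map_zero]
    exact (congrArg (freeVec m j) this).trans (map_zero _)
  · rw [freeVal_eq_zero (not_le.1 hm), freeVal_eq_zero (not_le.1 hm)]

lemma free_free_eq_smul {n m : ℤ} {j : Bool} (h : m ≤ n) (f : free k n j ⟶ free k m j) :
    ∃ c : k, f = c • freeIncl j h :=
  ⟨freeVal m j n ((deg k n).map f (gen k n j)), free_hom_ext (freeVal_injective _ _ _ (by
    rw [deg_map_smul, map_smul, freeVal_freeIncl, freeVal_gen, smul_eq_mul, mul_one]))⟩

lemma freeIncl_ne_zero (j : Bool) {n m : ℤ} (h : m ≤ n) : freeIncl (k := k) j h ≠ 0 := by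
  intro h'
  have := freeVal_freeIncl j h n (gen k n j)
  rw [h', deg_map_zero, map_zero, freeVal_gen] at this
  exact zero_ne_one this

lemma freeToTorsion_ne_zero (j : Bool) {a n b : ℤ} (h : a ≤ n) (h' : n < b) :
    freeToTorsion (k := k) j b h ≠ 0 := by
  intro h''
  have := torsionVal_freeToTorsion j b h n (gen k n j)
  rw [h'', deg_map_zero, map_zero, freeVal_gen, if_pos h'] at this
  exact zero_ne_one this

end Maps

/-! ### Consequences of finite generation, and maps extending monomorphisms. -/

section Finiteness

open Polynomial DirectSum

variable {k : Type u} [Field k]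

lemma mulX_apply_succ (M : GrMod k) (y : ⨁ n : ℤ, M.obj n) (n : ℤ) :
    mulX M y (n + 1) = M.map (homOfLE (by lia : n ≤ n + 1)) (y n) := by
  classical
  induction y using DirectSum.induction_on with
  | zero => rw [map_zero]; exact (map_zero (M.map _).hom).symm
  | add a b ha hb =>
    rw [map_add, DirectSum.add_apply, ha, hb]
    exact ((M.map _).hom.map_add _ _).symm
  | of l w =>
    refine (congrArg (fun z => z (n + 1)) (mulX_lof M l w)).trans ?_
    by_cases h : l = n
    · subst h
      refine (DirectSum.of_eq_same (β := fun n => M.obj n) _ _).trans ?_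
      refine congrArg (M.map _) ?_
      exact (DirectSum.of_eq_same (β := fun n => M.obj n) _ _).symm
    · refine (DirectSum.of_eq_of_ne (β := fun n => M.obj n) _ _ _ (by lia)).trans ?_
      rw [DirectSum.of_eq_of_ne (β := fun n => M.obj n) _ _ _ (by lia)]
      exact (map_zero (M.map _).hom).symm

/-- The generators need not be homogeneous, but the multiples by powers of `x` of their homogeneous
components span each degree. This is shown for all components of an element at once, by induction on
its expression through generators. -/
lemma mem_span_of_generators (M : GrMod k) (S : Set (⨁ n : ℤ, M.obj n))
    (hS : Submodule.span k[X] (Module.AEval'.of (mulX M) '' S) = ⊤) (n : ℤ) (w : M.obj n) :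
    w ∈ Submodule.span k {w | ∃ t ∈ S, ∃ (l : ℤ) (h : l ≤ n), w = M.map (homOfLE h) (t l)} := by
  classical
  have key (y : Total M) (hy : y ∈ Submodule.span k[X] (Module.AEval'.of (mulX M) '' S)) :
      ∀ n, (Module.AEval'.of (mulX M)).symm y n ∈
        Submodule.span k {w | ∃ t ∈ S, ∃ (l : ℤ) (h : l ≤ n), w = M.map (homOfLE h) (t l)} := by
    induction hy using Submodule.span_induction with
    | mem x hx =>
      obtain ⟨t, ht, rfl⟩ := hx
      intro n
      refine Submodule.subset_span ⟨t, ht, n, le_rfl, ?_⟩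
      have : homOfLE (le_refl n) = 𝟙 n := rfl
      rw [this, M.map_id, LinearEquiv.symm_apply_apply]
      rfl
    | zero => intro n; rw [map_zero]; exact zero_mem _
    | add x y _ _ hx hy => intro n; rw [map_add]; exact add_mem (hx n) (hy n)
    | smul p x _ hx =>
      induction p using Polynomial.induction_on' with
      | add p q hp hq => intro n; rw [add_smul, map_add]; exact add_mem (hp n) (hq n)
      | monomial j a =>
        intro n
        rw [← C_mul_X_pow_eq_monomial, mul_smul, Module.AEval.C_smul, map_smul]
        refine Submodule.smul_mem _ _ ?_
        induction j generalizing n with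
        | zero => rw [pow_zero, one_smul]; exact hx n
        | succ j ih =>
          rw [pow_succ', mul_smul, Module.AEval'.of_symm_X_smul]
          obtain ⟨n, rfl⟩ : ∃ m, n = m + 1 := ⟨n - 1, by ring⟩
          rw [mulX_apply_succ]
          have h1 := Submodule.mem_map_of_mem (f := (M.map (homOfLE (by lia : n ≤ n + 1))).hom)
            (ih n)
          rw [Submodule.map_span] at h1
          refine Submodule.span_le.2 ?_ h1
          rintro _ ⟨_, ⟨t, ht, l, h, rfl⟩, rfl⟩
          refine Submodule.subset_span ⟨t, ht, l, by lia, ?_⟩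
          exact (ConcreteCategory.congr_hom (M.map_comp (homOfLE h)
            (homOfLE (by lia : n ≤ n + 1))) (t l)).symm
  have := key (Module.AEval'.of (mulX M) (DirectSum.of (fun n => M.obj n) n w))
    (hS ▸ Submodule.mem_top) n
  rw [LinearEquiv.symm_apply_apply, DirectSum.of_eq_same] at this
  exact this

/-- Finitely many generators have finitely many nonzero homogeneous components, in degrees `U`. A
lower bound of `U` serves as `a` and an upper bound as `b`. -/
lemma exists_bounds (M : GrMod k) (hM : isFG k M) : ∃ a b : ℤ,
    (∀ n < a, Subsingleton (M.obj n)) ∧ (∀ n, Module.Finite k (M.obj n)) ∧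
    ∀ n m (h : n ≤ m), b ≤ n → Function.Surjective (M.map (homOfLE h)) := by
  classical
  obtain ⟨S, hS⟩ := hM
  let S' : Finset (⨁ n : ℤ, M.obj n) := S.image (Module.AEval'.of (mulX M)).symm
  have hS' : Submodule.span k[X] (Module.AEval'.of (mulX M) '' (S' : Set (⨁ n : ℤ, M.obj n))) =
      ⊤ := by
    rw [← hS]
    congr 1
    ext x
    simp [S']
  let U : Finset ℤ := S'.biUnion fun t => t.support
  have hU {t} (ht : t ∈ S') {l : ℤ} (hl : l ∉ U) : t l = 0 := by
    by_contra h
    exact hl (Finset.mem_biUnion.2 ⟨t, ht, DFinsupp.mem_support_toFun _ _ |>.2 h⟩)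
  have hspan := mem_span_of_generators M (S' : Set (⨁ n : ℤ, M.obj n)) hS'
  obtain ⟨a, ha⟩ := U.finite_toSet.bddBelow
  obtain ⟨b, hb⟩ := U.finite_toSet.bddAbove
  refine ⟨a, b, fun n hn => ?_, fun n => ?_, fun n m h hn => ?_⟩
  · refine ⟨fun x y => ?_⟩
    have h0 (w : M.obj n) : w = 0 := by
      refine (Submodule.mem_bot k).1 (Submodule.span_le.2 ?_ (hspan n w))
      rintro _ ⟨t, ht, l, h, rfl⟩
      rw [hU ht fun hl => absurd (ha hl) (by lia)]
      exact map_zero (M.map _).hom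
    rw [h0 x, h0 y]
  · refine Module.finite_def.2 ⟨(S' ×ˢ U).image fun p =>
      if h : p.2 ≤ n then M.map (homOfLE h) (p.1 p.2) else 0, ?_⟩
    rw [eq_top_iff]
    intro w _
    refine Submodule.span_le.2 ?_ (hspan n w)
    rintro _ ⟨t, ht, l, h, rfl⟩
    by_cases hl : l ∈ U
    · refine Submodule.subset_span (Finset.mem_coe.2 (Finset.mem_image.2
        ⟨(t, l), Finset.mem_product.2 ⟨ht, hl⟩, ?_⟩))
      rw [dif_pos h]
    · rw [hU ht hl, (M.map (homOfLE h)).hom.map_zero]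
      exact zero_mem _
  · intro w
    change w ∈ LinearMap.range (M.map (homOfLE h)).hom
    refine Submodule.span_le.2 ?_ (hspan m w)
    rintro _ ⟨t, ht, l, hl', rfl⟩
    by_cases hl : l ∈ U
    · have := hb hl
      exact ⟨M.map (homOfLE (by lia : l ≤ n)) (t l), (ConcreteCategory.congr_hom (M.map_comp
        (homOfLE (by lia : l ≤ n)) (homOfLE h)) (t l)).symm⟩
    · rw [hU ht hl]
      exact ⟨0, (map_zero (M.map _).hom).trans (map_zero (M.map _).hom).symm⟩

lemma mul_mul (X : ZDCategory k) {l m n : ℤ} (h : l ≤ m) (h' : m ≤ n) (z : (deg k l).obj X) :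
    (mul k h').app X ((mul k h).app X z) = (mul k (h.trans h')).app X z :=
  (ConcreteCategory.congr_hom (X.snd.obj.map_comp (homOfLE h) (homOfLE h')) z).symm

lemma mul_refl (X : ZDCategory k) {l : ℤ} (z : (deg k l).obj X) :
    (mul k (le_refl l)).app X z = z :=
  ConcreteCategory.congr_hom (X.snd.obj.map_id l) z

instance finite_deg (X : ZDCategory k) (n : ℤ) : Module.Finite k ((deg k n).obj X) :=
  (exists_bounds X.snd.obj X.snd.property).choose_spec.choose_spec.2.1 n

lemma exists_subsingleton_deg (X : ZDCategory k) :
    ∃ a : ℤ, ∀ n < a, Subsingleton ((deg k n).obj X) :=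
  ⟨_, (exists_bounds X.snd.obj X.snd.property).choose_spec.choose_spec.1⟩

/-- From some degree `b` on `x` is surjective. The kernels of `x ^ j` on the finite-dimensional
space in degree `b` increase and stabilize at some `N`, so `x` is injective from degree `b + N` on.
-/
lemma exists_bijective_mul (X : ZDCategory k) :
    ∃ b : ℤ, ∀ n m (h : n ≤ m), b ≤ n → Function.Bijective ((mul k h).app X) := by
  obtain ⟨b, hb⟩ : ∃ b : ℤ, ∀ n m (h : n ≤ m), b ≤ n → Function.Surjective ((mul k h).app X) :=
    ⟨_, (exists_bounds X.snd.obj X.snd.property).choose_spec.choose_spec.2.2⟩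
  let K : ℕ →o Submodule k ((deg k b).obj X) :=
    { toFun j := LinearMap.ker ((mul k (by lia : b ≤ b + j)).app X).hom
      monotone' i j hij z hz := by
        refine (mul_mul X (by lia : b ≤ b + i) (by lia : b + i ≤ b + j) z).symm.trans ?_
        refine (congrArg _ hz).trans (map_zero ((mul k _).app X).hom) }
  obtain ⟨N, hN⟩ := monotone_stabilizes_iff_noetherian.2 (inferInstanceAs
    (IsNoetherian k ((deg k b).obj X))) K
  refine ⟨b + N, fun n m h hn => ⟨?_, hb n m h (by lia)⟩⟩
  rw [← AddMonoidHom.coe_coe, injective_iff_map_eq_zero]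
  intro z hz
  obtain ⟨y, rfl⟩ := hb b n (by lia) le_rfl z
  obtain ⟨i, rfl⟩ := Int.le.dest (by lia : b ≤ n)
  obtain ⟨j, rfl⟩ := Int.le.dest (by lia : b ≤ m)
  have h1 : y ∈ K j := (mul_mul X (by lia : b ≤ b + i) h y).symm.trans hz
  rw [← hN j (by lia), hN i (by lia)] at h1
  exact h1

lemma exists_dual_eq_one {V : Type*} [AddCommGroup V] [Module k V] {v : V} (h : v ≠ 0) :
    ∃ φ : V →ₗ[k] k, φ v = 1 := by
  by_contra! h'
  refine h ((Module.forall_dual_apply_eq_zero_iff k v).1 fun φ => ?_)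
  by_contra h''
  exact h' ((φ v)⁻¹ • φ) (by simp [h''])

/-- A linear form on `V_j` of `Y` that is `1` on the image of the generator extends the inclusion.
It defines a map to `free k a j` because `Y` vanishes in very low degrees. Thus the `free k a j` for
`a → -∞` jointly act like an injective hull. -/
lemma exists_comp_eq_freeIncl {Y : ZDCategory k} {m : ℤ} {j : Bool} (f : free k m j ⟶ Y) [Mono f] :
    ∃ (a : ℤ) (h : a ≤ m) (g : Y ⟶ free k a j), f ≫ g = freeIncl j h := by
  obtain ⟨a, ha⟩ := exists_subsingleton_deg Y
  have h1 : pr (free k m j) m j (gen k m j) ≠ 0 := fun h => by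
    have := freeVec_pr m j m (gen k m j)
    rw [h, map_zero, freeVal_gen] at this
    exact zero_ne_one this
  have h2 : (vec k j).map f (pr (free k m j) m j (gen k m j)) ≠ 0 := fun h =>
    h1 ((ModuleCat.mono_iff_injective ((vec k j).map f)).1 inferInstance
      (h.trans (map_zero _).symm))
  obtain ⟨φ, hφ⟩ := exists_dual_eq_one (k := k) h2
  refine ⟨min a m, min_le_right _ _, toFree _ j φ fun l hl z => ?_, ?_⟩
  · have := ha l (by lia)
    rw [Subsingleton.elim z 0, map_zero, map_zero]
  · refine free_hom_ext (freeVal_injective _ _ _ ?_)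
    rw [deg_map_comp, freeVal_freeIncl, freeVal_toFree, freeVal_gen]
    exact (congrArg φ (ConcreteCategory.congr_hom (pr_naturality f m j) _)).trans hφ

/-- The morphism to `torsion k a b` given by a linear form in the highest degree. -/
lemma exists_toTorsion {Y : ZDCategory k} (a b : ℤ) (φ : (deg k (b - 1)).obj Y →ₗ[k] k)
    (h : ∀ l < a, ∀ (h' : l ≤ b - 1) (z : (deg k l).obj Y), φ ((mul k h').app Y z) = 0) :
    ∃ g : Y ⟶ torsion k a b, ∀ (l : ℤ) (h : l ≤ b - 1) (z : (deg k l).obj Y),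
      torsionVal a b l ((deg k l).map g z) = φ ((mul k h).app Y z) := by
  refine ⟨toTorsion a b (fun l => if h : l ≤ b - 1 then φ ∘ₗ ((mul k h).app Y).hom else 0)
    (fun l hl => ?_) (fun l l' f z h₁ h₂ => ?_), fun l h z => ?_⟩
  · split_ifs with h'
    · exact LinearMap.ext fun z => h l (by lia) h' z
    · rfl
  · rw [dif_pos (by lia), dif_pos (by lia)]
    exact congrArg φ (mul_mul Y _ _ z)
  · rw [torsionVal_toTorsion, dif_pos h]
    rfl

lemma exists_comp_eq_torsionMap {Y : ZDCategory k} {a b : ℤ} (f : torsion k a b ⟶ Y) [Mono f] :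
    ∃ (a' : ℤ) (h : a' ≤ a) (g : Y ⟶ torsion k a' b), f ≫ g = torsionMap h le_rfl := by
  by_cases hab : a < b
  · obtain ⟨c, hc⟩ := exists_subsingleton_deg Y
    -- The top degree `b - 1` is the socle. A form that is `1` on the image of `t` extends to lower
    -- degrees by composing it with powers of `x`.
    obtain ⟨t, ht⟩ := torsionVal_surjective (k := k) (by lia : a ≤ b - 1 ∧ b - 1 < b) 1
    have h1 : t ≠ 0 := by rintro rfl; simp at ht
    have h2 : (deg k (b - 1)).map f t ≠ 0 := fun h =>
      h1 ((ModuleCat.mono_iff_injective ((deg k (b - 1)).map f)).1 inferInstance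
        (h.trans (map_zero _).symm))
    obtain ⟨φ, hφ⟩ := exists_dual_eq_one (k := k) h2
    obtain ⟨g, hg⟩ := exists_toTorsion (min a c) b φ fun l hl h z => by
      have := hc l (by lia)
      rw [Subsingleton.elim z 0, map_zero, map_zero]
    refine ⟨min a c, min_le_left _ _, g, hom_ext_elem fun l z => torsionVal_injective _ _ _ ?_⟩
    rw [torsionVal_torsionMap, deg_map_comp]
    split_ifs with hl
    · rw [hg l (by lia), ← deg_map_mul,
        show (mul k (by lia : l ≤ b - 1)).app _ z = torsionVal a b l z • t from
          torsionVal_injective _ _ _ (by rw [torsionVal_mul _ (by lia), map_smul, ht]; simp),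
        map_smul, map_smul, hφ]
      simp
    · exact torsionVal_eq_zero (by lia) _
  · refine ⟨a, le_rfl, 0, hom_ext_elem fun l z => torsionVal_injective _ _ _ ?_⟩
    rw [torsionVal_eq_zero (by lia), torsionVal_eq_zero (by lia)]

end Finiteness

/-! ### Connecting classes of short exact sequences. -/

section Connecting

open CategoryTheory.Abelian

variable {C : Type u} [Category.{v} C] [Abelian C] [HasExt.{w} C]

/-- The connecting class of a short exact sequence, and its long exact sequence. -/
lemma exists_connecting {A B D : C} (f : A ⟶ B) (g : B ⟶ D) (w : f ≫ g = 0)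
    (h : (ShortComplex.mk f g w).ShortExact) :
    ∃ δ : Ext D A 1, (Ext.mk₀ g).comp δ (zero_add 1) = 0 ∧
      (∀ (X : C) (l : ℕ) (ξ : Ext X A (l + 1)), ξ.comp (Ext.mk₀ f) (add_zero _) = 0 →
        ∃ y : Ext X D l, y.comp δ rfl = ξ) ∧
      ∀ (X : C) (y : X ⟶ D), (Ext.mk₀ y).comp δ (zero_add 1) = 0 → ∃ z : X ⟶ B, z ≫ g = y := by
  refine ⟨h.extClass, h.comp_extClass, fun X l ξ hξ =>
    Ext.covariant_sequence_exact₁ X h ξ hξ rfl, fun X y hy => ?_⟩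
  obtain ⟨z, hz⟩ := Ext.covariant_sequence_exact₃ X h (Ext.mk₀ y) (zero_add 1) hy
  obtain ⟨z, rfl⟩ := Ext.mk₀_bijective _ _ |>.2 z
  rw [Ext.mk₀_comp_mk₀] at hz
  exact ⟨z, (Ext.mk₀_bijective _ _).1 hz⟩

end Connecting

/-! ### `Ext` groups between the basic objects, and their composition. -/

section ExtComputations

open CategoryTheory.Abelian

variable {k : Type u} [Field k] [HasExt.{w'} (ZDCategory k)]

/-- A vector space spanned by one element. -/
def AtMostOneDim (k : Type*) [Field k] (V : Type*) [AddCommGroup V] [Module k V] : Prop :=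
  ∃ v : V, ∀ w : V, ∃ c : k, w = c • v

/-- The inclusion into `free k a₀ j` factors through a monomorphism that kills `ξ`, and inclusions
for smaller `a` factor through this one. -/
lemma exists_comp_freeIncl_eq_zero {X : ZDCategory k} {l : ℕ} {m : ℤ} {j : Bool}
    (ξ : Ext X (free k m j) (l + 1)) : ∃ a₀ : ℤ, ∀ (a : ℤ) (h : a ≤ m), a ≤ a₀ →
      ξ.comp (Ext.mk₀ (freeIncl j h)) (add_zero _) = 0 := by
  obtain ⟨Y, f, _, hf⟩ := exists_mono_comp_mk₀_eq_zero ξ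
  obtain ⟨a₀, h₀, g, hg⟩ := exists_comp_eq_freeIncl f
  refine ⟨a₀, fun a h ha => ?_⟩
  rw [← freeIncl_comp j ha h₀, ← hg, ← Ext.mk₀_comp_mk₀, ← Ext.mk₀_comp_mk₀,
    ← Ext.comp_assoc_of_third_deg_zero, ← Ext.comp_assoc_of_third_deg_zero, hf, Ext.zero_comp,
    Ext.zero_comp]

lemma exists_comp_torsionMap_eq_zero {X : ZDCategory k} {l : ℕ} {a b : ℤ}
    (ξ : Ext X (torsion k a b) (l + 1)) : ∃ (a' : ℤ) (h : a' ≤ a),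
      ξ.comp (Ext.mk₀ (torsionMap h (le_refl b))) (add_zero _) = 0 := by
  obtain ⟨Y, f, _, hf⟩ := exists_mono_comp_mk₀_eq_zero ξ
  obtain ⟨a', h, g, hg⟩ := exists_comp_eq_torsionMap f
  refine ⟨a', h, ?_⟩
  rw [← hg, ← Ext.mk₀_comp_mk₀, ← Ext.comp_assoc_of_third_deg_zero, hf, Ext.zero_comp]

lemma exists_freeδ (j : Bool) {a m : ℤ} (h : a ≤ m) :
    ∃ δ : Ext (torsion k a m) (free k m j) 1,
      (Ext.mk₀ (freeToTorsion j m (le_refl a))).comp δ (zero_add 1) = 0 ∧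
      (∀ (X : ZDCategory k) (l : ℕ) (ξ : Ext X (free k m j) (l + 1)),
        ξ.comp (Ext.mk₀ (freeIncl j h)) (add_zero _) = 0 →
        ∃ y : Ext X (torsion k a m) l, y.comp δ rfl = ξ) ∧
      ∀ (X : ZDCategory k) (y : X ⟶ torsion k a m), (Ext.mk₀ y).comp δ (zero_add 1) = 0 →
        ∃ z : X ⟶ free k a j, z ≫ freeToTorsion j m le_rfl = y :=
  exists_connecting _ _ _ (freeSequence_shortExact (k := k) j h)

/-- The connecting class of `freeSequence`. -/
noncomputable def freeδ (j : Bool) {a m : ℤ} (h : a ≤ m) : Ext (torsion k a m) (free k m j) 1 :=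
  (exists_freeδ j h).choose

lemma mk₀_comp_freeδ (j : Bool) {a m : ℤ} (h : a ≤ m) :
    (Ext.mk₀ (freeToTorsion j m (le_refl a))).comp (freeδ (k := k) j h) (zero_add 1) = 0 :=
  (exists_freeδ j h).choose_spec.1

lemma exists_comp_freeδ_eq (j : Bool) {a m : ℤ} (h : a ≤ m) {X : ZDCategory k} {l : ℕ}
    (ξ : Ext X (free k m j) (l + 1)) (hξ : ξ.comp (Ext.mk₀ (freeIncl j h)) (add_zero _) = 0) :
    ∃ y : Ext X (torsion k a m) l, y.comp (freeδ j h) rfl = ξ :=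
  (exists_freeδ j h).choose_spec.2.1 X l ξ hξ

lemma exists_comp_freeToTorsion_eq (j : Bool) {a m : ℤ} (h : a ≤ m) {X : ZDCategory k}
    (y : X ⟶ torsion k a m) (hy : (Ext.mk₀ y).comp (freeδ j h) (zero_add 1) = 0) :
    ∃ z : X ⟶ free k a j, z ≫ freeToTorsion j m le_rfl = y :=
  (exists_freeδ j h).choose_spec.2.2 X y hy

omit [HasExt.{w'} (ZDCategory k)] in
lemma hom_torsion_eq_zero {X : ZDCategory k} {a b : ℤ}
    (hX : ∀ n < b, Subsingleton ((deg k n).obj X)) (f : X ⟶ torsion k a b) : f = 0 := by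
  refine hom_ext_elem fun l z => torsionVal_injective _ _ _ ?_
  by_cases hl : l < b
  · have := hX l hl
    rw [Subsingleton.elim z 0, map_zero, map_zero]
    exact (map_zero _).symm
  · rw [torsionVal_eq_zero (by lia), torsionVal_eq_zero (by lia)]

/-- The class dies in `T[a',b)` for some `a' ≤ a`, so it comes from an `Ext` into `T[a',a)` of one
degree less. Degree zero is the base: `X` vanishes in all degrees where `T[a',a)` lives. -/
lemma ext_torsion_eq_zero {X : ZDCategory k} {a : ℤ}
    (hX : ∀ n < a, Subsingleton ((deg k n).obj X)) {b : ℤ} (hab : a ≤ b) (l : ℕ)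
    (ξ : Ext X (torsion k a b) (l + 1)) : ξ = 0 := by
  induction l generalizing a b with
  | zero =>
    obtain ⟨a', h, hξ⟩ := exists_comp_torsionMap_eq_zero ξ
    obtain ⟨δ, -, hδ, -⟩ := exists_connecting _ _ _ (torsionSequence_shortExact (k := k) h hab)
    obtain ⟨y, rfl⟩ := hδ X _ ξ hξ
    obtain ⟨f, rfl⟩ := Ext.mk₀_bijective _ _ |>.2 y
    rw [hom_torsion_eq_zero hX f, Ext.mk₀_zero, Ext.zero_comp]
  | succ l ih =>
    obtain ⟨a', h, hξ⟩ := exists_comp_torsionMap_eq_zero ξ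
    obtain ⟨δ, -, hδ, -⟩ := exists_connecting _ _ _ (torsionSequence_shortExact (k := k) h hab)
    obtain ⟨y, rfl⟩ := hδ X _ ξ hξ
    rw [ih (fun n hn => hX n (by lia)) h y, Ext.zero_comp]

lemma ext_free_eq_zero {X : ZDCategory k} {m : ℤ} {j : Bool} (l : ℕ)
    (ξ : Ext X (free k m j) (l + 2)) : ξ = 0 := by
  obtain ⟨c, hc⟩ := exists_subsingleton_deg X
  obtain ⟨a₀, h₀⟩ := exists_comp_freeIncl_eq_zero ξ
  -- The lower end must lie below `m` for the sequence to exist, below `c` so that `X` vanishes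
  -- under it, and below `a₀` so that `ξ` dies.
  have h : min m (min c a₀) ≤ m := min_le_left _ _
  obtain ⟨y, rfl⟩ := exists_comp_freeδ_eq j h ξ (h₀ _ h (by lia))
  rw [ext_torsion_eq_zero (fun n hn => hc n (by lia)) h l y, Ext.zero_comp]

lemma exists_mk₀_comp_freeδ_eq {X : ZDCategory k} {m : ℤ} {j : Bool} (ξ : Ext X (free k m j) 1) :
    ∃ a₀ : ℤ, ∀ (a : ℤ) (h : a ≤ m), a ≤ a₀ → ∃ f : X ⟶ torsion k a m,
      (Ext.mk₀ f).comp (freeδ j h) (zero_add 1) = ξ := by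
  obtain ⟨a₀, h₀⟩ := exists_comp_freeIncl_eq_zero ξ
  refine ⟨a₀, fun a h ha => ?_⟩
  obtain ⟨y, rfl⟩ := exists_comp_freeδ_eq j h (l := 0) ξ (h₀ _ h ha)
  obtain ⟨f, rfl⟩ := Ext.mk₀_bijective _ _ |>.2 y
  exact ⟨f, rfl⟩

/-- The class in `Ext¹(free k n i, free k m j)` obtained from the extension of `torsion k a m` by
`free k m j`. -/
noncomputable def freeExt {a n m : ℤ} (i j : Bool) (h : a ≤ n) (h' : a ≤ m) :
    Ext (free k n i) (free k m j) 1 :=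
  (Ext.mk₀ (freeToTorsion i m h)).comp (freeδ j h') (zero_add 1)

lemma mk₀_freeIncl_comp_freeExt {a n n' m : ℤ} (i j : Bool) (h : a ≤ n) (h' : a ≤ m)
    (h'' : n ≤ n') : (Ext.mk₀ (freeIncl (k := k) i h'')).comp (freeExt i j h h') (zero_add 1) =
      freeExt i j (h.trans h'') h' := by
  rw [freeExt, Ext.mk₀_comp_mk₀_assoc, freeIncl_freeToTorsion]
  rfl

/-- A class is the connecting class pulled back along a map `F(n,i) → T[a,m)`. For `m ≤ n` there is
no nonzero such map. For `i = j` it is a multiple of the projection, which lifts to `F(a,j)`. -/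
lemma ext_free_free_eq_zero {n m : ℤ} {i j : Bool} (h : ¬(i ≠ j ∧ n < m))
    (ξ : Ext (free k n i) (free k m j) 1) : ξ = 0 := by
  obtain ⟨a₀, h₀⟩ := exists_mk₀_comp_freeδ_eq ξ
  have ha : min m (min n a₀) ≤ m := min_le_left _ _
  have ha' : min m (min n a₀) ≤ n := (min_le_right _ _).trans (min_le_left _ _)
  obtain ⟨f, rfl⟩ := h₀ _ ha (by lia)
  by_cases hnm : n < m
  · obtain rfl : i = j := by
      by_contra hij
      exact h ⟨hij, hnm⟩
    obtain ⟨c, rfl⟩ := free_torsion_eq_smul ha' hnm f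
    rw [← freeIncl_freeToTorsion i m le_rfl ha', Ext.mk₀_smul, Ext.smul_comp,
      ← Ext.mk₀_comp_mk₀, Ext.comp_assoc_of_second_deg_zero]
    rw [mk₀_comp_freeδ, Ext.comp_zero, smul_zero]
  · rw [free_torsion_eq_zero (by lia) f, Ext.mk₀_zero, Ext.zero_comp]

lemma exists_eq_smul_freeExt {n m : ℤ} {i j : Bool} (hnm : n < m)
    (ξ : Ext (free k n i) (free k m j) 1) : ∃ a₀ : ℤ, ∀ (a : ℤ) (h : a ≤ n), a ≤ a₀ →
      ∃ c : k, ξ = c • freeExt i j h (h.trans hnm.le) := by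
  obtain ⟨a₀, h₀⟩ := exists_mk₀_comp_freeδ_eq ξ
  refine ⟨a₀, fun a h ha => ?_⟩
  obtain ⟨f, rfl⟩ := h₀ _ (h.trans hnm.le) ha
  obtain ⟨c, rfl⟩ := free_torsion_eq_smul h hnm f
  exact ⟨c, by rw [Ext.mk₀_smul, Ext.smul_comp]; rfl⟩

/-- If the class were zero, the nonzero map to torsion would lift to a map `F(n,i) → F(a,j)`, which
is zero for `i ≠ j`. -/
lemma freeExt_ne_zero {a n m : ℤ} {i j : Bool} (hij : i ≠ j) (h : a ≤ n) (hnm : n < m) :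
    freeExt (k := k) i j h (h.trans hnm.le) ≠ 0 := by
  intro h₀
  obtain ⟨f, hf⟩ := exists_comp_freeToTorsion_eq j (h.trans hnm.le) _ h₀
  rw [free_free_eq_zero (by tauto) f, zero_comp] at hf
  exact freeToTorsion_ne_zero i h hnm hf.symm

omit [HasExt.{w'} (ZDCategory k)] in
lemma atMostOneDim_hom_free (n m : ℤ) (i j : Bool) :
    AtMostOneDim k (free k n i ⟶ free k m j) := by
  by_cases h : i = j ∧ m ≤ n
  · obtain ⟨rfl, h⟩ := h
    exact ⟨freeIncl i h, free_free_eq_smul h⟩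
  · exact ⟨0, fun f => ⟨0, by rw [free_free_eq_zero h f, smul_zero]⟩⟩

lemma atMostOneDim_ext_free (n m : ℤ) (i j : Bool) :
    AtMostOneDim k (Ext (free k n i) (free k m j) 1) := by
  by_cases h : i ≠ j ∧ n < m
  · obtain ⟨hij, h⟩ := h
    refine ⟨freeExt i j (le_refl n) h.le, fun ξ => ?_⟩
    -- The class `freeExt` is built with an auxiliary lower end. Both `ξ` and the proposed generator
    -- are expressed with one common, sufficiently small lower end.
    obtain ⟨a₀, h₀⟩ := exists_eq_smul_freeExt h ξ
    obtain ⟨a₁, h₁⟩ := exists_eq_smul_freeExt h (freeExt (k := k) i j (le_refl n) h.le)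
    have ha : min n (min a₀ a₁) ≤ n := min_le_left _ _
    obtain ⟨c, hc⟩ := h₀ _ ha (by lia)
    obtain ⟨d, hd⟩ := h₁ _ ha (by lia)
    have hd0 : d ≠ 0 := by
      rintro rfl
      rw [zero_smul] at hd
      exact freeExt_ne_zero hij le_rfl h hd
    refine ⟨c * d⁻¹, ?_⟩
    rw [hc, hd, smul_smul, mul_assoc, inv_mul_cancel₀ hd0, mul_one]
  · exact ⟨0, fun ξ => ⟨0, by rw [ext_free_free_eq_zero h ξ, smul_zero]⟩⟩

lemma exists_ext_free_ne_zero {n m : ℤ} {i j : Bool} (hij : i ≠ j) (hnm : n < m) :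
    ∃ ξ : Ext (free k n i) (free k m j) 1, ξ ≠ 0 :=
  ⟨_, freeExt_ne_zero hij le_rfl hnm⟩

/-- The composition of nonzero elements of `Hom(free k n i, free k m j)` and of
`Ext¹(free k m j, free k (n + 1) (!i))` is nonzero. -/
lemma mk₀_comp_ne_zero {n m : ℤ} {i j : Bool} {f : free k n i ⟶ free k m j} (hf : f ≠ 0)
    {ξ : Ext (free k m j) (free k (n + 1) (!i)) 1} (hξ : ξ ≠ 0) :
    (Ext.mk₀ f).comp ξ (zero_add 1) ≠ 0 := by
  obtain ⟨rfl, h⟩ : i = j ∧ m ≤ n := by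
    by_contra h
    exact hf (free_free_eq_zero h f)
  obtain ⟨c, rfl⟩ := free_free_eq_smul h f
  have hm : m < n + 1 := by lia
  obtain ⟨a₀, h₀⟩ := exists_eq_smul_freeExt hm ξ
  obtain ⟨d, rfl⟩ := h₀ (min m a₀) (min_le_left _ _) (min_le_right _ _)
  rw [Ext.mk₀_smul, Ext.smul_comp, Ext.comp_smul, mk₀_freeIncl_comp_freeExt]
  refine smul_ne_zero (left_ne_zero_of_smul hf) (smul_ne_zero (left_ne_zero_of_smul hξ) ?_)
  exact freeExt_ne_zero (by simp) _ (by lia)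

/-- The composition of nonzero elements of `Ext¹(free k n i, free k m j)` and of
`Hom(free k m j, free k (n + 1) (!i))` is nonzero. -/
lemma comp_mk₀_ne_zero {n m : ℤ} {i j : Bool} {ξ : Ext (free k n i) (free k m j) 1} (hξ : ξ ≠ 0)
    {f : free k m j ⟶ free k (n + 1) (!i)} (hf : f ≠ 0) :
    ξ.comp (Ext.mk₀ f) (add_zero 1) ≠ 0 := by
  obtain ⟨rfl, h⟩ : j = !i ∧ n + 1 ≤ m := by
    by_contra h
    exact hf (free_free_eq_zero h f)
  obtain ⟨c, rfl⟩ := free_free_eq_smul h f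
  rw [Ext.mk₀_smul, Ext.comp_smul]
  refine smul_ne_zero (left_ne_zero_of_smul hf) fun h₀ => hξ ?_
  -- A class killed by the inclusion into `F(n+1,!i)` comes from a map `F(n,i) → T[n+1,m)`, and
  -- there is none because the generator sits in degree `n`.
  obtain ⟨y, rfl⟩ := exists_comp_freeδ_eq (!i) h (l := 0) ξ h₀
  obtain ⟨g, rfl⟩ := Ext.mk₀_bijective _ _ |>.2 y
  rw [free_torsion_eq_zero (by lia) g, Ext.mk₀_zero, Ext.zero_comp]

end ExtComputations

/-! ### Every object is built from the free ones. -/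

section Generation

variable {k : Type u} [Field k]

/-- A property of objects such that two of the three objects in a short exact sequence having it
implies that the third has it, in two of the three possible cases. -/
structure IsExactClosed {C : Type u} [Category.{v} C] [Abelian C] (Q : C → Prop) : Prop where
  middle {S : ShortComplex C} (hS : S.ShortExact) : Q S.X₁ → Q S.X₃ → Q S.X₂
  cokernel {S : ShortComplex C} (hS : S.ShortExact) : Q S.X₁ → Q S.X₂ → Q S.X₃

/-- A sum of dimensions that decreases when an object is replaced by a proper subobject. -/
noncomputable def size (Y : ZDCategory k) (a b : ℤ) : ℕ :=
  ∑ n ∈ Finset.Icc a b, Module.finrank k ((deg k n).obj Y)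

/-- The graded module vanishes below degree `a` and `x` is bijective from degree `b` on. -/
def IsBounded (Y : ZDCategory k) (a b : ℤ) : Prop :=
  (∀ n < a, Subsingleton ((deg k n).obj Y)) ∧
    ∀ n m (h : n ≤ m), b ≤ n → Function.Bijective ((mul k h).app Y)

lemma exists_isBounded (Y : ZDCategory k) : ∃ a b : ℤ, IsBounded Y a b := by
  obtain ⟨a, ha⟩ := exists_subsingleton_deg Y
  obtain ⟨b, hb⟩ := exists_bijective_mul Y
  exact ⟨a, b, ha, hb⟩

section Kernel

variable {Y T : ZDCategory k} (g : Y ⟶ T)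

lemma deg_kernel_ι_injective (l : ℤ) : Function.Injective ((deg k l).map (kernel.ι g)) :=
  (ModuleCat.mono_iff_injective _).1 inferInstance

lemma deg_map_kernel_ι (l : ℤ) (z : (deg k l).obj (kernel g)) :
    (deg k l).map g ((deg k l).map (kernel.ι g) z) = 0 := by
  rw [← deg_map_comp, kernel.condition]
  rfl

lemma shortExact_kernel [Epi g] :
    (ShortComplex.mk (kernel.ι g) g (kernel.condition g)).ShortExact where
  exact := ShortComplex.exact_of_f_is_kernel _ (kernelIsKernel g)

lemma exists_deg_kernel_ι_eq {l : ℤ} (z : (deg k l).obj Y) (hz : (deg k l).map g z = 0) :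
    ∃ z', (deg k l).map (kernel.ι g) z' = z := by
  have h : (ShortComplex.mk (kernel.ι g) g (kernel.condition g)).Exact :=
    ShortComplex.exact_of_f_is_kernel _ (kernelIsKernel g)
  exact (ShortComplex.moduleCat_exact_iff _).1 (h.map (deg k l)) z hz

/-- The bounds stay fixed so that `size` can be compared. Injectivity of `x` on `T` ensures that the
preimage under `x` of a kernel element is again in the kernel. -/
lemma IsBounded.kernel {a b : ℤ} (hY : IsBounded Y a b)
    (hT : ∀ n m (h : n ≤ m), b ≤ n → Function.Injective ((mul k h).app T)) :
    IsBounded (kernel g) a b := by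
  refine ⟨fun n hn => ?_, fun n m h hn => ⟨fun z z' hz => ?_, fun z => ?_⟩⟩
  · have := hY.1 n hn
    exact (deg_kernel_ι_injective g n).subsingleton
  · refine deg_kernel_ι_injective g n ((hY.2 n m h hn).1 ?_)
    rw [← deg_map_mul, ← deg_map_mul, hz]
  · obtain ⟨y, hy⟩ := (hY.2 n m h hn).2 ((deg k m).map (kernel.ι g) z)
    have h0 : (deg k n).map g y = 0 := by
      apply hT n m h hn
      rw [← deg_map_mul, hy, deg_map_kernel_ι]
      exact (map_zero _).symm
    obtain ⟨z', rfl⟩ := exists_deg_kernel_ι_eq g y h0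
    refine ⟨z', deg_kernel_ι_injective g m ?_⟩
    rw [deg_map_mul, hy]

lemma size_kernel_lt {a b n : ℤ} (han : a ≤ n) (hnb : n ≤ b) (z : (deg k n).obj Y)
    (hz : (deg k n).map g z ≠ 0) : size (kernel g) a b < size Y a b := by
  refine Finset.sum_lt_sum (fun l _ => ?_) ⟨n, Finset.mem_Icc.2 ⟨han, hnb⟩, ?_⟩
  · exact LinearMap.finrank_le_finrank_of_injective (deg_kernel_ι_injective g l)
  · rw [← LinearMap.finrank_range_of_inj (f := ((deg k n).map (kernel.ι g)).hom)
      (deg_kernel_ι_injective g n)]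
    refine Submodule.finrank_lt fun h => hz ?_
    obtain ⟨z', rfl⟩ : z ∈ LinearMap.range ((deg k n).map (kernel.ι g)).hom := h ▸ trivial
    exact deg_map_kernel_ι g n z'

end Kernel

/-- Every nonzero object has a nonzero map onto one of the basic objects. -/
lemma exists_epi {Y : ZDCategory k} {a b : ℤ} (hY : IsBounded Y a b) (h : ¬ IsZero Y) :
    ∃ (T : ZDCategory k) (g : Y ⟶ T), Epi g ∧
      ((∃ n, T = torsion k n (n + 1)) ∨ ∃ n j, T = free k n j) ∧
      (∀ n m (h : n ≤ m), b ≤ n → Function.Injective ((mul k h).app T)) ∧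
      ∃ n, a ≤ n ∧ n ≤ b ∧ ∃ z, (deg k n).map g z ≠ 0 := by
  classical
  obtain ⟨n₀, h₀, hn₀⟩ : ∃ n, Nontrivial ((deg k n).obj Y) ∧ n ≤ b := by
    by_contra! h'
    refine h (isZero_of_deg fun n => ?_)
    have : Subsingleton ((deg k n).obj Y) := by
      by_cases hn : n ≤ b
      · by_contra h''
        rw [not_subsingleton_iff_nontrivial] at h''
        exact absurd hn (not_le.2 (h' n h''))
      · have : Subsingleton ((deg k b).obj Y) := by
          by_contra h''
          rw [not_subsingleton_iff_nontrivial] at h''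
          exact absurd le_rfl (not_le.2 (h' b h''))
        exact (hY.2 b n (by lia) le_rfl).2.subsingleton
    exact ModuleCat.isZero_of_subsingleton _
  have ha {n} (hn : Nontrivial ((deg k n).obj Y)) : a ≤ n := by
    by_contra h'
    exact not_subsingleton _ (hY.1 n (not_le.1 h'))
  obtain ⟨n, hn, hmin⟩ : ∃ n, Nontrivial ((deg k n).obj Y) ∧
      ∀ l, Nontrivial ((deg k l).obj Y) → n ≤ l :=
    Int.exists_least_of_bdd ⟨a, fun _ => ha⟩ ⟨n₀, h₀⟩
  have hlow {l} (hl : l < n) : Subsingleton ((deg k l).obj Y) := by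
    by_contra h''
    rw [not_subsingleton_iff_nontrivial] at h''
    exact absurd hl (not_lt.2 (hmin l h''))
  have hnb : n ≤ b := (hmin _ h₀).trans hn₀
  obtain ⟨z, hz⟩ := exists_ne (0 : (deg k n).obj Y)
  -- Let `n` be the lowest nonzero degree. If `n < b`, project onto a simple torsion object in
  -- degree `n`, which is zero from degree `b` on. If `n = b`, then `x` is injective on `Y`, so `z`
  -- survives in some `V_j` and a form there gives a map onto `free k n j`.
  rcases hnb.lt_or_eq with hnb' | rfl
  · obtain ⟨c, rfl⟩ : ∃ c, n = c - 1 := ⟨n + 1, by ring⟩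
    obtain ⟨φ, hφ⟩ := exists_dual_eq_one (k := k) hz
    obtain ⟨g, hg⟩ := exists_toTorsion (c - 1) c φ fun l hl _ z => by
      have := hlow hl
      rw [Subsingleton.elim z 0, map_zero, map_zero]
    have hg' (y) : torsionVal (c - 1) c (c - 1) ((deg k (c - 1)).map g y) = φ y := by
      rw [hg _ le_rfl, mul_refl]
    refine ⟨_, g, epi_of_deg g fun l => (ModuleCat.epi_iff_surjective _).2 fun t => ?_,
      Or.inl ⟨c - 1, by rw [sub_add_cancel]⟩, fun l m h hl x y _ => ?_, c - 1, ha hn, hnb, z, ?_⟩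
    · by_cases hl : l = c - 1
      · subst hl
        exact ⟨torsionVal _ _ _ t • z, torsionVal_injective _ _ _ (by
          rw [hg', map_smul, hφ, smul_eq_mul, mul_one])⟩
      · exact ⟨0, torsionVal_injective _ _ _ (by
          rw [torsionVal_eq_zero (by lia), torsionVal_eq_zero (by lia)])⟩
    · exact torsionVal_injective _ _ _ (by
        rw [torsionVal_eq_zero (by lia), torsionVal_eq_zero (by lia)])
    · intro h0
      have := hg' z
      rw [h0, map_zero, hφ] at this
      exact zero_ne_one this
  · obtain ⟨j, hj⟩ : ∃ j, pr Y n j z ≠ 0 := by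
      by_contra! h0
      obtain ⟨m, h, hm⟩ := exists_mul_eq_zero Y z h0
      exact hz ((hY.2 n m h le_rfl).1 (hm.trans (map_zero _).symm))
    obtain ⟨φ, hφ⟩ := exists_dual_eq_one (k := k) hj
    have hlow' (l) (hl : l < n) (z) : φ (pr Y l j z) = 0 := by
      have := hlow hl
      rw [Subsingleton.elim z 0, map_zero, map_zero]
    refine ⟨_, toFree n j φ hlow',
      epi_of_deg _ fun l => (ModuleCat.epi_iff_surjective _).2 fun t => ?_,
      Or.inr ⟨n, j, rfl⟩, fun l m h hl x y hxy => ?_, n, ha hn, le_rfl, z, ?_⟩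
    · by_cases hl : n ≤ l
      · refine ⟨freeVal _ _ _ t • (mul k hl).app Y z, freeVal_injective _ _ _ ?_⟩
        have := ConcreteCategory.congr_hom (mul_pr Y hl j) z
        rw [freeVal_toFree, map_smul, map_smul]
        refine (congrArg (fun y => _ • φ y) this).trans ?_
        rw [hφ, smul_eq_mul, mul_one]
      · exact ⟨0, freeVal_injective _ _ _ (by
          rw [freeVal_eq_zero (by lia), freeVal_eq_zero (by lia)])⟩
    · exact freeVal_injective _ _ _ (by rw [← freeVal_mul _ _ h, hxy, freeVal_mul])
    · intro h0
      have := freeVal_toFree n j φ hlow' n z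
      rw [h0, map_zero, hφ] at this
      exact zero_ne_one this

/-- Induction on `size`: split off a basic quotient and apply the hypothesis to the kernel. Simple
torsion objects are cokernels of maps between free ones, and a zero object is the cokernel of an
identity. -/
lemma IsExactClosed.prop_of_free {Q : ZDCategory k → Prop} (hQ : IsExactClosed Q)
    (h : ∀ n j, Q (free k n j)) (Y : ZDCategory k) : Q Y := by
  have htors (n : ℤ) : Q (torsion k n (n + 1)) :=
    hQ.cokernel (freeSequence_shortExact false (by lia : n ≤ n + 1)) (h _ _) (h _ _)
  have hzero {Z : ZDCategory k} (hZ : IsZero Z) : Q Z := by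
    have : (ShortComplex.mk (𝟙 (free k 0 false)) (0 : _ ⟶ Z) comp_zero).ShortExact :=
      { exact := (ShortComplex.exact_iff_epi _ rfl).2 inferInstance
        mono_f := inferInstance
        epi_g := ⟨fun _ _ _ => hZ.eq_of_src _ _⟩ }
    exact hQ.cokernel this (h 0 false) (h 0 false)
  obtain ⟨a, b, hY⟩ := exists_isBounded Y
  induction hs : size Y a b using Nat.strong_induction_on generalizing Y with
  | _ N ih =>
    subst hs
    by_cases h0 : IsZero Y
    · exact hzero h0
    · obtain ⟨T, g, _, hT, hT', n, han, hnb, z, hz⟩ := exists_epi hY h0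
      refine hQ.middle (shortExact_kernel g) (ih _ (size_kernel_lt g han hnb z hz) _
        (hY.kernel g hT') rfl) ?_
      obtain ⟨n, rfl⟩ | ⟨n, j, rfl⟩ := hT
      · exact htors n
      · exact h n j

end Generation

/-! ### The bounded derived category: dévissage to single objects and comparison with `Ext`. -/

section BoundedDerived

open DerivedCategory Pretriangulated

variable {k : Type u} [Field k] {C : Type u₁} [Category.{v₁} C] [Abelian C]
  [HasDerivedCategory.{w} C]

section ConeClosed

variable {D : Type*} [Category D] [Preadditive D] [HasZeroObject D] [HasShift D ℤ]
  [∀ n : ℤ, (shiftFunctor D n).Additive] [Pretriangulated D]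

lemma IsConeClosed.middle {P : D → Prop} (hP : IsConeClosed P) {X Y Z : D} {f : X ⟶ Y} {g : Y ⟶ Z}
    {h : Z ⟶ X⟦(1 : ℤ)⟧} (hT : Triangle.mk f g h ∈ distTriang D) (hX : P X) (hZ : P Z) : P Y :=
  hP.cone (inv_rot_of_distTriang _ hT) (hP.shift (-1) hZ) hX

end ConeClosed

variable (C) in
/-- The inclusion of the bounded derived category. -/
noncomputable abbrev boundedι : BoundedDerivedCategory C ⥤ DerivedCategory C :=
  (TStructure.t (C := C)).bounded.ι

/-- The inclusion commutes with shifts only up to isomorphism, so the third map is corrected by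
`commShiftIso`. -/
lemma exists_distinguished {X Y Z : BoundedDerivedCategory C} {f : X.obj ⟶ Y.obj}
    {g : Y.obj ⟶ Z.obj} {h : Z.obj ⟶ X.obj⟦(1 : ℤ)⟧}
    (hT : Triangle.mk f g h ∈ distTriang (DerivedCategory C)) :
    ∃ (f' : X ⟶ Y) (g' : Y ⟶ Z) (h' : Z ⟶ X⟦(1 : ℤ)⟧),
      Triangle.mk f' g' h' ∈ distTriang (BoundedDerivedCategory C) := by
  refine ⟨ObjectProperty.homMk f, ObjectProperty.homMk g,
    ObjectProperty.homMk (h ≫ ((boundedι C).commShiftIso (1 : ℤ)).inv.app X), ?_⟩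
  refine isomorphic_distinguished _ hT _ (Triangle.isoMk _ _ (Iso.refl _) (Iso.refl _)
    (Iso.refl _) ?_ ?_ ?_)
  · exact (Category.comp_id _).trans (Category.id_comp _).symm
  · exact (Category.comp_id _).trans (Category.id_comp _).symm
  · have h₁ : (h ≫ ((boundedι C).commShiftIso (1 : ℤ)).inv.app X) ≫
        ((boundedι C).commShiftIso (1 : ℤ)).hom.app X = h :=
      (Category.assoc _ _ _).trans ((congrArg (h ≫ ·)
        (((boundedι C).commShiftIso (1 : ℤ)).inv_hom_id_app X)).trans (Category.comp_id h))
    have h₂ : (𝟙 X.obj)⟦(1 : ℤ)⟧' = 𝟙 (X.obj⟦(1 : ℤ)⟧) := CategoryTheory.Functor.map_id _ _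
    exact (congrArg₂ (· ≫ ·) h₁ h₂).trans ((Category.comp_id h).trans (Category.id_comp h).symm)

namespace IsConeClosed

variable {P : BoundedDerivedCategory C → Prop} (hP : IsConeClosed P)
  (h : ∀ (Y : C) (h), P ⟨(singleFunctor C 0).obj Y, h⟩)

include hP h

lemma prop_of_isGE_of_isLE_self (a : ℤ) (X : BoundedDerivedCategory C) (h₁ : X.obj.IsGE a)
    (h₂ : X.obj.IsLE a) : P X := by
  have := TStructure.t.isLE_shift X.obj a a 0
  have := TStructure.t.isGE_shift X.obj a a 0
  obtain ⟨Y, ⟨e⟩⟩ := exists_iso_singleFunctor_obj_of_isGE_of_isLE (X.obj⟦a⟧) 0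
  have h₁ : TStructure.t.bounded ((singleFunctor C 0).obj Y) :=
    ⟨⟨0, inferInstance⟩, ⟨0, inferInstance⟩⟩
  have e' : (⟨(singleFunctor C 0).obj Y, h₁⟩ : BoundedDerivedCategory C) ≅ X⟦a⟧ :=
    TStructure.t.bounded.fullyFaithfulι.preimageIso
      (e.symm ≪≫ ((boundedι C).commShiftIso a).symm.app X)
  exact hP.iso (shiftShiftNeg X a) (hP.shift (-a) (hP.iso e' (h Y h₁)))

/-- Induction on the cohomological amplitude: the truncation triangle cuts off the lowest
cohomology. -/
lemma prop_of_isGE_of_isLE (n : ℕ) :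
    ∀ (a : ℤ) (X : BoundedDerivedCategory C), X.obj.IsGE a → X.obj.IsLE (a + n) → P X := by
  induction n with
  | zero =>
    intro a X h₁ h₂
    rw [Nat.cast_zero, add_zero] at h₂
    exact hP.prop_of_isGE_of_isLE_self h a X h₁ h₂
  | succ n ih =>
    intro a X h₁ h₂
    have hT := TStructure.t.triangleLTGE_distinguished (a + 1) X.obj
    have i₁ : ((TStructure.t.truncLT (a + 1)).obj X.obj).IsGE a := inferInstance
    have i₂ : ((TStructure.t.truncLT (a + 1)).obj X.obj).IsLE a :=
      TStructure.t.isLE_truncLT_obj _ _ _ (by simp)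
    have i₃ : ((TStructure.t.truncGE (a + 1)).obj X.obj).IsGE (a + 1) := inferInstance
    have i₄ : ((TStructure.t.truncGE (a + 1)).obj X.obj).IsLE (a + 1 + n) := by
      have : X.obj.IsLE (a + 1 + n) := by
        rw [show a + 1 + n = a + (n + 1 : ℕ) by push_cast; ring]
        exact h₂
      infer_instance
    obtain ⟨f, g, h', hT'⟩ := exists_distinguished
      (X := ⟨_, ⟨a, i₁⟩, ⟨_, i₂⟩⟩) (Y := X) (Z := ⟨_, ⟨a + 1, i₃⟩, ⟨_, i₄⟩⟩) hT
    exact hP.middle hT' (hP.prop_of_isGE_of_isLE_self h a _ i₁ i₂) (ih _ _ i₃ i₄)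

lemma prop_of_single (X : BoundedDerivedCategory C) : P X := by
  obtain ⟨⟨a, ha⟩, ⟨b, hb⟩⟩ := X.property
  exact hP.prop_of_isGE_of_isLE h (b - a).toNat a X ha
    (TStructure.t.isLE_of_le X.obj b _ (by lia))

end IsConeClosed

variable (C) in
/-- The functor sending an object to the corresponding complex in degree zero. -/
noncomputable def boundedSingle : C ⥤ BoundedDerivedCategory C :=
  (TStructure.t (C := C)).bounded.lift (singleFunctor C 0)
    fun _ => ⟨⟨0, inferInstance⟩, ⟨0, inferInstance⟩⟩

lemma isExactClosed_boundedSingle {P : BoundedDerivedCategory C → Prop} (hP : IsConeClosed P) :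
    IsExactClosed fun Y : C => P ((boundedSingle C).obj Y) where
  middle {S} hS h₁ h₃ := by
    obtain ⟨f, g, h, hT⟩ := exists_distinguished (X := (boundedSingle C).obj S.X₁)
      (Y := (boundedSingle C).obj S.X₂) (Z := (boundedSingle C).obj S.X₃)
      hS.singleTriangle_distinguished
    exact hP.middle hT h₁ h₃
  cokernel {S} hS h₁ h₂ := by
    obtain ⟨f, g, h, hT⟩ := exists_distinguished (X := (boundedSingle C).obj S.X₁)
      (Y := (boundedSingle C).obj S.X₂) (Z := (boundedSingle C).obj S.X₃)
      hS.singleTriangle_distinguished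
    exact hP.cone hT h₁ h₂

lemma boundedSingle_negative_eq_zero {X Y : C} {n : ℤ} (hn : n < 0)
    (f : (boundedSingle C).obj X ⟶ ((boundedSingle C).obj Y)⟦n⟧) : f = 0 := by
  apply (boundedι C).map_injective
  rw [Functor.map_zero, ← cancel_mono (((boundedι C).commShiftIso n).hom.app _), zero_comp]
  have := TStructure.t.isGE_shift ((singleFunctor C 0).obj Y) 0 n (-n)
  exact TStructure.t.zero (X := (singleFunctor C 0).obj X) (Y := ((singleFunctor C 0).obj Y)⟦n⟧)
    _ 0 (-n)

section Linear

variable [Linear k C]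

instance (n : ℤ) : (shiftFunctor (BoundedDerivedCategory C) n).Linear k where
  map_smul {X Y} f r := by
    apply (boundedι C).map_injective
    have h (g : X ⟶ Y) := ((boundedι C).commShiftIso n).hom.naturality g
    dsimp only [Functor.comp_map] at h
    rw [← cancel_mono (((boundedι C).commShiftIso n).hom.app Y), h, Functor.map_smul,
      Functor.map_smul, Functor.map_smul, Linear.smul_comp, h, Linear.comp_smul]

variable (k) in
/-- Morphisms in the bounded derived category are those of the derived category. -/
noncomputable def boundedHomEquiv (A B : BoundedDerivedCategory C) :
    (A.obj ⟶ B.obj) ≃ₗ[k] (A ⟶ B) where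
  toFun := ObjectProperty.homMk
  invFun f := f.hom
  map_add' _ _ := rfl
  map_smul' _ _ := rfl
  left_inv _ := rfl
  right_inv _ := rfl

variable (k) in
/-- The functor `boundedSingle C` is fully faithful. -/
noncomputable def boundedSingleHomEquiv (X Y : C) :
    (X ⟶ Y) ≃ₗ[k] ((boundedSingle C).obj X ⟶ (boundedSingle C).obj Y) :=
  (LinearEquiv.ofBijective
    { toFun f := (singleFunctor C 0).map f
      map_add' _ _ := Functor.map_add _
      map_smul' _ _ := Functor.map_smul _ _ _ }
    ⟨(singleFunctor C 0).map_injective, (singleFunctor C 0).map_surjective⟩).trans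
    (boundedHomEquiv k ((boundedSingle C).obj X) ((boundedSingle C).obj Y))

variable [HasExt.{w'} C]

open Abelian

variable (k) in
/-- `Ext` groups as morphisms in the bounded derived category. -/
noncomputable def extEquiv (X Y : C) (n : ℕ) :
    Ext X Y n ≃ₗ[k] ((boundedSingle C).obj X ⟶ ((boundedSingle C).obj Y)⟦(n : ℤ)⟧) :=
  (Ext.homLinearEquiv (R := k)).trans
    ((homCongrRight k ((singleFunctor C 0).obj X)
      (((boundedι C).commShiftIso (n : ℤ)).symm.app ((boundedSingle C).obj Y))).trans
      (boundedHomEquiv k ((boundedSingle C).obj X) (((boundedSingle C).obj Y)⟦(n : ℤ)⟧)))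

lemma map_extEquiv {X Y : C} {n : ℕ} (ξ : Ext X Y n) :
    (boundedι C).map (extEquiv k X Y n ξ) =
      ξ.hom ≫ ((boundedι C).commShiftIso (n : ℤ)).inv.app ((boundedSingle C).obj Y) :=
  rfl

lemma extEquiv_mk₀_comp {X Y Z : C} {n : ℕ} (f : X ⟶ Y) (ξ : Ext Y Z n) :
    extEquiv k X Z n ((Ext.mk₀ f).comp ξ (zero_add n)) =
      (boundedSingle C).map f ≫ extEquiv k Y Z n ξ := by
  apply (boundedι C).map_injective
  rw [Functor.map_comp, map_extEquiv, map_extEquiv, ← Ext.singleFunctor_map_comp_hom]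
  exact Category.assoc _ _ _

lemma extEquiv_comp_mk₀ {X Y Z : C} {n : ℕ} (ξ : Ext X Y n) (f : Y ⟶ Z) :
    extEquiv k X Z n (ξ.comp (Ext.mk₀ f) (add_zero n)) =
      extEquiv k X Y n ξ ≫ ((boundedSingle C).map f)⟦(n : ℤ)⟧' := by
  apply (boundedι C).map_injective
  rw [Functor.map_comp, map_extEquiv, map_extEquiv, ← Ext.hom_comp_singleFunctor_map_shift]
  have h := ((boundedι C).commShiftIso (n : ℤ)).inv.naturality ((boundedSingle C).map f)
  exact ((Category.assoc _ _ _).trans (congrArg (ξ.hom ≫ ·) h)).trans (Category.assoc _ _ _).symm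

end Linear

end BoundedDerived

/-! ### Spaces of dimension at most one and their pairings. -/

section AtMostOneDim

variable {k : Type*} [Field k] {V W : Type*} [AddCommGroup V] [Module k V] [AddCommGroup W]
  [Module k W]

lemma AtMostOneDim.of_equiv (h : AtMostOneDim k V) (e : V ≃ₗ[k] W) : AtMostOneDim k W := by
  obtain ⟨v, hv⟩ := h
  refine ⟨e v, fun w => ?_⟩
  obtain ⟨c, hc⟩ := hv (e.symm w)
  exact ⟨c, by rw [← map_smul, ← hc, e.apply_symm_apply]⟩

lemma AtMostOneDim.finite (h : AtMostOneDim k V) : Module.Finite k V := by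
  obtain ⟨v, hv⟩ := h
  refine Module.Finite.of_surjective (LinearMap.toSpanSingleton k V v) fun w => ?_
  obtain ⟨c, hc⟩ := hv w
  exact ⟨c, by rw [LinearMap.toSpanSingleton_apply, hc]⟩

lemma AtMostOneDim.exists_smul_eq (h : AtMostOneDim k V) {v : V} (hv : v ≠ 0) (w : V) :
    ∃ c : k, c • v = w := by
  obtain ⟨x, hx⟩ := h
  obtain ⟨a, rfl⟩ := hx v
  obtain ⟨b, rfl⟩ := hx w
  exact ⟨b * a⁻¹, by rw [smul_smul, inv_mul_cancel_right₀ (left_ne_zero_of_smul hv)]⟩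

lemma AtMostOneDim.exists_injective (h : AtMostOneDim k V) :
    ∃ φ : V →ₗ[k] k, ∀ v, v ≠ 0 → φ v ≠ 0 := by
  by_cases h₀ : ∃ v : V, v ≠ 0
  · obtain ⟨v, hv⟩ := h₀
    obtain ⟨φ, hφ⟩ := exists_dual_eq_one (k := k) hv
    refine ⟨φ, fun w hw => ?_⟩
    obtain ⟨c, rfl⟩ := h.exists_smul_eq hv w
    rw [map_smul, hφ, smul_eq_mul, mul_one]
    exact left_ne_zero_of_smul hw
  · exact ⟨0, fun v hv => (h₀ ⟨v, hv⟩).elim⟩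

/-- A pairing between spaces of the same dimension at most one is perfect if it is nonzero on
pairs of nonzero vectors. -/
lemma bijective_of_atMostOneDim (b : V →ₗ[k] Module.Dual k W) (hW : AtMostOneDim k W)
    (hb : ∀ v w, v ≠ 0 → w ≠ 0 → b v w ≠ 0)
    (h : (∃ v : V, v ≠ 0) ↔ ∃ w : W, w ≠ 0) : Function.Bijective b := by
  by_cases h₀ : ∃ v : V, v ≠ 0
  · obtain ⟨v, hv⟩ := h₀
    obtain ⟨w, hw⟩ := h.1 ⟨v, hv⟩
    refine ⟨(injective_iff_map_eq_zero b).2 fun x hx => ?_, fun φ => ⟨(φ w / b v w) • v, ?_⟩⟩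
    · by_contra hx'
      exact hb x w hx' hw (by rw [hx, LinearMap.zero_apply])
    · refine LinearMap.ext fun x => ?_
      obtain ⟨c, rfl⟩ := hW.exists_smul_eq hw x
      have := hb v w hv hw
      simp only [map_smul, LinearMap.smul_apply, smul_eq_mul]
      field_simp
  · have hV' : Subsingleton V := subsingleton_iff.2 fun x y => by
      by_contra hxy
      exact h₀ ⟨x - y, sub_ne_zero.2 hxy⟩
    have hW' : Subsingleton W := subsingleton_iff.2 fun x y => by
      by_contra hxy
      exact h₀ (h.2 ⟨x - y, sub_ne_zero.2 hxy⟩)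
    exact ⟨fun _ _ _ => Subsingleton.elim _ _, fun φ => ⟨0, Subsingleton.elim _ _⟩⟩

lemma exists_ne_zero_congr (e : V ≃ₗ[k] W) : (∃ v : V, v ≠ 0) ↔ ∃ w : W, w ≠ 0 :=
  ⟨fun ⟨v, hv⟩ => ⟨e v, e.map_ne_zero_iff.2 hv⟩,
    fun ⟨w, hw⟩ => ⟨e.symm w, e.symm.map_ne_zero_iff.2 hw⟩⟩

end AtMostOneDim

/-! ### Compatibility of `Ext` products with shifts. -/

section Generic

open CategoryTheory.Abelian

variable (k : Type u) [Field k] {C : Type u₁} [Category.{v₁} C] [Abelian C] [Linear k C]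
  [HasDerivedCategory.{w} C] (X Y Z : C)

/-- `boundedSingleHomEquiv`, with a shift by zero in the target. -/
noncomputable def homShiftZeroEquiv :
    (X ⟶ Y) ≃ₗ[k] ((boundedSingle C).obj X ⟶ ((boundedSingle C).obj Y)⟦(0 : ℤ)⟧) :=
  (boundedSingleHomEquiv k X Y).trans
    (homCongrRight k _ ((shiftFunctorZero _ ℤ).symm.app ((boundedSingle C).obj Y)))

/-- `boundedSingleHomEquiv`, with a shift of both objects. -/
noncomputable def shiftHomSingleEquiv (n : ℤ) :
    (X ⟶ Y) ≃ₗ[k] (((boundedSingle C).obj X)⟦n⟧ ⟶ ((boundedSingle C).obj Y)⟦n⟧) :=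
  (boundedSingleHomEquiv k X Y).trans (shiftHomEquiv k _ _ n)

variable [HasExt.{w'} C]

/-- `extEquiv`, with a shift by zero in the source. -/
noncomputable def shiftZeroExtEquiv (n : ℕ) :
    Ext X Y n ≃ₗ[k]
      (((boundedSingle C).obj X)⟦(0 : ℤ)⟧ ⟶ ((boundedSingle C).obj Y)⟦(n : ℤ)⟧) :=
  (extEquiv k X Y n).trans
    (homCongrLeft k _ ((shiftFunctorZero _ ℤ).app ((boundedSingle C).obj X)))

variable {X Y Z}

lemma homShiftZeroEquiv_comp {n : ℕ} (f : X ⟶ Y) (ξ : Ext Y Z n) :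
    homShiftZeroEquiv k X Y f ≫ shiftZeroExtEquiv k Y Z n ξ =
      extEquiv k X Z n ((Ext.mk₀ f).comp ξ (zero_add n)) := by
  rw [extEquiv_mk₀_comp]
  let e := (shiftFunctorZero (BoundedDerivedCategory C) ℤ).app ((boundedSingle C).obj Y)
  have h (g : (boundedSingle C).obj X ⟶ (boundedSingle C).obj Y)
      (g' : (boundedSingle C).obj Y ⟶ ((boundedSingle C).obj Z)⟦(n : ℤ)⟧) :
      (g ≫ e.inv) ≫ e.hom ≫ g' = g ≫ g' := by
    rw [Category.assoc, Iso.inv_hom_id_assoc]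
  exact h _ _

lemma extEquiv_comp_shiftHomSingleEquiv {n : ℕ} (ξ : Ext X Y n) (f : Y ⟶ Z) :
    extEquiv k X Y n ξ ≫ shiftHomSingleEquiv k Y Z n f =
      extEquiv k X Z n (ξ.comp (Ext.mk₀ f) (add_zero n)) :=
  (extEquiv_comp_mk₀ ξ f).symm

end Generic

/-! ### Serre duality on the generators, and the conclusion. -/

section SerreDuality

open CategoryTheory.Abelian

variable {k : Type u} [Field k] [HasDerivedCategory.{w} (ZDCategory k)]

variable (k) in
/-- The objects `free k n j` in the bounded derived category. -/
noncomputable abbrev freeObj (p : ℤ × Bool) : BoundedDerivedCategory (ZDCategory k) :=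
  (boundedSingle (ZDCategory k)).obj (free k p.1 p.2)

variable (k) in
/-- The value of the Serre functor at `freeObj k p`. -/
noncomputable abbrev serreObj (p : ℤ × Bool) : BoundedDerivedCategory (ZDCategory k) :=
  (freeObj k (p.1 + 1, !p.2))⟦((1 : ℕ) : ℤ)⟧

lemma generates_freeObj : Generates (freeObj k) := fun _ hP h =>
  hP.prop_of_single fun Y _ => (isExactClosed_boundedSingle hP).prop_of_free
    (fun n j => h (n, j)) Y

variable [HasExt.{w'} (ZDCategory k)]

lemma subsingleton_hom_freeObj (p q : ℤ × Bool) {l : ℤ} (h₀ : l ≠ 0) (h₁ : l ≠ 1) :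
    Subsingleton (freeObj k p ⟶ (freeObj k q)⟦l⟧) := by
  refine subsingleton_of_forall_eq 0 fun f => ?_
  by_cases hl : l < 0
  · exact boundedSingle_negative_eq_zero hl f
  · obtain ⟨n, rfl⟩ : ∃ n : ℕ, l = (n + 2 : ℕ) := ⟨(l - 2).toNat, by lia⟩
    obtain ⟨ξ, rfl⟩ := (extEquiv k _ _ _).surjective f
    rw [ext_free_eq_zero n ξ, map_zero]

/-- Shifting back by `l` turns these into morphisms of degree `1 - l` between generators, and `l ↦ 1
- l` preserves the pair of degrees `0`, `1`. -/
lemma subsingleton_hom_serreObj (p q : ℤ × Bool) {l : ℤ} (h₀ : l ≠ 0) (h₁ : l ≠ 1) :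
    Subsingleton ((freeObj k q)⟦l⟧ ⟶ serreObj k p) := by
  let e : ((freeObj k (p.1 + 1, !p.2))⟦1 - l⟧)⟦l⟧ ≅ serreObj k p :=
    ((shiftFunctorAdd' _ (1 - l) l ((1 : ℕ) : ℤ) (by simp)).app _).symm
  have : Subsingleton (freeObj k q ⟶ (freeObj k (p.1 + 1, !p.2))⟦1 - l⟧) :=
    subsingleton_hom_freeObj _ _ (by lia) (by lia)
  exact ((shiftHomEquiv k _ _ l).trans (homCongrRight k _ e)).toEquiv.symm.subsingleton

omit [HasDerivedCategory.{w} (ZDCategory k)] [HasExt.{w'} (ZDCategory k)] in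
lemma exists_hom_free_ne_zero_iff {n m : ℤ} {i j : Bool} :
    (∃ f : free k n i ⟶ free k m j, f ≠ 0) ↔ i = j ∧ m ≤ n := by
  refine ⟨fun ⟨f, hf⟩ => ?_, ?_⟩
  · by_contra h
    exact hf (free_free_eq_zero h f)
  · rintro ⟨rfl, h⟩
    exact ⟨_, freeIncl_ne_zero i h⟩

omit [HasDerivedCategory.{w} (ZDCategory k)] in
lemma exists_ext_free_ne_zero_iff {n m : ℤ} {i j : Bool} :
    (∃ ξ : Ext (free k n i) (free k m j) 1, ξ ≠ 0) ↔ i ≠ j ∧ n < m := by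
  refine ⟨fun ⟨ξ, hξ⟩ => ?_, fun h => exists_ext_free_ne_zero h.1 h.2⟩
  by_contra h
  exact hξ (ext_free_free_eq_zero h ξ)

lemma extFinitePair_freeObj (p q : ℤ × Bool) : ExtFinitePair k (freeObj k p) (freeObj k q) := by
  refine ⟨fun n => ?_, Set.Finite.subset (Set.toFinite {0, 1}) fun n hn => ?_⟩
  · by_cases h₀ : n = 0
    · subst h₀
      exact ((atMostOneDim_hom_free _ _ _ _).of_equiv
        (homShiftZeroEquiv k (free k p.1 p.2) (free k q.1 q.2))).finite
    by_cases h₁ : n = 1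
    · subst h₁
      exact ((atMostOneDim_ext_free _ _ _ _).of_equiv (extEquiv k _ _ 1)).finite
    have := subsingleton_hom_freeObj p q (k := k) h₀ h₁
    infer_instance
  · by_contra h
    have h' : n ≠ 0 ∧ n ≠ 1 := by simpa using h
    exact not_nontrivial_iff_subsingleton.2 (subsingleton_hom_freeObj p q h'.1 h'.2) hn

lemma bijective_serrePairing_freeObj (p q : ℤ × Bool) (η : (freeObj k p ⟶ serreObj k p) →ₗ[k] k)
    (hη : ∀ f, f ≠ 0 → η f ≠ 0) (l : ℤ) :
    Function.Bijective (serrePairing η ((freeObj k q)⟦l⟧)) := by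
  have hbool : p.2 = q.2 ↔ q.2 ≠ !p.2 := by cases p.2 <;> cases q.2 <;> simp
  by_cases h₀ : l = 0
  · subst h₀
    let e₁ := homShiftZeroEquiv k (free k p.1 p.2) (free k q.1 q.2)
    let e₂ := shiftZeroExtEquiv k (free k q.1 q.2) (free k (p.1 + 1) (!p.2)) 1
    refine bijective_of_atMostOneDim _ ((atMostOneDim_ext_free _ _ _ _).of_equiv e₂)
      (fun f g hf hg => ?_) ?_
    · obtain ⟨f, rfl⟩ := e₁.surjective f
      obtain ⟨g, rfl⟩ := e₂.surjective g
      have h : e₁ f ≫ e₂ g = _ := homShiftZeroEquiv_comp k f g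
      rw [serrePairing_apply, h]
      exact hη _ ((LinearEquiv.map_ne_zero_iff _).2
        (mk₀_comp_ne_zero (e₁.map_ne_zero_iff.1 hf) (e₂.map_ne_zero_iff.1 hg)))
    -- The two nonvanishing conditions agree since there are only two indices and `m ≤ n` means `m <
    -- n + 1`.
    · rw [← exists_ne_zero_congr e₁, ← exists_ne_zero_congr e₂, exists_hom_free_ne_zero_iff,
        exists_ext_free_ne_zero_iff, hbool, Int.lt_add_one_iff]
  by_cases h₁ : l = ((1 : ℕ) : ℤ)
  · subst h₁
    let e₁ := extEquiv k (free k p.1 p.2) (free k q.1 q.2) 1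
    let e₂ := shiftHomSingleEquiv k (free k q.1 q.2) (free k (p.1 + 1) (!p.2)) ((1 : ℕ) : ℤ)
    refine bijective_of_atMostOneDim _ ((atMostOneDim_hom_free _ _ _ _).of_equiv e₂)
      (fun f g hf hg => ?_) ?_
    · obtain ⟨f, rfl⟩ := e₁.surjective f
      obtain ⟨g, rfl⟩ := e₂.surjective g
      have h : e₁ f ≫ e₂ g = _ := extEquiv_comp_shiftHomSingleEquiv k f g
      rw [serrePairing_apply, h]
      exact hη _ ((LinearEquiv.map_ne_zero_iff _).2
        (comp_mk₀_ne_zero (e₁.map_ne_zero_iff.1 hf) (e₂.map_ne_zero_iff.1 hg)))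
    · rw [← exists_ne_zero_congr e₁, ← exists_ne_zero_congr e₂, exists_hom_free_ne_zero_iff,
        exists_ext_free_ne_zero_iff, Ne, hbool, not_not, Int.add_one_le_iff]
  · have := subsingleton_hom_freeObj p q (k := k) h₀ h₁
    have := subsingleton_hom_serreObj p q (k := k) h₀ h₁
    exact ⟨fun _ _ _ => Subsingleton.elim _ _, fun φ => ⟨0, Subsingleton.elim _ _⟩⟩

variable (k) in
lemma abelianExtFinite : AbelianExtFinite.{w'} k (ZDCategory k) := by
  intro X Y
  have h := generates_freeObj.extFinitePair (extFinitePair_freeObj (k := k))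
    ((boundedSingle _).obj X) ((boundedSingle _).obj Y)
  have (n : ℕ) : Module.Finite k (Ext X Y n) :=
    have := h.1 n
    Module.Finite.equiv (extEquiv k X Y n).symm
  refine finite_directSum ((h.2.preimage Nat.cast_injective.injOn).subset fun n hn => ?_)
  have : Nontrivial (Ext X Y n) := hn
  exact (extEquiv k X Y n).symm.toEquiv.nontrivial

variable (k) in
lemma triangulatedSerreDuality :
    TriangulatedSerreDuality k (BoundedDerivedCategory (ZDCategory k)) := by
  -- The trace forms: on a space of dimension at most one there is a functional that is nonzero on
  -- nonzero vectors.
  choose η hη using fun p : ℤ × Bool =>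
    ((atMostOneDim_ext_free p.1 (p.1 + 1) p.2 (!p.2)).of_equiv
      (extEquiv k (free k p.1 p.2) (free k (p.1 + 1) (!p.2)) 1)).exists_injective
  refine generates_freeObj.triangulatedSerreDuality extFinitePair_freeObj (serreObj k)
    -- The generator `q` is the dual of the one obtained by lowering the degree and swapping the
    -- index, shifted back by one.
    (fun q => ⟨(q.1 - 1, !q.2), -1, ?_⟩) η
    fun p q l => bijective_serrePairing_freeObj p q (η p) (hη p) l
  have h : freeObj k (q.1 - 1 + 1, !!q.2) = freeObj k q := by
    rw [Int.sub_add_cancel, Bool.not_not]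
  exact ⟨(shiftFunctorCompIsoId _ ((1 : ℕ) : ℤ) (-1) (by simp)).app _ ≪≫ eqToIso h⟩

end SerreDuality
end ZDInf

theorem theorem3p6 (k : Type u) [Field k] [HasDerivedCategory.{w} (ZDInf.ZDCategory k)]
    [CategoryTheory.HasExt.{w'} (ZDInf.ZDCategory k)] :
    ZDInf.SatisfiesSerreDuality.{w, w'} k (ZDInf.ZDCategory k) :=
  ⟨ZDInf.abelianExtFinite k, ZDInf.triangulatedSerreDuality k⟩
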